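/- **Setting.** Let $g\ge 2$, $N=8g-4$, indices modulo $N$, and let $\Gamma\backslash\mathbb D$ be a closed surface of genus $g$, where the Fuchsian group $\Gamma$ acts freely on the unit disk $\mathbb D$ by Möbius transformations. Let $\mathcal F$ be an $N$-sided fundamental polygon of $\Gamma$ with vertices $V_1,\dots,V_N$ in counterclockwise order, side $i$ joining $V_i$ to $V_{i+1}$. The oriented geodesic extending side $i$ goes from $P_i$ to $Q_{i+1}$ on $\mathbb S=\partial\mathbb D$, and the counterclockwise order on $\mathbb S$ is $P_1,Q_1,P_2,Q_2,\dots,P_N,Q_N$. Let $\sigma(i)=4g-i$ for odd $i$, $\sigma(i)=2-i$ for even $i$, $\rho(i)=\sigma(i)+1$, $\tau(i)=i+4g-2$. The group $\Gamma$ is generated by Möbius transformations $T_1,\dots,T_N$ with $T_iV_i=V_{\rho(i)}$, $T_{\sigma(i)}T_i=\mathrm{Id}$, $T_{\rho^3(i)}T_{\rho^2(i)}T_{\rho(i)}T_i=\mathrm{Id}$, and the geodesics extending the sides of $\mathcal F$ never meet the interior of a set $\gamma\mathcal F$, $\gamma\in\Gamma$. Arcs $[a,b]$, $[a,b)$ of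 $\mathbb S$ run counterclockwise from $a$ to $b$ ($[a,a]=\{a\}$, $[a,a)=\emptyset$). A parameter choice is $B=\{B_1,\dots,B_N\}$ with $B_i\in[P_i,Q_i]$. Put $f_B(x)=T_i(x)$ for $x\in[B_i,B_{i+1})$ and $F_B(u,w)=(T_iu,T_iw)$ for $w\in[B_i,B_{i+1})$. Let $\phi(x,y)=(y,x)$. The choice $A$ is extremal if $A_i\in\{P_i,Q_i\}$ for all $i$. **Theorem.** Let $A$ be extremal. There are unique points $G_1,\dots,G_N$ such that, for all $i$, $G_i\in[P_i,P_{i+1}]$; $G_{\sigma(i)}=T_iG_{i-2}$ if $A_i=P_i$; and $G_{\sigma(i)}=T_{\tau(i)+1}G_{\tau(i)}$ if $A_i=Q_i$. Put $H_i=T_{\sigma(i-1)}T_{\tau(i)}G_{\tau(i)-1}$, $D_i=T_{\tau\sigma(i)+1}G_{\tau\sigma(i)}$, and $$\Omega_A=\bigcup_{i}\;[H_{i+1},G_{i-2}]\times[P_i,Q_i]\;\cup\;[H_{i+1},G_{i-1}]\times[Q_i,P_{i+1}],$$ $$\Omega_D=\bigcup_{i}\;[Q_{i+2},P_{i-1}]\times[D_i,D_{i+1}]\;\cup\;[P_{i-1},P_i]\times[H_i,D_{i+1}]\;\cup\;[Q_{i+1},Q_{i+2}]\times[D_i,G_i],$$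 and let $\Omega_A^\circ,\Omega_D^\circ$ be given by the same formulas with every arc $[a,b]$ replaced by $[a,b)$. Then $D=\{D_i\}$ is a parameter choice, and it is dual to $A$ in the following sense. 1. For $B\in\{A,D\}$: $\Omega_B$ is a finite union of products of nondegenerate closed arcs and misses the diagonal; $F_B(\Omega_B)\subseteq\Omega_B$; $\operatorname{int}\Omega_B\subseteq\Omega_B^\circ\subseteq\Omega_B$; and $F_B$ restricts to a bijection of $\Omega_B^\circ$ onto itself. 2. $\phi(\Omega_A)=\Omega_D$ and $\phi(\Omega_A^\circ)=\Omega_D^\circ$. 3. $\phi(F_A^{-1}(p))=F_D(\phi(p))$ for all $p\in\Omega_A^\circ$, where $F_A^{-1}$ is the inverse of the bijection $F_A:\Omega_A^\circ\to\Omega_A^\circ$. Moreover, for every $p=(u,w)\in\Omega_A$ with $u\notin D$, every $q=(u',w')\in\Omega_A$ with $F_A(q)=p$ and $w'\notin A$ satisfies $\phi(q)=F_D(\phi(p))$. Consequently, let $(u_k,w_k)_{k\in\mathbb Z}$ be an orbit of $F_A$ (that is, $F_A(u_k,w_k)=(u_{k+1},w_{k+1})$) that lies in $\Omega_A^\circ$,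 or that lies in $\Omega_A$ and has $w_k\notin A$ and $u_k\notin D$ for all $k$. Let $(n_k)_{k\in\mathbb Z}$ be its $A$-code: $n_k=\sigma(i)$ for the $i$ with $w_k\in[A_i,A_{i+1})$. Then, for every $k\ge0$, $n_k=\sigma(i)$ for the $i$ with $f_A^{k}(w_0)\in[A_i,A_{i+1})$, and $n_{-k-1}$ is the index $i$ with $f_D^{k}(u_0)\in[D_i,D_{i+1})$. So the past of the $A$-code of a geodesic is the future of its $D$-code. -/

import Mathlib

/-! ### The closed disk, its Möbius transformations, arcs and geodesics -/

/-- The closed unit disk, i.e. the hyperbolic disk together with its circle at infinity. -/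
abbrev ClosedDisk : Type := ↥(Metric.closedBall (0 : ℂ) 1)

/-- The Möbius transformations `z ↦ (a z + b) / (b̄ z + ā)`, `|b| < |a|`, of the closed disk:
the orientation-preserving isometries of the hyperbolic disk, extended to the boundary. -/
def IsDiskMobius (e : Equiv.Perm ClosedDisk) : Prop :=
  ∃ a b : ℂ, ‖b‖ < ‖a‖ ∧ ∀ z : ClosedDisk,
    ((e z : ClosedDisk) : ℂ) =
      (a * (z : ℂ) + b) / ((starRingEnd ℂ) b * (z : ℂ) + (starRingEnd ℂ) a)

theorem diskMobius_denom_ne {a b : ℂ} (h : ‖b‖ < ‖a‖) {z : ℂ} (hz : ‖z‖ ≤ 1) :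
    (starRingEnd ℂ) b * z + (starRingEnd ℂ) a ≠ 0 := by
  intro h0
  have h1 : (starRingEnd ℂ) a = -((starRingEnd ℂ) b * z) := by
    rw [eq_neg_iff_add_eq_zero, add_comm]; exact h0
  have h2 : ‖a‖ = ‖b‖ * ‖z‖ := by
    rw [← Complex.norm_conj a, h1, norm_neg, norm_mul, Complex.norm_conj]
  nlinarith [norm_nonneg b, norm_nonneg z]

theorem closedDisk_norm_le (z : ClosedDisk) : ‖(z : ℂ)‖ ≤ 1 := by
  have h := z.2
  rwa [mem_closedBall_zero_iff] at h

theorem diskMobius_comp_norm {a b c d : ℂ} (h : ‖b‖ < ‖a‖) (h' : ‖d‖ < ‖c‖) :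
    ‖a * d + b * (starRingEnd ℂ) c‖ < ‖a * c + b * (starRingEnd ℂ) d‖ := by
  have key : ∀ x y : ℂ, ‖y‖ < ‖x‖ ↔ Complex.normSq y < Complex.normSq x := by
    intro x y
    rw [Complex.normSq_eq_norm_sq, Complex.normSq_eq_norm_sq]
    exact (sq_lt_sq₀ (norm_nonneg y) (norm_nonneg x)).symm
  rw [key] at h h' ⊢
  have e : Complex.normSq (a * c + b * (starRingEnd ℂ) d)
      - Complex.normSq (a * d + b * (starRingEnd ℂ) c)
      = (Complex.normSq a - Complex.normSq b) * (Complex.normSq c - Complex.normSq d) := by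
    simp [Complex.normSq_apply]; ring
  have := mul_pos (sub_pos.2 h) (sub_pos.2 h')
  linarith

/-- The group of orientation-preserving isometries of the hyperbolic disk. -/
def diskMobius : Subgroup (Equiv.Perm ClosedDisk) where
  carrier := {e | IsDiskMobius e}
  one_mem' := ⟨1, 0, by simp, fun z => by simp⟩
  mul_mem' := by
    rintro e f ⟨a, b, h, he⟩ ⟨c, d, h', hf⟩
    refine ⟨a * c + b * (starRingEnd ℂ) d, a * d + b * (starRingEnd ℂ) c,
      diskMobius_comp_norm h h', fun z => ?_⟩
    have hz := closedDisk_norm_le z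
    have hfz := closedDisk_norm_le (f z)
    have n1 := diskMobius_denom_ne h' hz
    have n2 := diskMobius_denom_ne h hfz
    have n3 := diskMobius_denom_ne (diskMobius_comp_norm h h') hz
    rw [Equiv.Perm.mul_apply, he (f z)]
    have hq := hf z
    rw [eq_div_iff n1] at hq
    rw [div_eq_div_iff n2 n3]
    simp only [map_add, map_mul, Complex.conj_conj]
    linear_combination (a * (starRingEnd ℂ) a - b * (starRingEnd ℂ) b) * hq
  inv_mem' := by
    rintro e ⟨a, b, h, he⟩
    have h' : ‖-b‖ < ‖(starRingEnd ℂ) a‖ := by rwa [norm_neg, Complex.norm_conj]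
    refine ⟨(starRingEnd ℂ) a, -b, h', fun w => ?_⟩
    obtain ⟨z, rfl⟩ := e.surjective w
    have hz := closedDisk_norm_le z
    have n1 := diskMobius_denom_ne h hz
    have n3 := diskMobius_denom_ne h' (closedDisk_norm_le (e z))
    have hi : e⁻¹ (e z) = z := e.symm_apply_apply z
    have hq := he z
    rw [eq_div_iff n1] at hq
    rw [hi, eq_div_iff n3]
    simp only [map_neg, Complex.conj_conj]
    linear_combination -hq

/-- A point of the circle at infinity as a point of the closed disk. -/
def Circle.toClosedDisk (x : Circle) : ClosedDisk := ⟨(x : ℂ), by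
  rw [mem_closedBall_zero_iff, Circle.norm_coe]⟩

theorem diskMobius_norm_boundary (T : diskMobius) (x : Circle) :
    ‖(((T : Equiv.Perm ClosedDisk) x.toClosedDisk : ClosedDisk) : ℂ)‖ = 1 := by
  obtain ⟨a, b, h, hT⟩ := T.2
  rw [hT]
  have hx : ‖(x : ℂ)‖ = 1 := Circle.norm_coe x
  have n1 := diskMobius_denom_ne h hx.le
  have e : a * (x : ℂ) + b
      = (x : ℂ) * (starRingEnd ℂ) ((starRingEnd ℂ) b * (x : ℂ) + (starRingEnd ℂ) a) := by
    have hxx : (x : ℂ) * (starRingEnd ℂ) (x : ℂ) = 1 := by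
      rw [Complex.mul_conj, Complex.normSq_eq_norm_sq, hx]; simp
    simp only [map_add, map_mul, Complex.conj_conj]
    linear_combination (-b) * hxx
  change ‖(a * (x : ℂ) + b) / ((starRingEnd ℂ) b * (x : ℂ) + (starRingEnd ℂ) a)‖ = 1
  rw [norm_div, e, norm_mul, Complex.norm_conj, hx, one_mul]
  exact div_self (norm_ne_zero_iff.2 n1)

/-- The action of a Möbius transformation of the disk on the circle at infinity. -/
def bdry (T : diskMobius) (x : Circle) : Circle :=
  ⟨(((T : Equiv.Perm ClosedDisk) x.toClosedDisk : ClosedDisk) : ℂ), by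
    simpa [Submonoid.unitSphere] using diskMobius_norm_boundary T x⟩

/-- The angle in `[0, 2π)` by which one turns counterclockwise from `a` to `x`. -/
noncomputable def ccwAngle (a x : Circle) : ℝ :=
  toIcoMod Real.two_pi_pos 0 (Complex.arg ((x / a : Circle) : ℂ))

/-- The closed arc `[a, b]` from `a` counterclockwise to `b` (a point if `a = b`). -/
def arcIcc (a b : Circle) : Set Circle := {x | ccwAngle a x ≤ ccwAngle a b}

/-- The half-open arc `[a, b)` from `a` counterclockwise to `b` (empty if `a = b`). -/
def arcIco (a b : Circle) : Set Circle := {x | ccwAngle a x < ccwAngle a b}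

/-- For `p ≠ q` on the circle at infinity and `z` in the open disk, the sign of this number tells
on which side of the oriented geodesic from `p` to `q` the point `z` lies: positive on the left,
zero on the geodesic, negative on the right. (Its zero set is a line or a circle through `p` and
`q` orthogonal to the unit circle; up to the factor `(1 + |z|²) / 2` it is the orientation
determinant of `p`, `q` and the point `2 z / (1 + |z|²)`, the image of `z` in the Klein model,
where geodesics are chords.) -/
noncomputable def geodesicSide (p q : Circle) (z : ℂ) : ℝ :=
  ((starRingEnd ℂ) (p : ℂ) * (q : ℂ)).im * (1 + ‖z‖ ^ 2) / 2
    + ((starRingEnd ℂ) ((q : ℂ) - (p : ℂ)) * z).im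

/-- The geodesic of the open disk with endpoints `p` and `q`. -/
def geodesicLine (p q : Circle) : Set ClosedDisk :=
  {z | ‖(z : ℂ)‖ < 1 ∧ geodesicSide p q (z : ℂ) = 0}

/-! ### The fundamental polygon -/

/-- The side pairing rule on the `8g-4` sides (as `8g-4` is even, the parity of an index
modulo `8g-4` is well defined). -/
def sidePairing (g : ℕ) (i : ZMod (8 * g - 4)) : ZMod (8 * g - 4) :=
  if Odd i.val then 4 * (g : ZMod (8 * g - 4)) - i else 2 - i

/-- `ρ(i) = σ(i) + 1`. -/
def vertexMap (g : ℕ) (i : ZMod (8 * g - 4)) : ZMod (8 * g - 4) := sidePairing g i + 1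

/-- `τ(i) = i + (4g - 2)`. -/
def oppositeSide (g : ℕ) (i : ZMod (8 * g - 4)) : ZMod (8 * g - 4) :=
  i + (4 * (g : ZMod (8 * g - 4)) - 2)

/-- The interior of the polygon bounded by the geodesics from `P i` to `Q (i + 1)`: the points of
the open disk to the left of all of them. -/
def polygonInterior {n : ℕ} (P Q : ZMod n → Circle) : Set ClosedDisk :=
  {z | ‖(z : ℂ)‖ < 1 ∧ ∀ i, 0 < geodesicSide (P i) (Q (i + 1)) (z : ℂ)}

/-- The closed polygon bounded by the geodesics from `P i` to `Q (i + 1)`. -/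
def closedPolygon {n : ℕ} (P Q : ZMod n → Circle) : Set ClosedDisk :=
  {z | ‖(z : ℂ)‖ < 1 ∧ ∀ i, 0 ≤ geodesicSide (P i) (Q (i + 1)) (z : ℂ)}

/-- The `(8g-4)`-sided fundamental polygon of a closed surface `Γ \ 𝔻` of genus `g`, with its
labelling. Side `i` joins the vertices `V i` and `V (i + 1)`, and the oriented geodesic that extends
side `i` goes from `P i` to `Q (i + 1)`; `T i` are the side-pairing generators of `Γ`. -/
structure FundamentalPolygon (g : ℕ) where
  /-- initial endpoints: `P i` is the start of the geodesic extending side `i` -/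
  P : ZMod (8 * g - 4) → Circle
  /-- final endpoints: `Q (i + 1)` is the end of the geodesic extending side `i` -/
  Q : ZMod (8 * g - 4) → Circle
  /-- vertices -/
  V : ZMod (8 * g - 4) → ClosedDisk
  /-- side-pairing transformations -/
  T : ZMod (8 * g - 4) → diskMobius
  /-- The counterclockwise order on the circle is `P 1, Q 1, P 2, Q 2, …, P (8g-4), Q (8g-4)`. -/
  order_PQ : ∀ i : ℕ, 1 ≤ i → i ≤ 8 * g - 4 → ccwAngle (P 1) (P i) < ccwAngle (P 1) (Q i)
  order_QP : ∀ i : ℕ, 1 ≤ i → i < 8 * g - 4 →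
    ccwAngle (P 1) (Q i) < ccwAngle (P 1) (P ((i : ZMod (8 * g - 4)) + 1))
  /-- `V i` is the common endpoint of the sides `i - 1` and `i`. -/
  vertex_mem_left : ∀ i, V i ∈ geodesicLine (P (i - 1)) (Q i)
  vertex_mem_right : ∀ i, V i ∈ geodesicLine (P i) (Q (i + 1))
  /-- The side pairings and their relations. -/
  map_vertex : ∀ i, (T i : Equiv.Perm ClosedDisk) (V i) = V (vertexMap g i)
  pairing_inv : ∀ i, T (sidePairing g i) * T i = 1
  vertex_cycle : ∀ i,
    T (vertexMap g (vertexMap g (vertexMap g i))) * T (vertexMap g (vertexMap g i)) *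
      T (vertexMap g i) * T i = 1
  /-- The group `Γ` generated by the `T i` acts freely on the open disk. -/
  free : ∀ γ ∈ Subgroup.closure (Set.range T), γ ≠ 1 →
    ∀ z : ClosedDisk, ‖(z : ℂ)‖ < 1 → (γ : Equiv.Perm ClosedDisk) z ≠ z
  /-- The polygon is a fundamental domain: its images cover the open disk, and the interiors of
  different images are disjoint. -/
  cover : ∀ z : ClosedDisk, ‖(z : ℂ)‖ < 1 → ∃ γ ∈ Subgroup.closure (Set.range T),
    (γ : Equiv.Perm ClosedDisk) z ∈ closedPolygon P Q
  disjoint : ∀ γ ∈ Subgroup.closure (Set.range T), γ ≠ 1 →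
    ∀ z ∈ polygonInterior P Q, (γ : Equiv.Perm ClosedDisk) z ∉ polygonInterior P Q
  /-- Extension condition: the geodesics that extend the sides never meet the interior of an image
  of the polygon. -/
  extension : ∀ i, ∀ γ ∈ Subgroup.closure (Set.range T), ∀ z ∈ polygonInterior P Q,
    (γ : Equiv.Perm ClosedDisk) z ∉ geodesicLine (P i) (Q (i + 1))

/-! ### Boundary maps and their natural extensions -/

/-- The index `i` with `x ∈ [B i, B (i + 1))`. It exists and is unique for every parameter choice
(the arcs then partition the circle); the value `0` is assigned if there is no such index. -/
noncomputable def arcIndex {n : ℕ} (B : ZMod n → Circle) (x : Circle) : ZMod n :=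
  open Classical in
  if h : ∃ i, x ∈ arcIco (B i) (B (i + 1)) then h.choose else 0

namespace FundamentalPolygon

variable {g : ℕ} (S : FundamentalPolygon g)

/-- A parameter choice for a boundary map: `B i ∈ [P i, Q i]`. -/
def IsParameterChoice (B : ZMod (8 * g - 4) → Circle) : Prop :=
  ∀ i, B i ∈ arcIcc (S.P i) (S.Q i)

/-- Extremal parameters. -/
def IsExtremal (A : ZMod (8 * g - 4) → Circle) : Prop :=
  ∀ i, A i = S.P i ∨ A i = S.Q i

/-- The boundary map `f_B(x) = T_i x` for `x ∈ [B i, B (i + 1))`. -/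
noncomputable def boundaryMap (B : ZMod (8 * g - 4) → Circle) (x : Circle) : Circle :=
  bdry (S.T (arcIndex B x)) x

/-- The map `F_B(u, w) = (T_i u, T_i w)` for `w ∈ [B i, B (i + 1))`. -/
noncomputable def extMap (B : ZMod (8 * g - 4) → Circle) (p : Circle × Circle) :
    Circle × Circle :=
  (bdry (S.T (arcIndex B p.2)) p.1, bdry (S.T (arcIndex B p.2)) p.2)

/-- The system of conditions that determines the points `G i` from extremal parameters `A`. -/
structure IsSystemSolution (A G : ZMod (8 * g - 4) → Circle) : Prop where
  mem : ∀ i, G i ∈ arcIcc (S.P i) (S.P (i + 1))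
  eq_of_P : ∀ i, A i = S.P i → G (sidePairing g i) = bdry (S.T i) (G (i - 2))
  eq_of_Q : ∀ i, A i = S.Q i →
    G (sidePairing g i) = bdry (S.T (oppositeSide g i + 1)) (G (oppositeSide g i))

/-- `H_i = U_i G_{τ(i)-1}` with `U_i = T_{σ(i-1)} T_{τ(i)}`. -/
def cornerH (G : ZMod (8 * g - 4) → Circle) (i : ZMod (8 * g - 4)) : Circle :=
  bdry (S.T (sidePairing g (i - 1)) * S.T (oppositeSide g i)) (G (oppositeSide g i - 1))

/-- `D_i = T_{τσ(i)+1} G_{τσ(i)}`. -/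
def dualParameter (G : ZMod (8 * g - 4) → Circle) (i : ZMod (8 * g - 4)) : Circle :=
  bdry (S.T (oppositeSide g (sidePairing g i) + 1)) (G (oppositeSide g (sidePairing g i)))

/-- The set `Ω_A`, as a union of horizontal strips. With `arc = arcIcc` the rectangles are closed,
with `arc = arcIco` they are half-open. -/
def domainA (arc : Circle → Circle → Set Circle) (G : ZMod (8 * g - 4) → Circle) :
    Set (Circle × Circle) :=
  ⋃ i : ZMod (8 * g - 4),
    (arc (S.cornerH G (i + 1)) (G (i - 2)) ×ˢ arc (S.P i) (S.Q i)) ∪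
    (arc (S.cornerH G (i + 1)) (G (i - 1)) ×ˢ arc (S.Q i) (S.P (i + 1)))

/-- The set `Ω_D`, with closed (`arc = arcIcc`) or half-open (`arc = arcIco`) rectangles. -/
def domainD (arc : Circle → Circle → Set Circle) (G : ZMod (8 * g - 4) → Circle) :
    Set (Circle × Circle) :=
  ⋃ i : ZMod (8 * g - 4),
    (arc (S.Q (i + 2)) (S.P (i - 1)) ×ˢ
      arc (S.dualParameter G i) (S.dualParameter G (i + 1))) ∪
    (arc (S.P (i - 1)) (S.P i) ×ˢ arc (S.cornerH G i) (S.dualParameter G (i + 1))) ∪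
    (arc (S.Q (i + 1)) (S.Q (i + 2)) ×ˢ arc (S.dualParameter G i) (G i))

end FundamentalPolygon

/-- A finite union of products of nondegenerate closed arcs that misses the diagonal (so that its
points are geodesics). -/
def HasFiniteRectangularStructure (Ω : Set (Circle × Circle)) : Prop :=
  (∃ R : Finset ((Circle × Circle) × (Circle × Circle)),
    (∀ r ∈ R, r.1.1 ≠ r.1.2 ∧ r.2.1 ≠ r.2.2) ∧
    Ω = ⋃ r ∈ R, arcIcc r.1.1 r.1.2 ×ˢ arcIcc r.2.1 r.2.2) ∧
  ∀ p ∈ Ω, p.1 ≠ p.2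

/-- `Ω` is a bijectivity domain of `F`, with finite rectangular structure: `F` maps `Ω` to itself
and is bijective on `Ω` up to boundary points, precisely, it is a bijection of the set `Ω₀`, which
arises from `Ω` by removing some of its boundary points. -/
structure IsBijectivityDomain (F : Circle × Circle → Circle × Circle)
    (Ω Ω₀ : Set (Circle × Circle)) : Prop where
  rectangular : HasFiniteRectangularStructure Ω
  mapsTo : Set.MapsTo F Ω Ω
  core_subset : Ω₀ ⊆ Ω
  interior_subset : interior Ω ⊆ Ω₀
  bijOn : Set.BijOn F Ω₀ Ω₀

/-- The parameter choice `D` is dual to `A`, where `F_A` and `F_D` have the domains `ΩA` and `ΩD`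
and are bijections of `ΩA₀` and `ΩD₀`. -/
structure FundamentalPolygon.IsDual {g : ℕ} (S : FundamentalPolygon g)
    (A D : ZMod (8 * g - 4) → Circle) (ΩA ΩA₀ ΩD ΩD₀ : Set (Circle × Circle)) : Prop where
  parameterA : S.IsParameterChoice A
  parameterD : S.IsParameterChoice D
  domain_A : IsBijectivityDomain (S.extMap A) ΩA ΩA₀
  domain_D : IsBijectivityDomain (S.extMap D) ΩD ΩD₀
  swap_image : Prod.swap '' ΩA = ΩD
  swap_image_core : Prod.swap '' ΩA₀ = ΩD₀
  /-- `φ ∘ F_A⁻¹ = F_D ∘ φ`, where `F_A⁻¹` is the inverse of the bijection `F_A` of `ΩA₀` -/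
  inverse : ∀ p ∈ ΩA₀,
    (Function.invFunOn (S.extMap A) ΩA₀ p).swap = S.extMap D p.swap
  /-- the same identity for all preimages in the closed domain, off the parameter points -/
  inverse_closed : ∀ p ∈ ΩA, p.1 ∉ Set.range D →
    ∀ q ∈ ΩA, S.extMap A q = p → q.2 ∉ Set.range A → q.swap = S.extMap D p.swap

/-- The digit `n_k` of the `A`-code read off at the point `(u_k, w_k)` of an orbit: `σ(i)` for the
index `i` with `w_k ∈ [A i, A (i + 1))`. -/
noncomputable def codeDigit {g : ℕ} (A : ZMod (8 * g - 4) → Circle) (p : Circle × Circle) :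
    ZMod (8 * g - 4) :=
  sidePairing g (arcIndex A p.2)

/-- For an orbit `p k = (u_k, w_k)`, `k ∈ ℤ`, of `F_A`: its digits `n_k` with `k ≥ 0` are the ones
that are read off from the orbit of `w_0` under `f_A`, and the past digits `n_{-1}, n_{-2}, …` are
read off from the orbit of `u_0` under `f_D`, in that `f_D^k(u_0) ∈ [D_i, D_{i+1})` for
`i = n_{-k-1}`. -/
def FundamentalPolygon.PastIsDualFuture {g : ℕ} (S : FundamentalPolygon g)
    (A D : ZMod (8 * g - 4) → Circle) (p : ℤ → Circle × Circle) : Prop :=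
  (∀ k : ℕ, codeDigit A (p k) = sidePairing g (arcIndex A ((S.boundaryMap A)^[k] (p 0).2))) ∧
  (∀ k : ℕ, (S.boundaryMap D)^[k] (p 0).1 ∈
    arcIco (D (codeDigit A (p (-(k : ℤ) - 1)))) (D (codeDigit A (p (-(k : ℤ) - 1)) + 1)))

/-! ### Angles, arcs and orientation on the circle -/

/-! After exchange of coordinates `F_A` and `F_D` are inverse to each other, because each `T i`
carries a horizontal strip of `Ω_A` onto a vertical strip of `Ω_D`. For extremal `A` the part of
`Ω_A` over `[A i, A (i+1))` is `rowA`: the rectangle over `[Q i, P (i+1)]`, the one over `[P i, Q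
i]` if `A i = P i`, and the one over `[P (i+1), Q (i+1)]` if `A (i+1) = Q (i+1)`. Let `s = σ(i)`.
The part of `Ω_D` over `[D s, D (s+1))` is `columnD`, and the corners match: `T_i H_{i+1} = D_s` and
`T_i G_{i-1} = D_{s+1}` always, `T_i G_{i-2} = G_s` if `A i = P i`, and `T_i H_{i+2} = H_s` if `A
(i+1) = Q (i+1)`. In the remaining cases `G_s = D_s`, respectively `H_s = D_{s+1}`, so the column
rectangle without a partner has collapsed. The relations for `G` are the defining system; those for
`H` come from the vertex relation in the form `T_mul_T`. All this is collected in `map_mem_columnD`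
and `map_mem_rowA`, while `mem_domainA_iff_mem_domainD` shows that the rows and the columns fill the
same set. Half-open arcs of a parameter choice partition the circle, so at an image point `F_D`
reads off exactly the index `σ(i)` and applies the inverse of `T i`. Iterating this backwards turns
the past of the `A`-code into the future of the `D`-code.

The matching needs the values of `T i` at the neighbouring points `P` and `Q`, which are not
hypotheses. They are found in the hyperboloid model: disk isometries act linearly up to positive
weights (`diskMobius_exists_weight`), so orientation, arcs and geodesics are preserved, and a point
of a geodesic is a positive combination of its endpoints. Two vertices determine the image of side
`i` (`map_side`). The image of the extended side `i - 1` is pinned down by the extension condition: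
the four sectors at a vertex close up, and an extended side cannot enter the interior of any of them
(`map_prev_side`).

The points `G` solve a system `G j = M_j (G (f j))` in which `M_j` sends the arc `[P (f j), P (f j +
1)]` into `[P j, P (j+1)]`. Existence is the Knaster–Tarski theorem for angles. Uniqueness holds
since the cross-ratio of two solutions with the ends of slightly larger arcs increases strictly
along the system, which is impossible for finitely many indices.

The order of all corner points is recorded on the universal cover in `IsDomainLift`, which reduces
statements about arcs to inequalities of reals. The closed domains carry additional boundary points,
where the map may use the index of the neighbouring strip; such points are shown to land on edges of
the domain. -/

theorem ccwAngle_nonneg (a x : Circle) : 0 ≤ ccwAngle a x := (toIcoMod_mem_Ico' _ _).1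

theorem ccwAngle_lt (a x : Circle) : ccwAngle a x < 2 * Real.pi := (toIcoMod_mem_Ico' _ _).2

theorem exp_ccwAngle (a x : Circle) : Circle.exp (ccwAngle a x) = x / a := by
  have h := toIcoMod_add_toIcoDiv_zsmul Real.two_pi_pos 0 (Complex.arg ((x / a : Circle) : ℂ))
  refine (Circle.exp_eq_exp.2
    ⟨-toIcoDiv Real.two_pi_pos 0 (Complex.arg ((x / a : Circle) : ℂ)), ?_⟩).trans
    (Circle.exp_arg (x / a))
  rw [zsmul_eq_mul] at h
  rw [Int.cast_neg]
  change toIcoMod _ _ _ = _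
  linarith

theorem ccwAngle_exp {a x : ℝ} (h : a ≤ x) (h' : x < a + 2 * Real.pi) :
    ccwAngle (Circle.exp a) (Circle.exp x) = x - a := by
  have h1 := exp_ccwAngle (Circle.exp a) (Circle.exp x)
  rw [← Circle.exp_sub] at h1
  refine Circle.exp_injOn_Ico (a := 0) (b := 2 * Real.pi) (by simp) ?_ ?_ h1
  · exact ⟨ccwAngle_nonneg _ _, ccwAngle_lt _ _⟩
  · exact ⟨by linarith, by linarith⟩

theorem exp_add_ccwAngle (a : ℝ) (x : Circle) :
    Circle.exp (a + ccwAngle (Circle.exp a) x) = x := by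
  rw [Circle.exp_add, exp_ccwAngle]; simp

/-- Places a point in a prescribed fundamental interval, so that questions of cyclic order become
inequalities. -/
theorem exists_exp_eq_Ico (a : ℝ) (x : Circle) :
    ∃ y, Circle.exp y = x ∧ a ≤ y ∧ y < a + 2 * Real.pi :=
  ⟨_, exp_add_ccwAngle a x, by linarith [ccwAngle_nonneg (Circle.exp a) x],
    by linarith [ccwAngle_lt (Circle.exp a) x]⟩

theorem ccwAngle_self (a : Circle) : ccwAngle a a = 0 := by
  simp [ccwAngle]

theorem ccwAngle_injective (a : Circle) : Function.Injective (ccwAngle a) := by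
  intro x y h
  have h1 := exp_ccwAngle a x
  rw [h, exp_ccwAngle a y] at h1
  exact (div_left_injective h1).symm

theorem mem_arcIcc_exp {a b : ℝ} {x : Circle} (h : a ≤ b) (h' : b < a + 2 * Real.pi) :
    x ∈ arcIcc (Circle.exp a) (Circle.exp b) ↔ ∃ y, Circle.exp y = x ∧ a ≤ y ∧ y ≤ b := by
  constructor
  · intro hx
    have hx : ccwAngle _ _ ≤ ccwAngle _ _ := hx
    rw [ccwAngle_exp h h'] at hx
    exact ⟨_, exp_add_ccwAngle a x, by linarith [ccwAngle_nonneg (Circle.exp a) x], by linarith⟩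
  · rintro ⟨y, rfl, h1, h2⟩
    change ccwAngle _ _ ≤ ccwAngle _ _
    rw [ccwAngle_exp h h', ccwAngle_exp h1 (by linarith)]
    linarith

theorem mem_arcIco_exp {a b : ℝ} {x : Circle} (h : a ≤ b) (h' : b < a + 2 * Real.pi) :
    x ∈ arcIco (Circle.exp a) (Circle.exp b) ↔ ∃ y, Circle.exp y = x ∧ a ≤ y ∧ y < b := by
  constructor
  · intro hx
    have hx : ccwAngle _ _ < ccwAngle _ _ := hx
    rw [ccwAngle_exp h h'] at hx
    exact ⟨_, exp_add_ccwAngle a x, by linarith [ccwAngle_nonneg (Circle.exp a) x], by linarith⟩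
  · rintro ⟨y, rfl, h1, h2⟩
    change ccwAngle _ _ < ccwAngle _ _
    rw [ccwAngle_exp h h', ccwAngle_exp h1 (by linarith)]
    linarith

theorem exp_mem_arcIcc {a b y : ℝ} (h1 : a ≤ y) (h2 : y ≤ b) (h' : b < a + 2 * Real.pi) :
    Circle.exp y ∈ arcIcc (Circle.exp a) (Circle.exp b) :=
  (mem_arcIcc_exp (h1.trans h2) h').2 ⟨y, rfl, h1, h2⟩

theorem exp_mem_arcIco {a b y : ℝ} (h1 : a ≤ y) (h2 : y < b) (h' : b < a + 2 * Real.pi) :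
    Circle.exp y ∈ arcIco (Circle.exp a) (Circle.exp b) :=
  (mem_arcIco_exp (h1.trans h2.le) h').2 ⟨y, rfl, h1, h2⟩

theorem left_mem_arcIcc (a b : Circle) : a ∈ arcIcc a b := by
  change ccwAngle _ _ ≤ ccwAngle _ _
  rw [ccwAngle_self]; exact ccwAngle_nonneg _ _

theorem right_mem_arcIcc (a b : Circle) : b ∈ arcIcc a b := le_refl (ccwAngle a b)

theorem left_mem_arcIco {a b : Circle} (h : a ≠ b) : a ∈ arcIco a b := by
  change ccwAngle _ _ < ccwAngle _ _
  rw [ccwAngle_self]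
  refine lt_of_le_of_ne (ccwAngle_nonneg _ _) fun h0 => h ?_
  rw [← ccwAngle_self a] at h0
  exact ccwAngle_injective a h0

theorem right_notMem_arcIco (a b : Circle) : b ∉ arcIco a b := fun h => lt_irrefl (ccwAngle a b) h

theorem arcIco_self (a : Circle) : arcIco a a = ∅ := by
  ext x
  simp only [Set.mem_empty_iff_false, iff_false]
  intro h
  have h : ccwAngle a x < ccwAngle a a := h
  rw [ccwAngle_self] at h
  linarith [ccwAngle_nonneg a x]

theorem arcIco_subset_arcIcc (a b : Circle) : arcIco a b ⊆ arcIcc a b := fun x hx =>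
  le_of_lt (show ccwAngle a x < ccwAngle a b from hx)

theorem mem_arcIcc_iff {a b x : Circle} : x ∈ arcIcc a b ↔ x ∈ arcIco a b ∨ x = b := by
  change ccwAngle a x ≤ ccwAngle a b ↔ ccwAngle a x < ccwAngle a b ∨ _
  rw [le_iff_lt_or_eq]
  exact or_congr_right (ccwAngle_injective a).eq_iff

/-! ### Orientation of triples of points on the circle -/

/-- The sides of a geodesic with respect to a boundary point, in terms of angles. -/
theorem geodesicSide_exp (a b c : ℝ) :
    geodesicSide (Circle.exp a) (Circle.exp b) (Circle.exp c) =
      4 * Real.sin ((b - a) / 2) * Real.sin ((c - b) / 2) * Real.sin ((c - a) / 2) := by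
  obtain ⟨x, rfl⟩ : ∃ x, a = 2 * x := ⟨a / 2, by ring⟩
  obtain ⟨y, rfl⟩ : ∃ y, b = 2 * y := ⟨b / 2, by ring⟩
  obtain ⟨z, rfl⟩ : ∃ z, c = 2 * z := ⟨c / 2, by ring⟩
  have e1 : ∀ s t : ℝ, (2 * s - 2 * t) / 2 = s - t := fun s t => by ring
  rw [e1, e1, e1]
  have er : ∀ t : ℝ, ((Circle.exp t : Circle) : ℂ).re = Real.cos t := fun t => by
    rw [Circle.coe_exp, Complex.exp_ofReal_mul_I_re]
  have ei : ∀ t : ℝ, ((Circle.exp t : Circle) : ℂ).im = Real.sin t := fun t => by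
    rw [Circle.coe_exp, Complex.exp_ofReal_mul_I_im]
  simp only [geodesicSide, Circle.norm_coe, Complex.mul_im, Complex.sub_re, Complex.sub_im,
    Complex.conj_re, Complex.conj_im, er, ei, map_sub, Real.cos_two_mul', Real.sin_two_mul,
    Real.sin_sub]
  have hx := Real.sin_sq_add_cos_sq x
  have hy := Real.sin_sq_add_cos_sq y
  have hz := Real.sin_sq_add_cos_sq z
  generalize Real.sin x = sx at *
  generalize Real.cos x = cx at *
  generalize Real.sin y = sy at *
  generalize Real.cos y = cy at *
  generalize Real.sin z = sz at *
  generalize Real.cos z = cz at *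
  grind

theorem geodesicSide_pos_of_lt {a b c : ℝ} (h1 : a < b) (h2 : b < c) (h3 : c < a + 2 * Real.pi) :
    0 < geodesicSide (Circle.exp a) (Circle.exp b) (Circle.exp c) := by
  rw [geodesicSide_exp]
  have e1 := Real.sin_pos_of_pos_of_lt_pi (x := (b - a) / 2) (by linarith) (by linarith)
  have e2 := Real.sin_pos_of_pos_of_lt_pi (x := (c - b) / 2) (by linarith) (by linarith)
  have e3 := Real.sin_pos_of_pos_of_lt_pi (x := (c - a) / 2) (by linarith) (by linarith)
  positivity

theorem geodesicSide_swap (a b c : Circle) : geodesicSide a c b = - geodesicSide a b c := by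
  obtain ⟨x, rfl⟩ := Circle.exp_surjective a
  obtain ⟨y, rfl⟩ := Circle.exp_surjective b
  obtain ⟨z, rfl⟩ := Circle.exp_surjective c
  rw [geodesicSide_exp, geodesicSide_exp,
    show (y - z) / 2 = -((z - y) / 2) by ring, Real.sin_neg]
  ring

theorem geodesicSide_left (a b : Circle) : geodesicSide a b a = 0 := by
  obtain ⟨x, rfl⟩ := Circle.exp_surjective a
  obtain ⟨y, rfl⟩ := Circle.exp_surjective b
  rw [geodesicSide_exp]; simp

theorem geodesicSide_right (a b : Circle) : geodesicSide a b b = 0 := by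
  obtain ⟨x, rfl⟩ := Circle.exp_surjective a
  obtain ⟨y, rfl⟩ := Circle.exp_surjective b
  rw [geodesicSide_exp]; simp

/-- The bridge between the algebraic orientation determinant, whose sign isometries preserve, and
the angles by which arcs are defined. -/
theorem geodesicSide_pos_iff {a b c : Circle} :
    0 < geodesicSide a b c ↔ 0 < ccwAngle a b ∧ ccwAngle a b < ccwAngle a c := by
  obtain ⟨x, rfl⟩ := Circle.exp_surjective a
  obtain ⟨y, rfl, y1, y2⟩ := exists_exp_eq_Ico x b
  obtain ⟨z, rfl, z1, z2⟩ := exists_exp_eq_Ico x c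
  rw [ccwAngle_exp y1 y2, ccwAngle_exp z1 z2]
  constructor
  · intro h
    have hxy : x ≠ y := by
      rintro rfl; rw [geodesicSide_exp] at h; simp at h
    have hxy : x < y := lt_of_le_of_ne y1 hxy
    refine ⟨by linarith, ?_⟩
    by_contra hyz
    rcases eq_or_lt_of_le (show z ≤ y by linarith) with rfl | hzy
    · rw [geodesicSide_exp] at h; simp at h
    rcases eq_or_lt_of_le z1 with rfl | hxz
    · rw [geodesicSide_exp] at h; simp at h
    have := geodesicSide_pos_of_lt hxz hzy y2
    rw [geodesicSide_swap] at this
    linarith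
  · rintro ⟨h1, h2⟩
    exact geodesicSide_pos_of_lt (by linarith) (by linarith) z2

theorem geodesicSide_eq_zero_iff {a b c : Circle} (hab : a ≠ b) :
    geodesicSide a b c = 0 ↔ c = a ∨ c = b := by
  constructor
  · intro h
    by_contra hne
    push Not at hne
    have pos : ∀ {u v : Circle}, u ≠ v → 0 < ccwAngle u v := fun {u v} huv => by
      refine lt_of_le_of_ne (ccwAngle_nonneg _ _) fun h0 => huv ?_
      rw [← ccwAngle_self u] at h0
      exact ccwAngle_injective u h0
    rcases lt_trichotomy (ccwAngle a b) (ccwAngle a c) with h1 | h1 | h1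
    · exact (geodesicSide_pos_iff.2 ⟨pos hab, h1⟩).ne' h
    · exact hne.2 (ccwAngle_injective a h1).symm
    · have := geodesicSide_pos_iff.2 ⟨pos hne.1.symm, h1⟩
      rw [geodesicSide_swap] at this
      linarith
  · rintro (rfl | rfl)
    · exact geodesicSide_left _ _
    · exact geodesicSide_right _ _

/-- Expresses an arc through equality and the sign of a determinant only; the invariance of arcs
under disk isometries is then immediate. -/
theorem mem_arcIco_iff_side {a b x : Circle} :
    x ∈ arcIco a b ↔ (x = a ∧ a ≠ b) ∨ 0 < geodesicSide a x b := by
  rw [geodesicSide_pos_iff]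
  change ccwAngle a x < ccwAngle a b ↔ _
  constructor
  · intro h
    by_cases hx : x = a
    · subst hx
      refine Or.inl ⟨rfl, ?_⟩
      rintro rfl
      exact lt_irrefl _ h
    · refine Or.inr ⟨lt_of_le_of_ne (ccwAngle_nonneg _ _) fun h0 => hx ?_, h⟩
      rw [← ccwAngle_self a] at h0
      exact (ccwAngle_injective a h0).symm
  · rintro (⟨rfl, h⟩ | h)
    · exact left_mem_arcIco h
    · exact h.2

/-- A cyclic chain of nondegenerate arcs covers the circle. -/
theorem mem_arcIco_of_cycle {a b c d : Circle} (hab : a ≠ b) (hbc : b ≠ c) (hcd : c ≠ d)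
    (hda : d ≠ a) (x : Circle) :
    x ∈ arcIco a b ∨ x ∈ arcIco b c ∨ x ∈ arcIco c d ∨ x ∈ arcIco d a := by
  -- If `x` avoids every arc, the angle measured from `x` grows strictly along the chain, which
  -- cannot then return to its start.
  have key : ∀ u v : Circle, u ≠ v → x ≠ v → x ∉ arcIco u v → ccwAngle x u < ccwAngle x v := by
    intro u v huv hxv hx
    obtain ⟨t, rfl⟩ := Circle.exp_surjective x
    obtain ⟨y, rfl, y1, y2⟩ := exists_exp_eq_Ico t u
    obtain ⟨z, rfl, z1, z2⟩ := exists_exp_eq_Ico t v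
    rw [ccwAngle_exp y1 y2, ccwAngle_exp z1 z2]
    by_contra h
    have hzy : z < y := lt_of_le_of_ne (by linarith) (by rintro rfl; exact huv rfl)
    have htz : t < z := lt_of_le_of_ne z1 (by rintro rfl; exact hxv rfl)
    apply hx
    -- Otherwise the lifts satisfy `t < z < y < t + 2π`; going counterclockwise from `u`, one meets
    -- `x` at `t + 2π` before `v` at `z + 2π`.
    rw [← Circle.exp_add_two_pi t, ← Circle.exp_add_two_pi z]
    exact exp_mem_arcIco (by linarith) (by linarith) (by linarith)
  by_contra hne
  push Not at hne
  have ne : ∀ u v : Circle, u ≠ v → x ∉ arcIco u v → x ≠ u := by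
    rintro u v huv hx rfl
    exact hx (left_mem_arcIco huv)
  have h1 := key _ _ hab (ne _ _ hbc hne.2.1) hne.1
  have h2 := key _ _ hbc (ne _ _ hcd hne.2.2.1) hne.2.1
  have h3 := key _ _ hcd (ne _ _ hda hne.2.2.2) hne.2.2.1
  have h4 := key _ _ hda (ne _ _ hab hne.1) hne.2.2.2
  linarith

/-! ### Disk isometries acting on the circle -/

/-- The squared modulus of the multiplier of a disk isometry: passing to the hyperboloid model,
a disk isometry becomes linear up to this positive weight. -/
theorem diskMobius_exists_weight (T : diskMobius) : ∃ m : ClosedDisk → ℝ, (∀ z, 0 < m z) ∧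
    (∀ (p q : Circle) (z : ClosedDisk),
      geodesicSide (bdry T p) (bdry T q) (((T : Equiv.Perm ClosedDisk) z : ClosedDisk) : ℂ) *
        (m p.toClosedDisk * m q.toClosedDisk * m z) = geodesicSide p q z) ∧
    (∀ z w : ClosedDisk, ‖(((T : Equiv.Perm ClosedDisk) z : ClosedDisk) : ℂ) -
        (((T : Equiv.Perm ClosedDisk) w : ClosedDisk) : ℂ)‖ ^ 2 * (m z * m w) =
          ‖(z : ℂ) - (w : ℂ)‖ ^ 2) ∧
    (∀ z : ClosedDisk, (1 - ‖(((T : Equiv.Perm ClosedDisk) z : ClosedDisk) : ℂ)‖ ^ 2) * m z =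
      1 - ‖(z : ℂ)‖ ^ 2) := by
  obtain ⟨a, b, h, hT⟩ := T.2
  have hΔ : 0 < Complex.normSq a - Complex.normSq b := by
    rw [Complex.normSq_eq_norm_sq, Complex.normSq_eq_norm_sq]
    nlinarith [norm_nonneg a, norm_nonneg b]
  set Δ := Complex.normSq a - Complex.normSq b with hΔd
  have hd : ∀ z : ClosedDisk, (starRingEnd ℂ) b * (z : ℂ) + (starRingEnd ℂ) a ≠ 0 := fun z =>
    diskMobius_denom_ne h (closedDisk_norm_le z)
  have hdpos : ∀ z : ClosedDisk,
      0 < Complex.normSq ((starRingEnd ℂ) b * (z : ℂ) + (starRingEnd ℂ) a) := fun z =>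
    Complex.normSq_pos.2 (hd z)
  set W : ClosedDisk → ℝ := fun z =>
    Complex.normSq ((starRingEnd ℂ) b * (z : ℂ) + (starRingEnd ℂ) a) with hW
  have hW0 : ∀ z, W z ≠ 0 := fun z => (hdpos z).ne'
  -- the linear action
  have lin : ∀ z : ClosedDisk, ∀ Z : ClosedDisk, Z = (T : Equiv.Perm ClosedDisk) z →
      W z * (Z : ℂ).re = (a.re ^ 2 - a.im ^ 2 + b.re ^ 2 - b.im ^ 2) * (z : ℂ).re
          + (-2 * a.re * a.im + 2 * b.re * b.im) * (z : ℂ).im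
          + (a.re * b.re - a.im * b.im) * (1 + Complex.normSq z) ∧
      W z * (Z : ℂ).im = (2 * a.re * a.im + 2 * b.re * b.im) * (z : ℂ).re
          + (a.re ^ 2 - a.im ^ 2 - b.re ^ 2 + b.im ^ 2) * (z : ℂ).im
          + (a.re * b.im + a.im * b.re) * (1 + Complex.normSq z) ∧
      W z * (1 + Complex.normSq (Z : ℂ)) =
          4 * (a.re * b.re + a.im * b.im) * (z : ℂ).re + 4 * (a.re * b.im - a.im * b.re) * (z : ℂ).im
          + (Complex.normSq a + Complex.normSq b) * (1 + Complex.normSq z) ∧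
      W z * (1 - Complex.normSq (Z : ℂ)) = Δ * (1 - Complex.normSq z) := by
    rintro z _ rfl
    have e := hT z
    have n0 := hd z
    have eW : W z = Complex.normSq ((starRingEnd ℂ) b * (z : ℂ) + (starRingEnd ℂ) a) := rfl
    have e1 : ((W z : ℝ) : ℂ) * (((T : Equiv.Perm ClosedDisk) z : ClosedDisk) : ℂ) =
        (a * (z : ℂ) + b) *
          (starRingEnd ℂ) ((starRingEnd ℂ) b * (z : ℂ) + (starRingEnd ℂ) a) := by
      rw [eW, Complex.normSq_eq_conj_mul_self]
      rw [eq_div_iff n0] at e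
      linear_combination
        (starRingEnd ℂ) ((starRingEnd ℂ) b * (z : ℂ) + (starRingEnd ℂ) a) * e
    have e2 : W z * Complex.normSq (((T : Equiv.Perm ClosedDisk) z : ClosedDisk) : ℂ) =
        Complex.normSq (a * (z : ℂ) + b) := by
      rw [hT z, Complex.normSq_div, eW]
      exact mul_div_cancel₀ _ (hdpos z).ne'
    have r1 := congrArg Complex.re e1
    have r2 := congrArg Complex.im e1
    rw [Complex.re_ofReal_mul] at r1
    rw [Complex.im_ofReal_mul] at r2
    refine ⟨?_, ?_, ?_, ?_⟩
    · rw [r1]; simp [Complex.normSq_apply]; ring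
    · rw [r2]; simp [Complex.normSq_apply]; ring
    · rw [mul_add, e2, eW]; simp [Complex.normSq_apply]; ring
    · rw [mul_sub, e2, eW, hΔd]; simp [Complex.normSq_apply]; ring
  refine ⟨fun z => W z / Δ, fun z => div_pos (hdpos z) hΔ, fun p q z => ?_, fun z w => ?_,
    fun z => ?_⟩
  · obtain ⟨p1, p2, p3, -⟩ := lin p.toClosedDisk _ rfl
    obtain ⟨q1, q2, q3, -⟩ := lin q.toClosedDisk _ rfl
    obtain ⟨z1, z2, z3, -⟩ := lin z _ rfl
    have hp : Complex.normSq (p.toClosedDisk : ℂ) = 1 := Circle.normSq_coe p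
    have hq : Complex.normSq (q.toClosedDisk : ℂ) = 1 := Circle.normSq_coe q
    have hP : Complex.normSq (((T : Equiv.Perm ClosedDisk) p.toClosedDisk : ClosedDisk) : ℂ) = 1 :=
      Circle.normSq_coe (bdry T p)
    have hQ : Complex.normSq (((T : Equiv.Perm ClosedDisk) q.toClosedDisk : ClosedDisk) : ℂ) = 1 :=
      Circle.normSq_coe (bdry T q)
    -- Up to the factor 2 this is the determinant with rows `(re, im, 1 + |·|²)`, where the last
    -- entry is 2 for points of the circle; the linear action multiplies it by its own determinant.
    have gs : ∀ (p q z : ℂ), ((starRingEnd ℂ) p * q).im * (1 + ‖z‖ ^ 2) / 2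
        + ((starRingEnd ℂ) (q - p) * z).im =
        ((p.re * q.im - p.im * q.re) * (1 + Complex.normSq z) + 2 * (q.re * z.im - q.im * z.re)
          + 2 * (z.re * p.im - z.im * p.re)) / 2 := by
      intro p q z
      rw [Complex.normSq_eq_norm_sq]; simp; ring
    unfold geodesicSide
    rw [gs, gs]
    change (((((T : Equiv.Perm ClosedDisk) p.toClosedDisk : ClosedDisk) : ℂ).re *
      (((T : Equiv.Perm ClosedDisk) q.toClosedDisk : ClosedDisk) : ℂ).im -
      (((T : Equiv.Perm ClosedDisk) p.toClosedDisk : ClosedDisk) : ℂ).im *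
      (((T : Equiv.Perm ClosedDisk) q.toClosedDisk : ClosedDisk) : ℂ).re) * _ +
      2 * ((((T : Equiv.Perm ClosedDisk) q.toClosedDisk : ClosedDisk) : ℂ).re * _ -
        (((T : Equiv.Perm ClosedDisk) q.toClosedDisk : ClosedDisk) : ℂ).im * _) +
      2 * (_ * (((T : Equiv.Perm ClosedDisk) p.toClosedDisk : ClosedDisk) : ℂ).im -
        _ * (((T : Equiv.Perm ClosedDisk) p.toClosedDisk : ClosedDisk) : ℂ).re)) / 2 * _ =
      (((p.toClosedDisk : ℂ).re * (q.toClosedDisk : ℂ).im -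
        (p.toClosedDisk : ℂ).im * (q.toClosedDisk : ℂ).re) * _ +
      2 * ((q.toClosedDisk : ℂ).re * _ - (q.toClosedDisk : ℂ).im * _) +
      2 * (_ * (p.toClosedDisk : ℂ).im - _ * (p.toClosedDisk : ℂ).re)) / 2
    rw [hP] at p3
    rw [hQ] at q3
    rw [hp] at p1 p2 p3
    rw [hq] at q1 q2 q3
    generalize (((T : Equiv.Perm ClosedDisk) p.toClosedDisk : ClosedDisk) : ℂ) = P' at *
    generalize (((T : Equiv.Perm ClosedDisk) q.toClosedDisk : ClosedDisk) : ℂ) = Q' at *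
    generalize (((T : Equiv.Perm ClosedDisk) z : ClosedDisk) : ℂ) = Z' at *
    generalize Complex.normSq Z' = tZ at *
    have hΔ3 : Δ ^ 3 ≠ 0 := pow_ne_zero _ hΔ.ne'
    have expand : ((P'.re * Q'.im - P'.im * Q'.re) * (1 + tZ) + 2 * (Q'.re * Z'.im - Q'.im * Z'.re)
          + 2 * (Z'.re * P'.im - Z'.im * P'.re)) *
          (W p.toClosedDisk * W q.toClosedDisk * W z) =
        ((W p.toClosedDisk * P'.re) * (W q.toClosedDisk * Q'.im)
          - (W p.toClosedDisk * P'.im) * (W q.toClosedDisk * Q'.re)) * (W z * (1 + tZ))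
        + ((W q.toClosedDisk * Q'.re) * (W z * Z'.im)
          - (W q.toClosedDisk * Q'.im) * (W z * Z'.re)) * (W p.toClosedDisk * (1 + 1))
        + ((W z * Z'.re) * (W p.toClosedDisk * P'.im)
          - (W z * Z'.im) * (W p.toClosedDisk * P'.re)) * (W q.toClosedDisk * (1 + 1)) := by ring
    rw [p1, p2, p3, q1, q2, q3, z1, z2, z3] at expand
    have hm : W p.toClosedDisk / Δ * (W q.toClosedDisk / Δ) * (W z / Δ) =
      (W p.toClosedDisk * W q.toClosedDisk * W z) / Δ ^ 3 := by
      field_simp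
    rw [hm, div_mul_div_comm, expand, div_eq_div_iff (by positivity) (by positivity), hΔd,
      Complex.normSq_apply a, Complex.normSq_apply b]
    ring
  · have e1 := hT z
    have e2 := hT w
    have nz := hd z
    have nw := hd w
    have : (((T : Equiv.Perm ClosedDisk) z : ClosedDisk) : ℂ) -
        (((T : Equiv.Perm ClosedDisk) w : ClosedDisk) : ℂ) = (Δ : ℂ) * ((z : ℂ) - w) /
        (((starRingEnd ℂ) b * (z : ℂ) + (starRingEnd ℂ) a) *
          ((starRingEnd ℂ) b * (w : ℂ) + (starRingEnd ℂ) a)) := by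
      rw [e1, e2, div_sub_div _ _ nz nw, hΔd]
      congr 1
      push_cast
      rw [← Complex.mul_conj, ← Complex.mul_conj]
      ring
    rw [← Complex.normSq_eq_norm_sq, this, Complex.normSq_div, Complex.normSq_mul,
      Complex.normSq_mul, Complex.normSq_ofReal, Complex.normSq_eq_norm_sq (_ - _)]
    change _ / (W z * W w) * _ = _
    have := hW0 z
    have := hW0 w
    have := hΔ.ne'
    field_simp
  · obtain ⟨-, -, -, z4⟩ := lin z _ rfl
    rw [← Complex.normSq_eq_norm_sq, ← Complex.normSq_eq_norm_sq, mul_div_assoc',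
      mul_comm, z4]
    field_simp

/-! ### Invariance of orientation, geodesics and arcs under disk isometries -/

theorem Circle.toClosedDisk_injective : Function.Injective Circle.toClosedDisk := by
  intro x y h
  exact Circle.ext (congrArg (fun z : ClosedDisk => (z : ℂ)) h)

theorem bdry_mul (T U : diskMobius) (x : Circle) : bdry (T * U) x = bdry T (bdry U x) :=
  Circle.toClosedDisk_injective rfl

theorem bdry_one (x : Circle) : bdry 1 x = x := Circle.toClosedDisk_injective rfl

theorem bdry_injective (T : diskMobius) : Function.Injective (bdry T) := by
  intro x y h
  rw [← bdry_one x, ← bdry_one y, ← inv_mul_cancel T, bdry_mul, bdry_mul, h]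

theorem geodesicSide_bdry_pos (T : diskMobius) {p q : Circle} {z : ClosedDisk} :
    0 < geodesicSide (bdry T p) (bdry T q) (((T : Equiv.Perm ClosedDisk) z : ClosedDisk) : ℂ) ↔
      0 < geodesicSide p q z := by
  obtain ⟨m, hm, h, -⟩ := diskMobius_exists_weight T
  rw [← h p q z]
  exact (mul_pos_iff_of_pos_right (mul_pos (mul_pos (hm _) (hm _)) (hm _))).symm

theorem geodesicSide_bdry_eq_zero (T : diskMobius) {p q : Circle} {z : ClosedDisk} :
    geodesicSide (bdry T p) (bdry T q) (((T : Equiv.Perm ClosedDisk) z : ClosedDisk) : ℂ) = 0 ↔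
      geodesicSide p q z = 0 := by
  obtain ⟨m, hm, h, -⟩ := diskMobius_exists_weight T
  rw [← h p q z]
  have := (mul_pos (mul_pos (hm p.toClosedDisk) (hm q.toClosedDisk)) (hm z)).ne'
  simp [this]

theorem geodesicSide_bdry_pos_circle (T : diskMobius) {p q r : Circle} :
    0 < geodesicSide (bdry T p) (bdry T q) (bdry T r) ↔ 0 < geodesicSide p q r :=
  geodesicSide_bdry_pos T (z := r.toClosedDisk)

theorem diskMobius_norm_lt_one (T : diskMobius) {z : ClosedDisk} :
    ‖(((T : Equiv.Perm ClosedDisk) z : ClosedDisk) : ℂ)‖ < 1 ↔ ‖(z : ℂ)‖ < 1 := by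
  obtain ⟨m, hm, -, -, h⟩ := diskMobius_exists_weight T
  have key : ∀ z : ClosedDisk, ‖(z : ℂ)‖ < 1 ↔ 0 < 1 - ‖(z : ℂ)‖ ^ 2 := fun z => by
    rw [sub_pos, sq_lt_one_iff₀ (norm_nonneg _)]
  rw [key, key, ← h z]
  exact (mul_pos_iff_of_pos_right (hm _)).symm

theorem bdry_mem_geodesicLine (T : diskMobius) {p q : Circle} {z : ClosedDisk} :
    (T : Equiv.Perm ClosedDisk) z ∈ geodesicLine (bdry T p) (bdry T q) ↔
      z ∈ geodesicLine p q := by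
  change _ ∧ _ ↔ _ ∧ _
  rw [diskMobius_norm_lt_one, geodesicSide_bdry_eq_zero]

theorem bdry_mem_arcIco (T : diskMobius) {a b x : Circle} :
    bdry T x ∈ arcIco (bdry T a) (bdry T b) ↔ x ∈ arcIco a b := by
  rw [mem_arcIco_iff_side, mem_arcIco_iff_side, geodesicSide_bdry_pos_circle,
    (bdry_injective T).eq_iff, (bdry_injective T).ne_iff]

theorem bdry_mem_arcIcc (T : diskMobius) {a b x : Circle} :
    bdry T x ∈ arcIcc (bdry T a) (bdry T b) ↔ x ∈ arcIcc a b := by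
  rw [mem_arcIcc_iff, mem_arcIcc_iff, bdry_mem_arcIco, (bdry_injective T).eq_iff]

/-! ### Points on geodesics in the hyperboloid model -/

theorem norm_sub_sq_pos {z p : ℂ} (hz : ‖z‖ < 1) (hp : ‖p‖ = 1) : 0 < ‖z - p‖ ^ 2 := by
  have : z - p ≠ 0 := by
    intro h
    rw [sub_eq_zero] at h
    rw [h] at hz
    linarith
  positivity

/-- In the hyperboloid model, a point of a geodesic is a positive combination of the endpoints. -/
theorem exists_combination_of_mem_geodesicLine {p q : Circle} (hpq : p ≠ q) {z : ClosedDisk}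
    (hz : z ∈ geodesicLine p q) : ∃ α β : ℝ, 0 < α ∧ 0 < β ∧ ∀ r s : Circle,
      geodesicSide r s z = α * geodesicSide r s p + β * geodesicSide r s q := by
  obtain ⟨hz1, hz2⟩ := hz
  have hp := Circle.norm_coe p
  have hq := Circle.norm_coe q
  have hpq' : (p : ℂ) - q ≠ 0 := sub_ne_zero.2 fun h => hpq (Circle.ext h)
  have hc : 0 < ‖(p : ℂ) - q‖ ^ 2 := by positivity
  refine ⟨‖(z : ℂ) - q‖ ^ 2 / ‖(p : ℂ) - q‖ ^ 2, ‖(z : ℂ) - p‖ ^ 2 / ‖(p : ℂ) - q‖ ^ 2,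
    div_pos (norm_sub_sq_pos hz1 hq) hc, div_pos (norm_sub_sq_pos hz1 hp) hc, ?_⟩
  have ns : ∀ w : ℂ, ‖w‖ ^ 2 = w.re * w.re + w.im * w.im := fun w => by
    rw [← Complex.normSq_eq_norm_sq, Complex.normSq_apply]
  have hp' : ‖(p : ℂ)‖ ^ 2 = 1 := by rw [hp]; norm_num
  have hq' : ‖(q : ℂ)‖ ^ 2 = 1 := by rw [hq]; norm_num
  intro r s
  unfold geodesicSide at *
  have comb : (1 + ‖(z : ℂ)‖ ^ 2) / 2 * ‖(p : ℂ) - q‖ ^ 2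
        = ‖(z : ℂ) - q‖ ^ 2 + ‖(z : ℂ) - p‖ ^ 2 ∧
      (z : ℂ).re * ‖(p : ℂ) - q‖ ^ 2
        = ‖(z : ℂ) - q‖ ^ 2 * (p : ℂ).re + ‖(z : ℂ) - p‖ ^ 2 * (q : ℂ).re ∧
      (z : ℂ).im * ‖(p : ℂ) - q‖ ^ 2
        = ‖(z : ℂ) - q‖ ^ 2 * (p : ℂ).im + ‖(z : ℂ) - p‖ ^ 2 * (q : ℂ).im := by
    have hc0 := hc.ne'
    simp only [ns, Complex.sub_re, Complex.sub_im, map_sub, Complex.mul_im, Complex.conj_re,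
      Complex.conj_im] at *
    generalize (p : ℂ).re = p1 at *
    generalize (p : ℂ).im = p2 at *
    generalize (q : ℂ).re = q1 at *
    generalize (q : ℂ).im = q2 at *
    generalize (z : ℂ).re = z1 at *
    generalize (z : ℂ).im = z2 at *
    clear hz1 hp hq hpq' hc hpq
    clear ns r s
    -- `D` is the equation of the geodesic. Each coordinate identity, multiplied by `|p - q|²`, is a
    -- multiple of `D` modulo `|p| = |q| = 1`.
    obtain ⟨D, hD⟩ : ∃ D, D = (p1 * q2 + -p2 * q1) * (1 + (z1 * z1 + z2 * z2)) / 2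
      + ((q1 - p1) * z2 + (-q2 - -p2) * z1) := ⟨_, rfl⟩
    rw [← hD] at hz2
    have k1 : ((1 + (z1 * z1 + z2 * z2)) / 2 * ((p1 - q1) * (p1 - q1) + (p2 - q2) * (p2 - q2)) -
        ((z1 - q1) * (z1 - q1) + (z2 - q2) * (z2 - q2)
          + ((z1 - p1) * (z1 - p1) + (z2 - p2) * (z2 - p2)))) *
        ((p1 - q1) * (p1 - q1) + (p2 - q2) * (p2 - q2)) = -4 * (p1 * q2 - p2 * q1) * D := by
      rw [hD]; clear hD hz2 hc0; clear D z; grind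
    have k2 : (z1 * ((p1 - q1) * (p1 - q1) + (p2 - q2) * (p2 - q2)) -
        (((z1 - q1) * (z1 - q1) + (z2 - q2) * (z2 - q2)) * p1
          + ((z1 - p1) * (z1 - p1) + (z2 - p2) * (z2 - p2)) * q1)) *
        ((p1 - q1) * (p1 - q1) + (p2 - q2) * (p2 - q2)) = -4 * (q2 - p2) * D := by
      rw [hD]; clear hD hz2 hc0 k1; clear D z; grind
    have k3 : (z2 * ((p1 - q1) * (p1 - q1) + (p2 - q2) * (p2 - q2)) -
        (((z1 - q1) * (z1 - q1) + (z2 - q2) * (z2 - q2)) * p2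
          + ((z1 - p1) * (z1 - p1) + (z2 - p2) * (z2 - p2)) * q2)) *
        ((p1 - q1) * (p1 - q1) + (p2 - q2) * (p2 - q2)) = -4 * (p1 - q1) * D := by
      rw [hD]; clear hD hz2 hc0 k1 k2; clear D z; grind
    rw [hz2, mul_zero] at k1 k2 k3
    exact ⟨sub_eq_zero.1 ((mul_eq_zero.1 k1).resolve_right hc0),
      sub_eq_zero.1 ((mul_eq_zero.1 k2).resolve_right hc0),
      sub_eq_zero.1 ((mul_eq_zero.1 k3).resolve_right hc0)⟩
  obtain ⟨c1, c2, c3⟩ := comb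
  rw [hp', hq']
  have hc0 := hc.ne'
  field_simp
  simp only [Complex.sub_re, Complex.sub_im, map_sub, Complex.mul_im, Complex.conj_re,
    Complex.conj_im]
  linear_combination 2 * ((r : ℂ).re * (s : ℂ).im - (r : ℂ).im * (s : ℂ).re) * c1
    + 2 * (((s : ℂ).re - (r : ℂ).re)) * c3 - 2 * ((s : ℂ).im - (r : ℂ).im) * c2

/-- Moving from an interior point towards a boundary point, in the hyperboloid model. -/
theorem exists_point_on_ray {v : ClosedDisk} (hv : ‖(v : ℂ)‖ < 1) (x : Circle) {ε : ℝ}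
    (hε : 0 < ε) : ∃ z : ClosedDisk, ‖(z : ℂ)‖ < 1 ∧ ∃ c : ℝ, 0 < c ∧ ∀ r s : Circle,
      geodesicSide r s z = c * (geodesicSide r s v + ε * geodesicSide r s x) := by
  have hx := Circle.norm_coe x
  -- `ζ` and `t` are the space and time coordinates of the vector `v + ε x`, which is timelike
  -- because `|ζ| < t`. Division by `t + s`, where `s² = t² - |ζ|²`, projects it back to the disk.
  obtain ⟨t, ht⟩ : ∃ t : ℝ, t = (1 + ‖(v : ℂ)‖ ^ 2) / 2 + ε := ⟨_, rfl⟩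
  obtain ⟨ζ, hζ⟩ : ∃ ζ : ℂ, ζ = (v : ℂ) + ε * (x : ℂ) := ⟨_, rfl⟩
  have h1 : ‖ζ‖ < t := by
    have : ‖ζ‖ ≤ ‖(v : ℂ)‖ + ε := by
      rw [hζ]
      refine (norm_add_le _ _).trans ?_
      rw [norm_mul, hx, Complex.norm_real, Real.norm_eq_abs, abs_of_pos hε, mul_one]
    nlinarith [norm_nonneg (v : ℂ)]
  have ht0 : 0 < t := lt_of_le_of_lt (norm_nonneg _) h1
  obtain ⟨s, hs⟩ : ∃ s : ℝ, s = Real.sqrt (t ^ 2 - ‖ζ‖ ^ 2) := ⟨_, rfl⟩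
  have hs0 : 0 < s := hs ▸ Real.sqrt_pos.2 (by nlinarith [norm_nonneg ζ])
  have hs2 : s ^ 2 = t ^ 2 - ‖ζ‖ ^ 2 := hs ▸ Real.sq_sqrt (by nlinarith [norm_nonneg ζ])
  have hn : ‖((1 / (t + s) : ℝ) : ℂ) * ζ‖ = ‖ζ‖ / (t + s) := by
    rw [norm_mul, Complex.norm_real, Real.norm_eq_abs, abs_of_pos (by positivity)]
    ring
  have hz : ‖((1 / (t + s) : ℝ) : ℂ) * ζ‖ < 1 := by
    rw [hn, div_lt_one (by linarith)]
    linarith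
  refine ⟨⟨((1 / (t + s) : ℝ) : ℂ) * ζ, by rw [mem_closedBall_zero_iff]; exact hz.le⟩, hz,
    1 / (t + s), by positivity, fun r u => ?_⟩
  unfold geodesicSide
  change _ * (1 + ‖((1 / (t + s) : ℝ) : ℂ) * ζ‖ ^ 2) / 2
    + ((starRingEnd ℂ) ((u : ℂ) - r) * (((1 / (t + s) : ℝ) : ℂ) * ζ)).im = _
  have e1 : (1 + ‖((1 / (t + s) : ℝ) : ℂ) * ζ‖ ^ 2) / 2 = 1 / (t + s) * t := by
    rw [hn, div_pow]
    have : (t + s) ≠ 0 := by positivity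
    field_simp
    linear_combination hs2
  rw [mul_div_assoc, e1, hx, hζ, ht, mul_left_comm ((starRingEnd ℂ) ((u : ℂ) - r)),
    Complex.im_ofReal_mul, mul_add ((starRingEnd ℂ) ((u : ℂ) - r)), Complex.add_im,
    mul_left_comm ((starRingEnd ℂ) ((u : ℂ) - r)), Complex.im_ofReal_mul]
  ring

/-! ### Index arithmetic -/

section Index

variable {g : ℕ}

theorem odd_val_intCast (hg : 2 ≤ g) (k : ℤ) :
    Odd ((k : ZMod (8 * g - 4)).val) ↔ Odd k := by
  have hN : NeZero (8 * g - 4) := ⟨by omega⟩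
  have h : (((k : ZMod (8 * g - 4)).val : ℕ) : ℤ) = k % ((8 * g - 4 : ℕ) : ℤ) :=
    ZMod.val_intCast k
  rw [← Int.odd_coe_nat, h, Int.odd_iff, Int.odd_iff]
  rw [Int.emod_emod_of_dvd]
  omega

theorem sidePairing_intCast (hg : 2 ≤ g) (k : ℤ) :
    sidePairing g (k : ZMod (8 * g - 4)) =
      ((if Odd k then 4 * g - k else 2 - k : ℤ) : ZMod (8 * g - 4)) := by
  unfold sidePairing
  simp only [odd_val_intCast hg]
  split_ifs <;> push_cast <;> rfl

theorem intCast_eq_of_sub {n : ℕ} {a b : ℤ} (c : ℤ) (h : a - b = n * c) :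
    (a : ZMod n) = (b : ZMod n) := by
  rw [ZMod.intCast_eq_intCast_iff_dvd_sub]
  exact ⟨-c, by linarith⟩

theorem natCast_mod_eq (hg : 2 ≤ g) : (((8 * g - 4 : ℕ) : ℕ) : ℤ) = 8 * g - 4 := by
  omega

theorem oppositeSide_intCast (k : ℤ) :
    oppositeSide g (k : ZMod (8 * g - 4)) = ((k + (4 * g - 2) : ℤ) : ZMod (8 * g - 4)) := by
  unfold oppositeSide; push_cast; rfl

theorem sidePairing_sidePairing (hg : 2 ≤ g) (i : ZMod (8 * g - 4)) :
    sidePairing g (sidePairing g i) = i := by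
  obtain ⟨k, rfl⟩ := ZMod.intCast_surjective i
  rw [sidePairing_intCast hg, sidePairing_intCast hg]
  congr 1
  grind

theorem oppositeSide_oppositeSide (hg : 2 ≤ g) (i : ZMod (8 * g - 4)) :
    oppositeSide g (oppositeSide g i) = i := by
  obtain ⟨k, rfl⟩ := ZMod.intCast_surjective i
  rw [oppositeSide_intCast, oppositeSide_intCast]
  refine intCast_eq_of_sub 1 ?_
  rw [natCast_mod_eq hg]; ring

theorem oppositeSide_add_one (i : ZMod (8 * g - 4)) :
    oppositeSide g (i + 1) = oppositeSide g i + 1 := by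
  unfold oppositeSide; ring

theorem oppositeSide_sub_one (i : ZMod (8 * g - 4)) :
    oppositeSide g (i - 1) = oppositeSide g i - 1 := by
  unfold oppositeSide; ring

theorem sidePairing_oppositeSide (hg : 2 ≤ g) (i : ZMod (8 * g - 4)) :
    sidePairing g (oppositeSide g i) = oppositeSide g (sidePairing g i) := by
  obtain ⟨k, rfl⟩ := ZMod.intCast_surjective i
  have hN := natCast_mod_eq hg
  rw [oppositeSide_intCast, sidePairing_intCast hg, sidePairing_intCast hg, oppositeSide_intCast]
  by_cases h : Odd k
  · have h' : Odd (k + (4 * g - 2)) := by grind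
    rw [if_pos h, if_pos h']
    exact intCast_eq_of_sub (-1) (by rw [hN]; ring)
  · have h' : ¬ Odd (k + (4 * g - 2)) := by grind
    rw [if_neg h, if_neg h']
    exact intCast_eq_of_sub (-1) (by rw [hN]; ring)

theorem sidePairing_add_one (hg : 2 ≤ g) (i : ZMod (8 * g - 4)) :
    sidePairing g (i + 1) = oppositeSide g (sidePairing g i) - 1 := by
  obtain ⟨k, rfl⟩ := ZMod.intCast_surjective i
  have hN := natCast_mod_eq hg
  have e1 : ((k : ZMod (8 * g - 4)) + 1) = ((k + 1 : ℤ) : ZMod (8 * g - 4)) := by push_cast; rfl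
  rw [e1, sidePairing_intCast hg, sidePairing_intCast hg, oppositeSide_intCast]
  have e2 : ∀ m : ℤ, ((m : ZMod (8 * g - 4)) - 1) = ((m - 1 : ℤ) : ZMod (8 * g - 4)) := by
    intro m; push_cast; rfl
  rw [e2]
  by_cases h : Odd k
  · have h' : ¬ Odd (k + 1) := by grind
    rw [if_pos h, if_neg h']
    exact intCast_eq_of_sub (-1) (by rw [hN]; ring)
  · have h' : Odd (k + 1) := by grind
    rw [if_neg h, if_pos h']
    exact intCast_eq_of_sub 0 (by ring)

theorem sidePairing_sub_one (hg : 2 ≤ g) (i : ZMod (8 * g - 4)) :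
    sidePairing g (i - 1) = oppositeSide g (sidePairing g i) + 1 := by
  have h := sidePairing_add_one hg (i - 1)
  rw [sub_add_cancel] at h
  rw [h, oppositeSide_sub_one, oppositeSide_oppositeSide hg, sub_add_cancel]

theorem vertexMap_vertexMap (hg : 2 ≤ g) (i : ZMod (8 * g - 4)) :
    vertexMap g (vertexMap g i) = oppositeSide g i := by
  unfold vertexMap
  rw [sidePairing_add_one hg, sidePairing_sidePairing hg, sub_add_cancel]

end Index

/-! ### Lifts of cyclically ordered families of points -/

/-- `x` is a lift to the line of the family `X` of points on the circle, indexed modulo `n`. -/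
structure IsCircleLift {n : ℕ} (X : ZMod n → Circle) (x : ℤ → ℝ) : Prop where
  exp : ∀ k : ℤ, Circle.exp (x k) = X (k : ZMod n)
  add : ∀ k : ℤ, x (k + n) = x k + 2 * Real.pi

theorem IsCircleLift.add_mul {n : ℕ} {X : ZMod n → Circle} {x : ℤ → ℝ} (h : IsCircleLift X x)
    (k m : ℤ) : x (k + n * m) = x k + m * (2 * Real.pi) := by
  induction m using Int.induction_on with
  | zero => simp
  | succ m ih =>
    rw [mul_add, mul_one, ← add_assoc, h.add, ih]; push_cast; ring
  | pred m ih =>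
    have := h.add (k + n * (-(m : ℤ) - 1))
    rw [show k + n * (-(m : ℤ) - 1) + n = k + n * (-(m : ℤ)) by ring, ih] at this
    push_cast at this ⊢
    linarith

/-- Lifting a family of points that lie on given arcs. -/
theorem IsCircleLift.exists_between {n : ℕ} {X Y Z : ZMod n → Circle} {x y : ℤ → ℝ}
    (hx : IsCircleLift X x) (hy : IsCircleLift Y y) (h1 : ∀ k, x k ≤ y k)
    (h2 : ∀ k, y k < x k + 2 * Real.pi)
    (hZ : ∀ k : ℤ, Z k ∈ arcIcc (X k) (Y k)) :
    ∃ z : ℤ → ℝ, IsCircleLift Z z ∧ (∀ k, x k ≤ z k) ∧ ∀ k, z k ≤ y k := by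
  refine ⟨fun k => x k + ccwAngle (X k) (Z k), ⟨fun k => ?_, fun k => ?_⟩, fun k => ?_, fun k => ?_⟩
  · rw [← hx.exp, exp_add_ccwAngle]
  · simp only [hx.add]; push_cast; simp; ring
  · linarith [ccwAngle_nonneg (X k) (Z k)]
  · have h : ccwAngle (X k) (Z k) ≤ ccwAngle (X k) (Y k) := hZ k
    have h3 : ccwAngle (X k) (Y k) = y k - x k := by
      rw [← hx.exp, ← hy.exp, ccwAngle_exp (h1 k) (h2 k)]
    simp only; linarith

namespace FundamentalPolygon

variable {g : ℕ} (S : FundamentalPolygon g)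

/-- The endpoints of the extended sides lift to an increasing sequence on the line. -/
theorem exists_lift (hg : 2 ≤ g) : ∃ p q : ℤ → ℝ, IsCircleLift S.P p ∧ IsCircleLift S.Q q ∧
    (∀ k, p k < q k) ∧ ∀ k, q k < p (k + 1) := by
  have hN := natCast_mod_eq hg
  obtain ⟨α, hα⟩ := Circle.exp_surjective (S.P 1)
  have hNpos : (0 : ℤ) < ((8 * g - 4 : ℕ) : ℤ) := by omega
  set N : ℤ := ((8 * g - 4 : ℕ) : ℤ) with hNd
  have cast_add : ∀ k : ℤ, ((k + N : ℤ) : ZMod (8 * g - 4)) = k := fun k => by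
    rw [hNd]; push_cast; simp
  have div_add : ∀ k : ℤ, (k + N - 1) / N = (k - 1) / N + 1 := fun k => by
    rw [show k + N - 1 = (k - 1) + N by ring, Int.add_ediv_of_dvd_right (dvd_refl N),
      Int.ediv_self hNpos.ne']
  -- The number of full turns is the integer part of `(k - 1) / N`, because the cyclic order is
  -- given starting at index 1.
  have lift : ∀ X : ZMod (8 * g - 4) → Circle, IsCircleLift X
      (fun k => α + ccwAngle (S.P 1) (X k) + ((k - 1) / N : ℤ) * (2 * Real.pi)) := by
    intro X
    refine ⟨fun k => ?_, fun k => ?_⟩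
    · rw [Circle.exp_add, Circle.exp_int_mul_two_pi, mul_one, ← hα, exp_add_ccwAngle]
    · rw [cast_add, div_add]; push_cast; ring
  refine ⟨_, _, lift S.P, lift S.Q, fun k => ?_, fun k => ?_⟩
  all_goals
    obtain ⟨i, m, hi1, hi2, rfl⟩ : ∃ (i : ℕ) (m : ℤ), 1 ≤ i ∧ i ≤ 8 * g - 4 ∧ k = i + N * m := by
      have h1 := Int.emod_nonneg (k - 1) hNpos.ne'
      have h2 := Int.emod_lt_of_pos (k - 1) hNpos
      have h3 := Int.emod_add_mul_ediv (k - 1) N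
      refine ⟨((k - 1) % N + 1).toNat, (k - 1) / N, by omega, by omega, by omega⟩
  · have := S.order_PQ i hi1 hi2
    have e : (((i : ℤ) + N * m : ℤ) : ZMod (8 * g - 4)) = (i : ZMod (8 * g - 4)) := by
      rw [hNd]; push_cast; simp
    simp only [e]
    linarith
  · rw [(lift S.Q).add_mul, show (i : ℤ) + N * m + 1 = (i + 1) + N * m by ring,
      (lift S.P).add_mul]
    have e : ((i : ℤ) : ZMod (8 * g - 4)) = (i : ZMod (8 * g - 4)) := by push_cast; rfl
    rcases Nat.lt_or_ge i (8 * g - 4) with h | h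
    · have := S.order_QP i hi1 h
      have d1 : ((i : ℤ) - 1) / N = 0 := Int.ediv_eq_zero_of_lt (by omega) (by omega)
      have d2 : ((i : ℤ) + 1 - 1) / N = 0 := Int.ediv_eq_zero_of_lt (by omega) (by omega)
      simp only [d1, d2]
      push_cast
      linarith
    · have hiN : (i : ℤ) = N := by omega
      have d1 : ((i : ℤ) - 1) / N = 0 := Int.ediv_eq_zero_of_lt (by omega) (by omega)
      have d2 : ((i : ℤ) + 1 - 1) / N = 1 := by
        rw [add_sub_cancel_right, hiN, Int.ediv_self hNpos.ne']
      simp only [d1, d2]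
      have h5 := ccwAngle_lt (S.P 1) (S.Q (i : ℤ))
      have h6 := ccwAngle_nonneg (S.P 1) (S.P ((i + 1 : ℤ) : ZMod (8 * g - 4)))
      push_cast at h5 h6 ⊢
      linarith

end FundamentalPolygon

/-! ### The action of the side pairings on the endpoints of the extended sides -/

namespace FundamentalPolygon

variable {g : ℕ} (S : FundamentalPolygon g)

theorem T_mul_T_sidePairing (hg : 2 ≤ g) (i : ZMod (8 * g - 4)) :
    S.T i * S.T (sidePairing g i) = 1 := by
  have := S.pairing_inv (sidePairing g i)
  rwa [sidePairing_sidePairing hg] at this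

theorem T_inv (i : ZMod (8 * g - 4)) : (S.T i)⁻¹ = S.T (sidePairing g i) :=
  inv_eq_of_mul_eq_one_left (S.pairing_inv i)

theorem bdry_sidePairing_bdry (i : ZMod (8 * g - 4)) (x : Circle) :
    bdry (S.T (sidePairing g i)) (bdry (S.T i) x) = x := by
  rw [← bdry_mul, S.pairing_inv, bdry_one]

theorem bdry_bdry_sidePairing (hg : 2 ≤ g) (i : ZMod (8 * g - 4)) (x : Circle) :
    bdry (S.T i) (bdry (S.T (sidePairing g i)) x) = x := by
  rw [← bdry_mul, S.T_mul_T_sidePairing hg, bdry_one]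

theorem map_vertex_add_one (hg : 2 ≤ g) (i : ZMod (8 * g - 4)) :
    (S.T i : Equiv.Perm ClosedDisk) (S.V (i + 1)) = S.V (sidePairing g i) := by
  have h := S.map_vertex (sidePairing g i)
  unfold vertexMap at h
  rw [sidePairing_sidePairing hg] at h
  rw [← h]
  have h2 := S.T_mul_T_sidePairing hg i
  have h3 : ((S.T i * S.T (sidePairing g i) : diskMobius) : Equiv.Perm ClosedDisk)
    (S.V (sidePairing g i)) = S.V (sidePairing g i) := by rw [h2]; rfl
  exact h3

/-- A vertex lies strictly on the left of all extended sides that do not pass through it. -/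
theorem side_vertex_pos (hg : 2 ≤ g) {i j : ZMod (8 * g - 4)} (h1 : j ≠ i - 1) (h2 : j ≠ i) :
    0 < geodesicSide (S.P j) (S.Q (j + 1)) (S.V i) := by
  obtain ⟨p, q, hp, hq, hpq, hqp⟩ := S.exists_lift hg
  have hN := natCast_mod_eq hg
  obtain ⟨k, rfl⟩ := ZMod.intCast_surjective i
  have pm : StrictMono p := strictMono_int_of_lt_succ fun k => (hpq k).trans (hqp k)
  have qm : StrictMono q := strictMono_int_of_lt_succ fun k => (hqp k).trans (hpq (k + 1))
  obtain ⟨l, rfl, l1, l2⟩ : ∃ l : ℤ, (l : ZMod (8 * g - 4)) = j ∧ k < l ∧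
      l < k + ((8 * g - 4 : ℕ) : ℤ) - 1 := by
    obtain ⟨m, rfl⟩ := ZMod.intCast_surjective j
    have hNpos : (0 : ℤ) < ((8 * g - 4 : ℕ) : ℤ) := by omega
    have e1 := Int.emod_nonneg (m - k) hNpos.ne'
    have e2 := Int.emod_lt_of_pos (m - k) hNpos
    have e3 := Int.emod_add_mul_ediv (m - k) ((8 * g - 4 : ℕ) : ℤ)
    have e4 : ((k + (m - k) % ((8 * g - 4 : ℕ) : ℤ) : ℤ) : ZMod (8 * g - 4)) = m :=
      intCast_eq_of_sub (-((m - k) / ((8 * g - 4 : ℕ) : ℤ))) (by linarith)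
    refine ⟨k + (m - k) % ((8 * g - 4 : ℕ) : ℤ), e4, ?_, ?_⟩
    · rcases eq_or_lt_of_le e1 with h | h
      · rw [← h, add_zero] at e4
        exact absurd e4.symm h2
      · linarith
    · by_contra hcon
      have h : (m - k) % ((8 * g - 4 : ℕ) : ℤ) = ((8 * g - 4 : ℕ) : ℤ) - 1 := by omega
      rw [h] at e4
      apply h1
      rw [← e4]; push_cast; simp; ring
  have e1 : ((l : ZMod (8 * g - 4)) + 1) = ((l + 1 : ℤ) : ZMod (8 * g - 4)) := by push_cast; rfl
  have e2 : ((k : ZMod (8 * g - 4)) + 1) = ((k + 1 : ℤ) : ZMod (8 * g - 4)) := by push_cast; rfl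
  have e3 : ((k : ZMod (8 * g - 4)) - 1) = ((k - 1 : ℤ) : ZMod (8 * g - 4)) := by push_cast; rfl
  have ne : ∀ m : ℤ, S.P (m : ZMod (8 * g - 4)) ≠ S.Q ((m + 1 : ℤ) : ZMod (8 * g - 4)) := by
    intro m h
    rw [← hp.exp, ← hq.exp] at h
    have h5 := hp.add m
    have h6 : q (m + 1) < p (m + 2) := hqp (m + 1) |>.trans_eq (by ring_nf)
    have h7 : p (m + 2) < p (m + ((8 * g - 4 : ℕ) : ℤ)) := pm (by omega)
    have h8 := pm (show m < m + 1 by omega)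
    have h9 := hpq (m + 1)
    have := Circle.exp_injOn_Ico (a := p m) (b := p m + 2 * Real.pi) (by simp)
      ⟨le_refl _, by linarith⟩ ⟨by linarith, by linarith⟩ h
    linarith
  have hl : p l < q (l + 1) := (pm (show l < l + 1 by omega)).trans (hpq _)
  have pos : ∀ y : ℝ, q (l + 1) < y → y < p (l + ((8 * g - 4 : ℕ) : ℤ)) →
      0 < geodesicSide (S.P (l : ZMod (8 * g - 4))) (S.Q ((l + 1 : ℤ) : ZMod (8 * g - 4)))
        (Circle.exp y) := by
    intro y y1 y2
    rw [← hp.exp, ← hq.exp]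
    rw [hp.add] at y2
    exact geodesicSide_pos_of_lt hl y1 y2
  rw [e1]
  -- The vertex lies on the extended sides `i - 1` and `i`. It suffices that one of them has both
  -- ends to the left of side `j`; the line of side `i - 1` serves except for `j = i - 2`, where its
  -- start is not to the left.
  by_cases hlast : l = k + ((8 * g - 4 : ℕ) : ℤ) - 2
  · have hv := S.vertex_mem_right k
    rw [e2] at hv
    obtain ⟨α, β, hα, hβ, h⟩ := exists_combination_of_mem_geodesicLine (ne k) hv
    rw [h]
    have a1 := pos (p (k + ((8 * g - 4 : ℕ) : ℤ)))
      ((hqp (l + 1)).trans_le (pm.monotone (by omega))) (pm (by omega))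
    have a2 := pos (q (k + 1 + ((8 * g - 4 : ℕ) : ℤ)))
      (qm (by omega)) ((hqp _).trans_le (pm.monotone (by omega)))
    rw [hp.add, Circle.exp_add_two_pi, hp.exp] at a1
    rw [hq.add, Circle.exp_add_two_pi, hq.exp] at a2
    positivity
  · have hv := S.vertex_mem_left k
    have ne' := ne (k - 1)
    rw [sub_add_cancel] at ne'
    rw [e3] at hv
    obtain ⟨α, β, hα, hβ, h⟩ := exists_combination_of_mem_geodesicLine ne' hv
    rw [h]
    have a1 := pos (p (k - 1 + ((8 * g - 4 : ℕ) : ℤ)))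
      ((hqp (l + 1)).trans_le (pm.monotone (by omega))) (pm (by omega))
    have a2 := pos (q (k + ((8 * g - 4 : ℕ) : ℤ)))
      (qm (by omega)) ((hqp _).trans_le (pm.monotone (by omega)))
    rw [hp.add, Circle.exp_add_two_pi, hp.exp] at a1
    rw [hq.add, Circle.exp_add_two_pi, hq.exp] at a2
    positivity

/-- The cyclic order of the endpoints of the two extended sides through a vertex. -/
theorem order_at_vertex (hg : 2 ≤ g) (j : ZMod (8 * g - 4)) : ∃ a b c d : ℝ,
    a < b ∧ b < c ∧ c < d ∧ d < a + 2 * Real.pi ∧ Circle.exp a = S.P (j - 1) ∧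
    Circle.exp b = S.P j ∧ Circle.exp c = S.Q j ∧ Circle.exp d = S.Q (j + 1) := by
  obtain ⟨p, q, hp, hq, hpq, hqp⟩ := S.exists_lift hg
  have hN := natCast_mod_eq hg
  obtain ⟨k, rfl⟩ := ZMod.intCast_surjective j
  have pm : StrictMono p := strictMono_int_of_lt_succ fun k => (hpq k).trans (hqp k)
  refine ⟨p (k - 1), p k, q k, q (k + 1), pm (by omega), hpq k,
    (hqp k).trans (hpq _), ?_, ?_, hp.exp k, hq.exp k, ?_⟩
  · rw [← hp.add]
    exact (hqp _).trans_le (pm.monotone (by omega))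
  · rw [hp.exp]; push_cast; rfl
  · rw [hq.exp]; push_cast; rfl

theorem exp_ne_exp {a b : ℝ} (h : a < b) (h' : b < a + 2 * Real.pi) :
    Circle.exp a ≠ Circle.exp b := by
  intro he
  have := Circle.exp_injOn_Ico (a := a) (b := a + 2 * Real.pi) (by simp)
      ⟨le_refl _, by linarith⟩ ⟨by linarith, by linarith⟩ he
  linarith

theorem P_ne_Q_add_one (hg : 2 ≤ g) (j : ZMod (8 * g - 4)) : S.P j ≠ S.Q (j + 1) := by
  obtain ⟨a, b, c, d, h1, h2, h3, h4, ea, eb, ec, ed⟩ := S.order_at_vertex hg j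
  rw [← eb, ← ed]
  exact exp_ne_exp (by linarith) (by linarith)

/-- Side `i` is mapped to side `σ(i)`, with the opposite orientation. -/
theorem map_side (hg : 2 ≤ g) (i : ZMod (8 * g - 4)) :
    bdry (S.T i) (S.P i) = S.Q (sidePairing g i + 1) ∧
      bdry (S.T i) (S.Q (i + 1)) = S.P (sidePairing g i) := by
  have one_ne : ∀ j : ZMod (8 * g - 4), j - 1 ≠ j + 1 - 1 ∧ j - 1 ≠ j + 1 := by
    intro j
    obtain ⟨k, rfl⟩ := ZMod.intCast_surjective j
    have key : ∀ m : ℤ, 0 < m → m < 3 → ((m : ℤ) : ZMod (8 * g - 4)) ≠ 0 := by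
      intro m m1 m2 h
      rw [ZMod.intCast_zmod_eq_zero_iff_dvd] at h
      have := Int.le_of_dvd m1 h
      have := natCast_mod_eq hg
      omega
    constructor
    · intro h
      apply key 1 (by norm_num) (by norm_num)
      push_cast
      linear_combination -h
    · intro h
      apply key 2 (by norm_num) (by norm_num)
      push_cast
      linear_combination -h
  obtain ⟨s, hs⟩ : ∃ s, s = sidePairing g i := ⟨_, rfl⟩
  have hsi : sidePairing g s = i := by rw [hs, sidePairing_sidePairing hg]
  -- on side `j`, the geodesic of side `j - 1` separates the endpoints
  have sep : ∀ j : ZMod (8 * g - 4),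
      geodesicSide (S.P (j - 1)) (S.Q j) (S.V j) = 0 ∧
      0 < geodesicSide (S.P (j - 1)) (S.Q j) (S.V (j + 1)) ∧
      geodesicSide (S.P (j - 1)) (S.Q j) (S.P j) < 0 ∧
      0 < geodesicSide (S.P (j - 1)) (S.Q j) (S.Q (j + 1)) := by
    intro j
    have h1 := S.side_vertex_pos hg (one_ne j).1 (one_ne j).2
    rw [sub_add_cancel] at h1
    obtain ⟨a, b, c, d, a1, a2, a3, a4, ea, eb, ec, ed⟩ := S.order_at_vertex hg j
    refine ⟨(S.vertex_mem_left j).2, h1, ?_, ?_⟩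
    · rw [← ea, ← eb, ← ec, geodesicSide_swap]
      linarith [geodesicSide_pos_of_lt a1 a2 (by linarith)]
    · rw [← ea, ← ec, ← ed]
      exact geodesicSide_pos_of_lt (by linarith) a3 a4
  have v1 : (S.T i : Equiv.Perm ClosedDisk) (S.V i) = S.V (s + 1) := by
    rw [S.map_vertex, hs]; rfl
  have v2 : (S.T i : Equiv.Perm ClosedDisk) (S.V (i + 1)) = S.V s := by
    rw [S.map_vertex_add_one hg, hs]
  have w1 := (bdry_mem_geodesicLine (S.T i)).2 (S.vertex_mem_right i)
  have w2' := S.vertex_mem_left (i + 1)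
  rw [add_sub_cancel_right] at w2'
  have w2 := (bdry_mem_geodesicLine (S.T i)).2 w2'
  rw [v1] at w1
  rw [v2] at w2
  have u1 := S.vertex_mem_right s
  have u2 := S.vertex_mem_left (s + 1)
  rw [add_sub_cancel_right] at u2
  have hne : bdry (S.T i) (S.P i) ≠ bdry (S.T i) (S.Q (i + 1)) := fun h =>
    S.P_ne_Q_add_one hg i (bdry_injective _ h)
  obtain ⟨α, β, hα, hβ, hc⟩ := exists_combination_of_mem_geodesicLine hne w2
  obtain ⟨α', β', hα', hβ', hc'⟩ := exists_combination_of_mem_geodesicLine hne w1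
  obtain ⟨f1, f2, f3, f4⟩ := sep s
  -- The two vertices are not proportional as vectors: the line of side `s - 1` passes through the
  -- first and not through the second.
  have hdet : α * β' - α' * β ≠ 0 := by
    intro h0
    rw [hc] at f1
    rw [hc'] at f2
    have h1 := mul_pos hα f2
    have h2 : α * (α' * geodesicSide (S.P (s - 1)) (S.Q s) (bdry (S.T i) (S.P i)) +
        β' * geodesicSide (S.P (s - 1)) (S.Q s) (bdry (S.T i) (S.Q (i + 1)))) = 0 := by
      linear_combination α' * f1 +
        geodesicSide (S.P (s - 1)) (S.Q s) (bdry (S.T i) (S.Q (i + 1))) * h0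
    linarith
  have z1 := u1.2
  have z2 := u2.2
  rw [hc] at z1
  rw [hc'] at z2
  -- The functional that defines side `s` vanishes at both vertices, hence on the plane they span,
  -- which contains both ends of the image line.
  have x0 : geodesicSide (S.P s) (S.Q (s + 1)) (bdry (S.T i) (S.P i)) = 0 := by
    refine (mul_eq_zero.1 (?_ : (α * β' - α' * β) * _ = 0)).resolve_left hdet
    linear_combination β' * z1 - β * z2
  have y0 : geodesicSide (S.P s) (S.Q (s + 1)) (bdry (S.T i) (S.Q (i + 1))) = 0 := by
    refine (mul_eq_zero.1 (?_ : (α * β' - α' * β) * _ = 0)).resolve_left hdet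
    linear_combination α * z2 - α' * z1
  rw [geodesicSide_eq_zero_iff (S.P_ne_Q_add_one hg s)] at x0 y0
  rw [← hs]
  rcases x0 with x0 | x0
  · exfalso
    have y1 : bdry (S.T i) (S.Q (i + 1)) = S.Q (s + 1) :=
      y0.resolve_left fun h => hne (x0.trans h.symm)
    -- orientation
    have t1 : bdry (S.T s) (S.P s) = S.P i := by rw [← x0, hs, S.bdry_sidePairing_bdry]
    have t2 : bdry (S.T s) (S.Q (s + 1)) = S.Q (i + 1) := by
      rw [← y1, hs, S.bdry_sidePairing_bdry]
    have t3 : (S.T s : Equiv.Perm ClosedDisk) (S.V s) = S.V (i + 1) := by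
      rw [S.map_vertex, vertexMap, hsi]
    have t4 : (S.T s : Equiv.Perm ClosedDisk) (S.V (s + 1)) = S.V i := by
      rw [S.map_vertex_add_one hg, hsi]
    rw [← geodesicSide_bdry_eq_zero (S.T s), t3] at f1
    rw [← geodesicSide_bdry_pos (S.T s), t4] at f2
    rw [← geodesicSide_bdry_pos_circle (S.T s), t2] at f4
    obtain ⟨a, b, ha, hb, hd⟩ :=
      exists_combination_of_mem_geodesicLine (S.P_ne_Q_add_one hg i) (S.vertex_mem_right i)
    obtain ⟨a', b', ha', hb', hd'⟩ :=
      exists_combination_of_mem_geodesicLine (S.P_ne_Q_add_one hg i) w2'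
    obtain ⟨e1, e2, e3, e4⟩ := sep i
    rw [hd] at e1 f2
    rw [hd'] at e2 f1
    generalize geodesicSide (S.P (i - 1)) (S.Q i) (S.P i) = x at *
    generalize geodesicSide (S.P (i - 1)) (S.Q i) (S.Q (i + 1)) = y at *
    generalize geodesicSide (bdry (S.T s) (S.P (s - 1))) (bdry (S.T s) (S.Q s)) (S.P i) = X at *
    generalize geodesicSide (bdry (S.T s) (S.P (s - 1))) (bdry (S.T s) (S.Q s))
      (S.Q (i + 1)) = Y at *
    -- The sign of this determinant says that `V i` precedes `V (i + 1)` on the way from `P i` to `Q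
    -- (i + 1)`. If `T s` preserved the direction of the line, the images of the vertices of side
    -- `s` would come in that order too, but they are `V (i + 1)` and then `V i`.
    have g1 : 0 < a * b' - a' * b := by
      have : 0 < (-x) * (a * b' - a' * b) := by
        have := mul_pos hb e2
        nlinarith
      exact (mul_pos_iff_of_pos_left (by linarith)).1 this
    have g2 : 0 < Y * (a' * b - a * b') := by
      have := mul_pos ha' f2
      nlinarith
    nlinarith
  · exact ⟨x0, y0.resolve_right fun h => hne (x0.trans h.symm)⟩

theorem map_P (hg : 2 ≤ g) (i : ZMod (8 * g - 4)) :
    bdry (S.T i) (S.P i) = S.Q (sidePairing g i + 1) := (S.map_side hg i).1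

theorem map_Q_add_one (hg : 2 ≤ g) (i : ZMod (8 * g - 4)) :
    bdry (S.T i) (S.Q (i + 1)) = S.P (sidePairing g i) := (S.map_side hg i).2

/-- By the extension condition, an image of an extended side through a vertex does not enter the
sector of the polygon at this vertex. -/
theorem not_in_sector (hg : 2 ≤ g) {γ : diskMobius} (hγ : γ ∈ Subgroup.closure (Set.range S.T))
    {j k : ZMod (8 * g - 4)}
    (hV : (γ : Equiv.Perm ClosedDisk) (S.V j) ∈ geodesicLine (S.P k) (S.Q (k + 1)))
    {r s x : Circle} (hr : bdry γ r = S.P k) (hs : bdry γ s = S.Q (k + 1)) (hx : x = r ∨ x = s) :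
    ¬ (0 < geodesicSide (S.P (j - 1)) (S.Q j) x ∧ 0 < geodesicSide (S.P j) (S.Q (j + 1)) x) := by
  rintro ⟨h1, h2⟩
  have hN : NeZero (8 * g - 4) := ⟨by omega⟩
  have hvlt : ‖((S.V j : ClosedDisk) : ℂ)‖ < 1 := (S.vertex_mem_left j).1
  -- A short move from `V j` towards `x` enters the polygon: the two sides through `V j` are
  -- controlled by the assumption on `x`, the finitely many others by `side_vertex_pos` and
  -- continuity.
  have ev : ∀ᶠ ε in nhdsWithin (0 : ℝ) (Set.Ioi 0), ∀ l, 0 < geodesicSide (S.P l) (S.Q (l + 1))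
      (S.V j) + ε * geodesicSide (S.P l) (S.Q (l + 1)) x := by
    rw [Filter.eventually_all]
    intro l
    by_cases l1 : l = j - 1
    · subst l1
      rw [sub_add_cancel, (S.vertex_mem_left j).2]
      filter_upwards [self_mem_nhdsWithin] with ε hε
      have : 0 < ε := hε
      rw [zero_add]; positivity
    · by_cases l2 : l = j
      · subst l2
        rw [(S.vertex_mem_right l).2]
        filter_upwards [self_mem_nhdsWithin] with ε hε
        have : 0 < ε := hε
        rw [zero_add]; positivity
      · have hpos := S.side_vertex_pos hg l1 l2
        have : Filter.Tendsto (fun ε : ℝ => geodesicSide (S.P l) (S.Q (l + 1))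
            (S.V j) + ε * geodesicSide (S.P l) (S.Q (l + 1)) x) (nhds 0)
            (nhds (geodesicSide (S.P l) (S.Q (l + 1)) (S.V j)
              + 0 * geodesicSide (S.P l) (S.Q (l + 1)) x)) :=
          (Continuous.tendsto (by fun_prop) 0)
        rw [zero_mul, add_zero] at this
        exact (this.eventually (lt_mem_nhds hpos)).filter_mono nhdsWithin_le_nhds
  obtain ⟨ε, hε, hε0⟩ := (ev.and self_mem_nhdsWithin).exists
  obtain ⟨z, hz, c, hc, hzc⟩ := exists_point_on_ray hvlt x (show 0 < ε from hε0)
  refine S.extension k γ hγ z ⟨hz, fun l => ?_⟩ ?_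
  · rw [hzc]; exact mul_pos hc (hε l)
  · rw [← hr, ← hs] at hV ⊢
    rw [bdry_mem_geodesicLine] at hV ⊢
    refine ⟨hz, ?_⟩
    rw [hzc, hV.2]
    rcases hx with rfl | rfl
    · rw [geodesicSide_left]; simp
    · rw [geodesicSide_right]; simp

/-- The extension of side `i - 1` is mapped to the extension of side `σ(i) + 1`. -/
theorem map_prev_side (hg : 2 ≤ g) (i : ZMod (8 * g - 4)) :
    bdry (S.T i) (S.P (i - 1)) = S.P (sidePairing g i + 1) ∧
      bdry (S.T i) (S.Q i) = S.Q (sidePairing g i + 2) := by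
  -- the cyclic order at a vertex, pulled back by `γ`
  have order : ∀ (γ : diskMobius) (j : ZMod (8 * g - 4)) (x y z w : Circle),
      bdry γ x = S.P (j - 1) → bdry γ y = S.P j → bdry γ z = S.Q j → bdry γ w = S.Q (j + 1) →
      w ≠ x ∧ x ≠ y ∧ y ∉ arcIco w x ∧ z ∉ arcIco w x ∧ ∀ u ∈ arcIco w x, u ≠ w →
        0 < geodesicSide (S.P (j - 1)) (S.Q j) (bdry γ u) ∧
        0 < geodesicSide (S.P j) (S.Q (j + 1)) (bdry γ u) := by
    intro γ j x y z w hx hy hz hw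
    obtain ⟨a, b, c, d, a1, a2, a3, a4, ea, eb, ec, ed⟩ := S.order_at_vertex hg j
    have key : ∀ u, u ∈ arcIco w x ↔ bdry γ u ∈ arcIco (Circle.exp d) (Circle.exp a) := by
      intro u
      rw [← bdry_mem_arcIco γ, hw, hx, ea, ed]
    have notin : ∀ t, a < t → t < d → Circle.exp t ∉ arcIco (Circle.exp d) (Circle.exp a) := by
      intro t t1 t2 h
      rw [← Circle.exp_add_two_pi a, mem_arcIco_exp (by linarith) (by linarith)] at h
      obtain ⟨y, hy, y1, y2⟩ := h
      have := Circle.exp_injOn_Ico (a := t) (b := t + 2 * Real.pi) (by simp)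
        ⟨by linarith, by linarith⟩ ⟨by linarith, by linarith⟩ hy
      linarith
    refine ⟨?_, ?_, ?_, ?_, ?_⟩
    · rintro rfl
      rw [hx, ← ea, ← ed] at hw
      exact exp_ne_exp (by linarith) (by linarith) hw
    · rintro rfl
      rw [hx, ← ea, ← eb] at hy
      exact exp_ne_exp (by linarith) (by linarith) hy
    · rw [key, hy, ← eb]; exact notin b (by linarith) (by linarith)
    · rw [key, hz, ← ec]; exact notin c (by linarith) (by linarith)
    · intro u hu hne
      rw [key, ← Circle.exp_add_two_pi a, mem_arcIco_exp (by linarith) (by linarith)] at hu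
      obtain ⟨y, hy, y1, y2⟩ := hu
      have hdy : d ≠ y := by
        rintro rfl
        apply hne
        apply bdry_injective γ
        rw [hw, ← hy, ed]
      have hdy : d < y := lt_of_le_of_ne y1 hdy
      rw [← hy, ← ea, ← eb, ← ec, ← ed]
      exact ⟨geodesicSide_pos_of_lt (by linarith) (by linarith) (by linarith),
        geodesicSide_pos_of_lt (by linarith) (by linarith) (by linarith)⟩
  obtain ⟨j₁, hj₁⟩ : ∃ j, j = vertexMap g i := ⟨_, rfl⟩
  obtain ⟨j₂, hj₂⟩ : ∃ j, j = vertexMap g j₁ := ⟨_, rfl⟩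
  obtain ⟨j₃, hj₃⟩ : ∃ j, j = vertexMap g j₂ := ⟨_, rfl⟩
  have hj₄ : vertexMap g j₃ = i := by
    rw [hj₃, vertexMap_vertexMap hg, hj₂, hj₁, vertexMap_vertexMap hg,
      oppositeSide_oppositeSide hg]
  have hcyc : S.T j₃ * S.T j₂ * S.T j₁ * S.T i = 1 := by
    rw [hj₃, hj₂, hj₁]; exact S.vertex_cycle i
  have hP : ∀ j : ZMod (8 * g - 4), bdry (S.T j) (S.P j) = S.Q (vertexMap g j) := S.map_P hg
  have hQ : ∀ j : ZMod (8 * g - 4), bdry (S.T j) (S.Q (j + 1)) = S.P (vertexMap g j - 1) := by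
    intro j
    rw [S.map_Q_add_one hg, vertexMap, add_sub_cancel_right]
  obtain ⟨γ₁, hγ₁⟩ : ∃ γ, γ = S.T i := ⟨_, rfl⟩
  obtain ⟨γ₂, hγ₂⟩ : ∃ γ, γ = S.T j₁ * γ₁ := ⟨_, rfl⟩
  obtain ⟨γ₃, hγ₃⟩ : ∃ γ, γ = S.T j₂ * γ₂ := ⟨_, rfl⟩
  have hγ₄ : S.T j₃ * γ₃ = 1 := by
    -- The vertex relation makes the fourth sector adjacent to the first one.
    rw [hγ₃, hγ₂, hγ₁, ← hcyc]; group
  have memT : ∀ j, S.T j ∈ Subgroup.closure (Set.range S.T) := fun j =>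
    Subgroup.subset_closure ⟨j, rfl⟩
  have m₁ : γ₁ ∈ Subgroup.closure (Set.range S.T) := hγ₁ ▸ memT _
  have m₂ : γ₂ ∈ Subgroup.closure (Set.range S.T) := hγ₂ ▸ mul_mem (memT _) m₁
  have inv_apply : ∀ (γ : diskMobius) (x : Circle), bdry γ (bdry γ⁻¹ x) = x := fun γ x => by
    rw [← bdry_mul, mul_inv_cancel, bdry_one]
  have inv_apply' : ∀ (γ : diskMobius) (x : Circle), bdry γ⁻¹ (bdry γ x) = x := fun γ x => by
    rw [← bdry_mul, inv_mul_cancel, bdry_one]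
  have V₁ : (γ₁ : Equiv.Perm ClosedDisk) (S.V i) = S.V j₁ := by rw [hγ₁, hj₁, S.map_vertex]
  have V₂ : (γ₂ : Equiv.Perm ClosedDisk) (S.V i) = S.V j₂ := by
    rw [hγ₂, hj₂, ← S.map_vertex, ← V₁]; rfl
  -- the four lines through the vertex
  obtain ⟨a₁, ha₁⟩ : ∃ a, a = S.Q (i + 1) := ⟨_, rfl⟩
  obtain ⟨b₁, hb₁⟩ : ∃ a, a = S.P i := ⟨_, rfl⟩
  obtain ⟨a₂, ha₂⟩ : ∃ a, a = bdry γ₁⁻¹ (S.Q (j₁ + 1)) := ⟨_, rfl⟩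
  obtain ⟨b₂, hb₂⟩ : ∃ a, a = bdry γ₁⁻¹ (S.P j₁) := ⟨_, rfl⟩
  obtain ⟨a₃, ha₃⟩ : ∃ a, a = bdry γ₂⁻¹ (S.Q (j₂ + 1)) := ⟨_, rfl⟩
  obtain ⟨b₃, hb₃⟩ : ∃ a, a = bdry γ₂⁻¹ (S.P j₂) := ⟨_, rfl⟩
  have o₀ := order 1 i (S.P (i - 1)) b₁ (S.Q i) a₁ (bdry_one _) (by rw [bdry_one, hb₁])
    (bdry_one _) (by rw [bdry_one, ha₁])
  have o₁ := order γ₁ j₁ a₁ b₂ b₁ a₂ (by rw [ha₁, hγ₁, hQ, hj₁]) (by rw [hb₂, inv_apply])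
    (by rw [hb₁, hγ₁, hP, hj₁]) (by rw [ha₂, inv_apply])
  have o₂ := order γ₂ j₂ a₂ b₃ b₂ a₃ (by rw [ha₂, hγ₂, bdry_mul, inv_apply, hQ, hj₂])
    (by rw [hb₃, inv_apply]) (by rw [hb₂, hγ₂, bdry_mul, inv_apply, hP, hj₂])
    (by rw [ha₃, inv_apply])
  have last : ∀ x : Circle, bdry (S.T j₃) (bdry γ₃ x) = x := fun x => by
    rw [← bdry_mul, hγ₄, bdry_one]
  have o₃ := order γ₃ j₃ a₃ (S.Q i) b₃ (S.P (i - 1))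
    (by rw [ha₃, hγ₃, bdry_mul, inv_apply, hQ, hj₃])
    (by apply bdry_injective (S.T j₃); rw [last, hP, hj₄])
    (by rw [hb₃, hγ₃, bdry_mul, inv_apply, hP, hj₃])
    (by apply bdry_injective (S.T j₃); rw [last, hQ, hj₄])
  have hline := S.vertex_mem_left i
  have hk : i = i - 1 + 1 := (sub_add_cancel i 1).symm
  have noSector : ∀ (γ : diskMobius) (j : ZMod (8 * g - 4)),
      γ ∈ Subgroup.closure (Set.range S.T) → (γ : Equiv.Perm ClosedDisk) (S.V i) = S.V j →
      ¬ (0 < geodesicSide (S.P (j - 1)) (S.Q j) (bdry γ (S.Q i)) ∧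
        0 < geodesicSide (S.P j) (S.Q (j + 1)) (bdry γ (S.Q i))) := by
    intro γ j hγ hγV
    refine S.not_in_sector hg (γ := γ⁻¹) (inv_mem hγ) (k := i - 1) (r := bdry γ (S.P (i - 1)))
      (s := bdry γ (S.Q i)) ?_ (inv_apply' _ _) ?_ (Or.inr rfl)
    · rw [← hγV, ← hk]
      have : ((γ⁻¹ : diskMobius) : Equiv.Perm ClosedDisk) ((γ : Equiv.Perm ClosedDisk) (S.V i))
          = S.V i := Equiv.symm_apply_apply (γ : Equiv.Perm ClosedDisk) (S.V i)
      rw [this]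
      exact hline
    · rw [inv_apply', ← hk]
  -- The arcs cut out by the four sectors form a counterclockwise chain from `a₁` to `P (i - 1)`,
  -- `a₃`, `a₂` and back to `a₁`. The order at the vertex excludes `Q i` from the first two arcs and
  -- from `a₃`, the extension condition excludes it from the interiors of the last two; only `a₂` is
  -- left.
  have hQi : S.Q i = a₂ := by
    rcases mem_arcIco_of_cycle o₀.1 o₃.1 o₂.1 o₁.1 (S.Q i) with h | h | h | h
    · exact absurd h o₀.2.2.2.1
    · exact absurd h o₃.2.2.1
    · by_contra hne
      by_cases h3 : S.Q i = a₃
      · exact o₃.2.1 h3.symm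
      · exact noSector γ₂ j₂ m₂ V₂ (o₂.2.2.2.2 _ h h3)
    · by_contra hne
      exact noSector γ₁ j₁ m₁ V₁ (o₁.2.2.2.2 _ h hne)
  have h2 : bdry (S.T i) (S.Q i) = S.Q (j₁ + 1) := by
    rw [hQi, ha₂, ← hγ₁, inv_apply]
  have hj : j₁ = sidePairing g i + 1 := hj₁
  refine ⟨?_, ?_⟩
  -- The image line and the extended side `j₁` share the vertex `V j₁` and the end `Q (j₁ + 1)`, so
  -- their other ends agree.
  · have w := (bdry_mem_geodesicLine (S.T i)).2 hline
    rw [h2, ← hγ₁, V₁, hγ₁] at w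
    obtain ⟨α, β, hα, hβ, hc⟩ :=
      exists_combination_of_mem_geodesicLine (S.P_ne_Q_add_one hg j₁) (S.vertex_mem_right j₁)
    have w2 := w.2
    rw [hc, geodesicSide_right, mul_zero, add_zero] at w2
    have w3 := (mul_eq_zero.1 w2).resolve_left hα.ne'
    rw [geodesicSide_eq_zero_iff] at w3
    · rw [← hj]
      exact (w3.resolve_right (S.P_ne_Q_add_one hg j₁)).symm
    · rw [← h2]
      intro h
      have h := bdry_injective _ h
      obtain ⟨a, b, c, d, a1, a2, a3, a4, ea, eb, ec, ed⟩ := S.order_at_vertex hg i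
      rw [← ea, ← ec] at h
      exact exp_ne_exp (by linarith) (by linarith) h
  · rw [h2, hj]; congr 1; ring

theorem map_P_sub_one (hg : 2 ≤ g) (i : ZMod (8 * g - 4)) :
    bdry (S.T i) (S.P (i - 1)) = S.P (sidePairing g i + 1) := (S.map_prev_side hg i).1

theorem map_Q (hg : 2 ≤ g) (i : ZMod (8 * g - 4)) :
    bdry (S.T i) (S.Q i) = S.Q (sidePairing g i + 2) := (S.map_prev_side hg i).2

theorem map_P_add_one (hg : 2 ≤ g) (i : ZMod (8 * g - 4)) :
    bdry (S.T i) (S.P (i + 1)) = S.P (sidePairing g i - 1) := by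
  have h := S.map_P_sub_one hg (sidePairing g i)
  rw [sidePairing_sidePairing hg] at h
  rw [← h, S.bdry_bdry_sidePairing hg]

theorem map_Q_add_two (hg : 2 ≤ g) (i : ZMod (8 * g - 4)) :
    bdry (S.T i) (S.Q (i + 2)) = S.Q (sidePairing g i) := by
  have h := S.map_Q hg (sidePairing g i)
  rw [sidePairing_sidePairing hg] at h
  rw [← h, S.bdry_bdry_sidePairing hg]

end FundamentalPolygon

/-! ### Systems of fixed point equations on arcs -/

/-- A disk isometry lifts to a strictly increasing map of a fundamental interval. -/
theorem exists_strictMonoOn_lift (T : diskMobius) {a a' : ℝ}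
    (h : Circle.exp a' = bdry T (Circle.exp a)) : ∃ t : ℝ → ℝ, t a = a' ∧
      (∀ y, Circle.exp (t y) = bdry T (Circle.exp y)) ∧
      StrictMonoOn t (Set.Ico a (a + 2 * Real.pi)) ∧ ∀ y, t y < a' + 2 * Real.pi := by
  refine ⟨fun y => a' + ccwAngle (bdry T (Circle.exp a)) (bdry T (Circle.exp y)), ?_,
    fun y => ?_, ?_, fun y => ?_⟩
  · simp [ccwAngle_self]
  · rw [← h, exp_add_ccwAngle]
  · rintro x ⟨x1, x2⟩ y ⟨y1, y2⟩ hxy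
    have h1 : Circle.exp x ∈ arcIco (Circle.exp a) (Circle.exp y) := exp_mem_arcIco x1 hxy y2
    rw [← bdry_mem_arcIco T] at h1
    have h2 : ccwAngle (bdry T (Circle.exp a)) (bdry T (Circle.exp x)) <
      ccwAngle (bdry T (Circle.exp a)) (bdry T (Circle.exp y)) := h1
    simp only; linarith
  · linarith [ccwAngle_lt (bdry T (Circle.exp a)) (bdry T (Circle.exp y))]

/-- Lets an order-preserving map of one arc into another be followed on points: here `u` and `v` are
the images of the ends of the first arc. -/
theorem mem_arcIcc_of_chain {a u v x y : Circle} (hu : u ∈ arcIcc a v) (hy : y ∈ arcIcc u v)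
    (hx : x ∈ arcIcc u y) : x ∈ arcIcc a y ∧ y ∈ arcIcc a v := by
  obtain ⟨α, rfl⟩ := Circle.exp_surjective a
  obtain ⟨β, rfl, b1, b2⟩ := exists_exp_eq_Ico α v
  obtain ⟨γ, rfl, c1, c2⟩ := (mem_arcIcc_exp b1 b2).1 hu
  obtain ⟨δ, rfl, d1, d2⟩ := (mem_arcIcc_exp c2 (by linarith)).1 hy
  obtain ⟨ε, rfl, e1, e2⟩ := (mem_arcIcc_exp d1 (by linarith)).1 hx
  exact ⟨exp_mem_arcIcc (by linarith) e2 (by linarith),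
    exp_mem_arcIcc (by linarith) (by linarith) (by linarith)⟩

theorem mem_arcIcc_trans {a v w x : Circle} (hv : v ∈ arcIcc a w) (hx : x ∈ arcIcc a v) :
    x ∈ arcIcc a w :=
  le_trans (show ccwAngle a x ≤ ccwAngle a v from hx) hv

/-- Existence of solutions, by monotonicity. -/
theorem exists_arc_system_solution {ι : Type*} (X Y : ι → Circle) (f : ι → ι)
    (M : ι → diskMobius) (h1 : ∀ j, bdry (M j) (X (f j)) ∈ arcIcc (X j) (bdry (M j) (Y (f j))))
    (h2 : ∀ j, bdry (M j) (Y (f j)) ∈ arcIcc (X j) (Y j)) :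
    ∃ G : ι → Circle, ∀ j, G j ∈ arcIcc (X j) (Y j) ∧ G j = bdry (M j) (G (f j)) := by
  -- This makes the intervals of angles complete lattices, so that the least fixed point of a
  -- monotone map of their product exists.
  have inst : ∀ j, Fact (0 ≤ ccwAngle (X j) (Y j)) := fun j => ⟨ccwAngle_nonneg _ _⟩
  -- the point of the `j`-th arc at a given angle
  obtain ⟨E, hE⟩ : ∃ E : ι → ℝ → Circle, ∀ j r, E j r = Circle.exp r * X j :=
    ⟨fun j r => Circle.exp r * X j, fun _ _ => rfl⟩
  have hang : ∀ j r, 0 ≤ r → r ≤ ccwAngle (X j) (Y j) → ccwAngle (X j) (E j r) = r := by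
    intro j r r0 r1
    obtain ⟨a, ha⟩ := Circle.exp_surjective (X j)
    have := ccwAngle_lt (X j) (Y j)
    rw [hE, ← ha, ← Circle.exp_add, add_comm, ccwAngle_exp (by linarith) (by linarith)]
    ring
  have hmem : ∀ j r, 0 ≤ r → r ≤ ccwAngle (X j) (Y j) → E j r ∈ arcIcc (X j) (Y j) := by
    intro j r r0 r1
    change ccwAngle _ _ ≤ _
    rw [hang j r r0 r1]; exact r1
  have step : ∀ j x y, y ∈ arcIcc (X (f j)) (Y (f j)) → x ∈ arcIcc (X (f j)) y →
      bdry (M j) x ∈ arcIcc (X j) (bdry (M j) y) ∧ bdry (M j) y ∈ arcIcc (X j) (Y j) := by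
    intro j x y hy hx
    rw [← bdry_mem_arcIcc (M j)] at hx hy
    obtain ⟨k1, k2⟩ := mem_arcIcc_of_chain (h1 j) hy hx
    exact ⟨k1, mem_arcIcc_trans (h2 j) k2⟩
  let Φ : (∀ j, Set.Icc 0 (ccwAngle (X j) (Y j))) →o (∀ j, Set.Icc 0 (ccwAngle (X j) (Y j))) :=
    { toFun := fun x j => ⟨ccwAngle (X j) (bdry (M j) (E (f j) (x (f j)))), ccwAngle_nonneg _ _,
        (step j _ _ (hmem _ _ (x (f j)).2.1 (x (f j)).2.2) (right_mem_arcIcc _ _)).2⟩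
      monotone' := by
        intro x y hxy j
        have hxy' : ((x (f j) : ℝ)) ≤ y (f j) := hxy (f j)
        refine (step j _ _ (hmem _ _ (y (f j)).2.1 (y (f j)).2.2) ?_).1
        change ccwAngle _ _ ≤ ccwAngle _ _
        rw [hang _ _ (x (f j)).2.1 (x (f j)).2.2, hang _ _ (y (f j)).2.1 (y (f j)).2.2]
        exact hxy' }
  obtain ⟨x, hx⟩ : ∃ x, Φ x = x := ⟨OrderHom.lfp Φ, Φ.map_lfp⟩
  refine ⟨fun j => E j (x j), fun j => ⟨hmem _ _ (x j).2.1 (x j).2.2, ?_⟩⟩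
  have hj : ccwAngle (X j) (bdry (M j) (E (f j) (x (f j)))) = x j :=
    congrArg Subtype.val (congrFun hx j)
  apply ccwAngle_injective (X j)
  rw [hj, hang _ _ (x j).2.1 (x j).2.2]

/-! ### Cross-ratios and uniqueness of solutions -/

theorem norm_exp_sub_exp_sq (a b : ℝ) :
    ‖((Circle.exp a : Circle) : ℂ) - (Circle.exp b : Circle)‖ ^ 2 =
      4 * Real.sin ((a - b) / 2) ^ 2 := by
  rw [← Complex.normSq_eq_norm_sq, Complex.normSq_apply, Complex.sub_re, Complex.sub_im,
    Circle.coe_exp, Circle.coe_exp, Complex.exp_ofReal_mul_I_re, Complex.exp_ofReal_mul_I_re,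
    Complex.exp_ofReal_mul_I_im, Complex.exp_ofReal_mul_I_im]
  have h1 : Real.cos (a - b) = 1 - 2 * Real.sin ((a - b) / 2) ^ 2 := by
    rw [show a - b = 2 * ((a - b) / 2) by ring, Real.cos_two_mul', Real.cos_sq']
    ring_nf
  rw [Real.cos_sub] at h1
  linear_combination Real.sin_sq_add_cos_sq a + Real.sin_sq_add_cos_sq b - 2 * h1

/-- The square of the cross-ratio of four points of the circle. -/
noncomputable def crossRatioSq (u x y w : Circle) : ℝ :=
  (‖(y : ℂ) - u‖ ^ 2 * ‖(w : ℂ) - x‖ ^ 2) / (‖(x : ℂ) - u‖ ^ 2 * ‖(w : ℂ) - y‖ ^ 2)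

/-- Each of the four points contributes its weight once to the numerator and once to the
denominator. -/
theorem crossRatioSq_bdry (T : diskMobius) (u x y w : Circle) :
    crossRatioSq (bdry T u) (bdry T x) (bdry T y) (bdry T w) = crossRatioSq u x y w := by
  obtain ⟨m, hm, -, h, -⟩ := diskMobius_exists_weight T
  have key : ∀ a b : Circle, ‖((bdry T a : Circle) : ℂ) - bdry T b‖ ^ 2 *
      (m a.toClosedDisk * m b.toClosedDisk) = ‖(a : ℂ) - b‖ ^ 2 := fun a b =>
    h a.toClosedDisk b.toClosedDisk
  unfold crossRatioSq
  rw [← key y u, ← key w x, ← key x u, ← key w y]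
  have hu := (hm u.toClosedDisk).ne'
  have hx := (hm x.toClosedDisk).ne'
  have hy := (hm y.toClosedDisk).ne'
  have hw := (hm w.toClosedDisk).ne'
  rw [← mul_div_mul_right _ _ (mul_ne_zero (mul_ne_zero hu hx) (mul_ne_zero hy hw))]
  congr 1 <;> ring

/-- Shrinking an arc increases the cross-ratio of two interior points with its endpoints. -/
theorem crossRatioSq_lt {u m x y n w : ℝ} (h1 : u < m) (h2 : m < x) (h3 : x < y) (h4 : y < n)
    (h5 : n ≤ w) (h6 : w < u + 2 * Real.pi) :
    crossRatioSq (Circle.exp u) (Circle.exp x) (Circle.exp y) (Circle.exp w) <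
      crossRatioSq (Circle.exp m) (Circle.exp x) (Circle.exp y) (Circle.exp n) := by
  unfold crossRatioSq
  simp only [norm_exp_sub_exp_sq]
  have sp : ∀ s t : ℝ, s < t → t < s + 2 * Real.pi → 0 < Real.sin ((t - s) / 2) :=
    fun s t h h' => Real.sin_pos_of_pos_of_lt_pi (by linarith) (by linarith)
  have yu := sp u y (by linarith) (by linarith)
  have xu := sp u x (by linarith) (by linarith)
  have ym := sp m y (by linarith) (by linarith)
  have xm := sp m x (by linarith) (by linarith)
  have wx := sp x w (by linarith) (by linarith)
  have wy := sp y w (by linarith) (by linarith)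
  have nx := sp x n (by linarith) (by linarith)
  have ny := sp y n (by linarith) (by linarith)
  have yx := sp x y (by linarith) (by linarith)
  have mu := sp u m (by linarith) (by linarith)
  -- Ptolemy's relation for chords: the differences that decide `k1` and `k2` become products of
  -- sines of known sign.
  have ptolemy : ∀ a b c d : ℝ, Real.sin (a - c) * Real.sin (b - d) -
      Real.sin (a - d) * Real.sin (b - c) = Real.sin (c - d) * Real.sin (a - b) := by
    intro a b c d
    simp only [Real.sin_sub]
    ring
  have k1 : Real.sin ((y - u) / 2) * Real.sin ((x - m) / 2) <
      Real.sin ((y - m) / 2) * Real.sin ((x - u) / 2) := by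
    have := ptolemy (y / 2) (x / 2) (m / 2) (u / 2)
    simp only [← sub_div] at this
    nlinarith [mul_pos mu yx]
  have k2 : Real.sin ((w - x) / 2) * Real.sin ((n - y) / 2) ≤
      Real.sin ((n - x) / 2) * Real.sin ((w - y) / 2) := by
    have := ptolemy (w / 2) (n / 2) (y / 2) (x / 2)
    simp only [← sub_div] at this
    have hwn : 0 ≤ Real.sin ((w - n) / 2) :=
      Real.sin_nonneg_of_nonneg_of_le_pi (by linarith) (by linarith)
    nlinarith [mul_nonneg yx.le hwn]
  have k3 : (Real.sin ((y - u) / 2) * Real.sin ((w - x) / 2)) *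
      (Real.sin ((x - m) / 2) * Real.sin ((n - y) / 2)) <
      (Real.sin ((y - m) / 2) * Real.sin ((n - x) / 2)) *
      (Real.sin ((x - u) / 2) * Real.sin ((w - y) / 2)) := by
    have := mul_lt_mul k1 k2 (by positivity) (by positivity)
    linarith
  rw [div_lt_div_iff₀ (by positivity) (by positivity)]
  have k4 := pow_lt_pow_left₀ k3 (by positivity) (two_ne_zero)
  linarith

/-- Uniqueness of solutions: the cross-ratio of two solutions with the ends of the arcs would
increase along the system. -/
theorem arc_system_solution_unique {ι : Type*} [Finite ι] (U W : ι → Circle) (f : ι → ι)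
    (M : ι → diskMobius)
    (h : ∀ j, ∃ u m n w : ℝ, u < m ∧ n ≤ w ∧ m < n ∧ w < u + 2 * Real.pi ∧ Circle.exp u = U j ∧
      Circle.exp m = bdry (M j) (U (f j)) ∧ Circle.exp n = bdry (M j) (W (f j)) ∧
      Circle.exp w = W j)
    {G G' : ι → Circle} (hG : ∀ j, G j = bdry (M j) (G (f j)))
    (hG' : ∀ j, G' j = bdry (M j) (G' (f j)))
    (mG : ∀ j, G j ∈ arcIcc (U j) (W j) ∧ G j ≠ U j ∧ G j ≠ W j)
    (mG' : ∀ j, G' j ∈ arcIcc (U j) (W j) ∧ G' j ≠ U j ∧ G' j ≠ W j) : G = G' := by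
  -- the step, for solutions in a given order
  have main : ∀ {G G' : ι → Circle}, (∀ j, G j = bdry (M j) (G (f j))) →
      (∀ j, G' j = bdry (M j) (G' (f j))) →
      (∀ j, G j ∈ arcIcc (U j) (W j) ∧ G j ≠ U j ∧ G j ≠ W j) →
      (∀ j, G' j ∈ arcIcc (U j) (W j) ∧ G' j ≠ U j ∧ G' j ≠ W j) →
      ∀ j, ¬ 0 < geodesicSide (U j) (G j) (G' j) := by
    intro G G' hG hG' mG mG' j₀ hj₀
    have step : ∀ j, 0 < geodesicSide (U j) (G j) (G' j) →
        0 < geodesicSide (U (f j)) (G (f j)) (G' (f j)) ∧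
        crossRatioSq (U j) (G j) (G' j) (W j) <
          crossRatioSq (U (f j)) (G (f j)) (G' (f j)) (W (f j)) := by
      intro j hj
      obtain ⟨u, m, n, w, h1, h2, h3, h4, eu, em, en, ew⟩ := h j
      have lift : ∀ {G : ι → Circle}, (∀ j, G j = bdry (M j) (G (f j))) →
          (∀ j, G j ∈ arcIcc (U j) (W j) ∧ G j ≠ U j ∧ G j ≠ W j) →
          ∃ x, Circle.exp x = G j ∧ m < x ∧ x < n := by
        intro G hG mG
        obtain ⟨k1, k2, k3⟩ := mG (f j)
        rw [← bdry_mem_arcIcc (M j), ← hG, ← em, ← en,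
          mem_arcIcc_exp h3.le (by linarith)] at k1
        obtain ⟨x, hx, x1, x2⟩ := k1
        refine ⟨x, hx, lt_of_le_of_ne x1 ?_, lt_of_le_of_ne x2 ?_⟩
        · rintro rfl
          rw [em, hG] at hx
          exact k2 (bdry_injective _ hx).symm
        · rintro rfl
          rw [en, hG] at hx
          exact k3 (bdry_injective _ hx).symm
      obtain ⟨x, hx, x1, x2⟩ := lift hG mG
      obtain ⟨y, hy, y1, y2⟩ := lift hG' mG'
      have hxy : x < y := by
        rw [← eu, ← hx, ← hy, geodesicSide_pos_iff, ccwAngle_exp (by linarith) (by linarith),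
          ccwAngle_exp (by linarith) (by linarith)] at hj
        linarith [hj.2]
      constructor
      · rw [← geodesicSide_bdry_pos_circle (M j), ← hG, ← hG', ← em, ← hx, ← hy]
        exact geodesicSide_pos_of_lt x1 hxy (by linarith)
      · rw [← crossRatioSq_bdry (M j) (U (f j)), ← hG, ← hG', ← em, ← hx, ← hy, ← eu, ← en, ← ew]
        exact crossRatioSq_lt h1 x1 hxy y2 h2 h4
    obtain ⟨j, hj, hmax⟩ := Set.exists_max_image
      {j | 0 < geodesicSide (U j) (G j) (G' j)}
      (fun j => crossRatioSq (U j) (G j) (G' j) (W j)) (Set.toFinite _) ⟨j₀, hj₀⟩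
    obtain ⟨s1, s2⟩ := step j hj
    exact absurd (hmax _ s1) (not_le.2 s2)
  funext j
  by_contra hne
  have h1 := main hG hG' mG mG' j
  have h2 := main hG' hG mG' mG j
  have h3 := geodesicSide_swap (U j) (G j) (G' j)
  have h0 : geodesicSide (U j) (G j) (G' j) = 0 := by linarith
  rcases (geodesicSide_eq_zero_iff (mG j).2.1.symm).1 h0 with h3 | h3
  · exact (mG' j).2.1 h3
  · exact hne h3.symm

/-! ### The points `G`, `D` and `H` -/

theorem IsCircleLift.exp_eq {n : ℕ} {X : ZMod n → Circle} {x : ℤ → ℝ} (h : IsCircleLift X x)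
    {k : ℤ} {i : ZMod n} (hk : (k : ZMod n) = i) : Circle.exp (x k) = X i := by
  rw [h.exp, hk]

theorem IsCircleLift.shift {n : ℕ} {X : ZMod n → Circle} {x : ℤ → ℝ} (h : IsCircleLift X x)
    (m : ℤ) : IsCircleLift (fun i : ZMod n => X (i + (m : ZMod n))) (fun k => x (k + m)) :=
  ⟨fun k => by rw [h.exp]; push_cast; rfl, fun k => by
    rw [show k + (n : ℤ) + m = k + m + n by ring, h.add]⟩

theorem eq_of_exp_eq {a x y : ℝ} (h : Circle.exp x = Circle.exp y) (x1 : a ≤ x)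
    (x2 : x < a + 2 * Real.pi) (y1 : a ≤ y) (y2 : y < a + 2 * Real.pi) : x = y :=
  Circle.exp_injOn_Ico (a := a) (b := a + 2 * Real.pi) (by simp) ⟨x1, x2⟩ ⟨y1, y2⟩ h

namespace FundamentalPolygon

variable {g : ℕ} (S : FundamentalPolygon g)

/-- Lifts of the endpoints of the extended sides to the line. -/
structure IsEndpointLift (p q : ℤ → ℝ) : Prop where
  P : IsCircleLift S.P p
  Q : IsCircleLift S.Q q
  p_lt_q : ∀ k, p k < q k
  q_lt_p : ∀ k, q k < p (k + 1)

theorem exists_isEndpointLift (hg : 2 ≤ g) : ∃ p q, S.IsEndpointLift p q := by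
  obtain ⟨p, q, hp, hq, h1, h2⟩ := S.exists_lift hg
  exact ⟨p, q, hp, hq, h1, h2⟩

namespace IsEndpointLift

variable {S} {p q : ℤ → ℝ}

theorem strictMono_p (L : S.IsEndpointLift p q) : StrictMono p :=
  strictMono_int_of_lt_succ fun k => (L.p_lt_q k).trans (L.q_lt_p k)

theorem strictMono_q (L : S.IsEndpointLift p q) : StrictMono q :=
  strictMono_int_of_lt_succ fun k => (L.q_lt_p k).trans (L.p_lt_q (k + 1))

theorem q_lt_p_of_lt (L : S.IsEndpointLift p q) {k l : ℤ} (h : k < l) : q k < p l :=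
  (L.q_lt_p k).trans_le (L.strictMono_p.monotone (by omega))

theorem p_lt_q_of_le (L : S.IsEndpointLift p q) {k l : ℤ} (h : k ≤ l) : p k < q l :=
  (L.p_lt_q k).trans_le (L.strictMono_q.monotone (by omega))

/-- A side pairing lifts to an increasing map with prescribed values. -/
theorem exists_lift_T (L : S.IsEndpointLift p q) (hg : 2 ≤ g) {i : ZMod (8 * g - 4)} {k l : ℤ}
    (hk : (k : ZMod (8 * g - 4)) = i) (hl : (l : ZMod (8 * g - 4)) = sidePairing g i) :
    ∃ t : ℝ → ℝ, (∀ y, Circle.exp (t y) = bdry (S.T i) (Circle.exp y)) ∧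
      StrictMonoOn t (Set.Ico (q (k + 1)) (q (k + 1) + 2 * Real.pi)) ∧ t (q (k + 1)) = p l ∧
      t (q (k + 2)) = q l ∧ t (p (k - 1 + (8 * g - 4 : ℕ))) = p (l + 1) ∧
      t (p (k + (8 * g - 4 : ℕ))) = q (l + 1) ∧ t (q (k + (8 * g - 4 : ℕ))) = q (l + 2) := by
  have hN := natCast_mod_eq hg
  have e0 : Circle.exp (p l) = bdry (S.T i) (Circle.exp (q (k + 1))) := by
    rw [L.P.exp_eq hl, L.Q.exp_eq (i := i + 1) (by rw [← hk]; push_cast; rfl),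
      S.map_Q_add_one hg]
  obtain ⟨t, t0, te, tm, tb⟩ := exists_strictMonoOn_lift (S.T i) e0
  have hpl := L.P.add l
  have hqk := L.Q.add (k + 1)
  -- On this fundamental interval the values of `t` stay in `[p l, p l + 2π)`, so they are
  -- determined by their images on the circle; the prescribed values then follow from the action on
  -- endpoints.
  have key : ∀ y z : ℝ, q (k + 1) ≤ y → y < q (k + 1 + (8 * g - 4 : ℕ)) → p l ≤ z →
      z < p (l + (8 * g - 4 : ℕ)) → Circle.exp z = bdry (S.T i) (Circle.exp y) → t y = z := by
    intro y z y1 y2 z1 z2 h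
    rw [hqk] at y2
    rw [hpl] at z2
    rw [← te] at h
    refine (eq_of_exp_eq h z1 z2 ?_ (tb y)).symm
    rw [← t0]
    exact tm.monotoneOn ⟨le_refl _, by linarith⟩ ⟨y1, y2⟩ y1
  refine ⟨t, te, tm, t0, ?_, ?_, ?_, ?_⟩
  · apply key
    · exact L.strictMono_q.monotone (by omega)
    · exact L.strictMono_q (by omega)
    · exact (L.p_lt_q_of_le (by omega)).le
    · exact L.q_lt_p_of_lt (by omega)
    · rw [L.Q.exp_eq hl, L.Q.exp_eq (i := i + 2) (by rw [← hk]; push_cast; rfl),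
        S.map_Q_add_two hg]
  · apply key
    · exact (L.q_lt_p_of_lt (by omega)).le
    · exact L.p_lt_q_of_le (by omega)
    · exact L.strictMono_p.monotone (by omega)
    · exact L.strictMono_p (by omega)
    · rw [L.P.exp_eq (i := sidePairing g i + 1) (by rw [← hl]; push_cast; rfl), L.P.add,
        Circle.exp_add_two_pi, L.P.exp_eq (i := i - 1) (by rw [← hk]; push_cast; rfl),
        S.map_P_sub_one hg]
  · apply key
    · exact (L.q_lt_p_of_lt (by omega)).le
    · exact L.p_lt_q_of_le (by omega)
    · exact (L.p_lt_q_of_le (by omega)).le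
    · exact L.q_lt_p_of_lt (by omega)
    · rw [L.Q.exp_eq (i := sidePairing g i + 1) (by rw [← hl]; push_cast; rfl), L.P.add,
        Circle.exp_add_two_pi, L.P.exp_eq hk, S.map_P hg]
  · apply key
    · exact L.strictMono_q.monotone (by omega)
    · exact L.strictMono_q (by omega)
    · exact (L.p_lt_q_of_le (by omega)).le
    · exact L.q_lt_p_of_lt (by omega)
    · rw [L.Q.exp_eq (i := sidePairing g i + 2) (by rw [← hl]; push_cast; rfl), L.Q.add,
        Circle.exp_add_two_pi, L.Q.exp_eq hk, S.map_Q hg]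

end IsEndpointLift

theorem P_ne_Q (hg : 2 ≤ g) (i : ZMod (8 * g - 4)) : S.P i ≠ S.Q i := by
  obtain ⟨a, b, c, d, h1, h2, h3, h4, ea, eb, ec, ed⟩ := S.order_at_vertex hg i
  rw [← eb, ← ec]
  exact exp_ne_exp h2 (by linarith)

/-! ### The system for `G`: existence and uniqueness -/

/-- The index on which `G j` depends. -/
noncomputable def depIndex (A : ZMod (8 * g - 4) → Circle) (j : ZMod (8 * g - 4)) :
    ZMod (8 * g - 4) :=
  open Classical in
  if A (sidePairing g j) = S.P (sidePairing g j) then sidePairing g j - 2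
  else oppositeSide g (sidePairing g j)

/-- The transformation by which `G j` depends on another of the points. -/
noncomputable def depMap (A : ZMod (8 * g - 4) → Circle) (j : ZMod (8 * g - 4)) : diskMobius :=
  open Classical in
  if A (sidePairing g j) = S.P (sidePairing g j) then S.T (sidePairing g j)
  else S.T (oppositeSide g (sidePairing g j) + 1)

variable {S} {A G : ZMod (8 * g - 4) → Circle}

/-- Since `σ` is an involution and `P i ≠ Q i`, every `G j` is governed by exactly one of the two
kinds of equation. -/
theorem isSystemSolution_iff (hg : 2 ≤ g) (hA : S.IsExtremal A) :
    S.IsSystemSolution A G ↔ ∀ j, G j ∈ arcIcc (S.P j) (S.P (j + 1)) ∧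
      G j = bdry (S.depMap A j) (G (S.depIndex A j)) := by
  constructor
  · intro h j
    refine ⟨h.mem j, ?_⟩
    unfold depMap depIndex
    by_cases hP : A (sidePairing g j) = S.P (sidePairing g j)
    · rw [if_pos hP, if_pos hP, ← h.eq_of_P _ hP, sidePairing_sidePairing hg]
    · rw [if_neg hP, if_neg hP, ← h.eq_of_Q _ ((hA _).resolve_left hP),
        sidePairing_sidePairing hg]
  · intro h
    refine ⟨fun i => (h i).1, fun i hP => ?_, fun i hQ => ?_⟩
    · have := (h (sidePairing g i)).2
      unfold depMap depIndex at this
      rw [sidePairing_sidePairing hg] at this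
      rwa [if_pos hP, if_pos hP] at this
    · have hP : A i ≠ S.P i := by
        rw [hQ]; exact (S.P_ne_Q hg i).symm
      have := (h (sidePairing g i)).2
      unfold depMap depIndex at this
      rw [sidePairing_sidePairing hg] at this
      rwa [if_neg hP, if_neg hP] at this

theorem sidePairing_oppositeSide_add_one (hg : 2 ≤ g) (j : ZMod (8 * g - 4)) :
    sidePairing g (oppositeSide g (sidePairing g j) + 1) = j - 1 := by
  rw [sidePairing_add_one hg, sidePairing_oppositeSide hg, oppositeSide_oppositeSide hg,
    sidePairing_sidePairing hg]

theorem existsUnique_isSystemSolution (hg : 2 ≤ g) (hA : S.IsExtremal A) :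
    ∃! G, S.IsSystemSolution A G := by
  have hNZ : NeZero (8 * g - 4) := ⟨by omega⟩
  have hN := natCast_mod_eq hg
  obtain ⟨p, q, L⟩ := S.exists_isEndpointLift hg
  simp only [isSystemSolution_iff hg hA]
  refine existsUnique_of_exists_of_unique ?_ ?_
  · refine exists_arc_system_solution S.P (fun j => S.P (j + 1)) _ _ ?_ ?_
    all_goals
      intro j
      obtain ⟨l, hl⟩ := ZMod.intCast_surjective j
      unfold depMap depIndex
      by_cases hP : A (sidePairing g j) = S.P (sidePairing g j)
    · rw [if_pos hP, if_pos hP]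
      -- The image arc ends at `P (j + 1)` when `A (σ j) = P (σ j)`; in the other case it is `[P j,
      -- Q j]`.
      obtain ⟨k, hk⟩ := ZMod.intCast_surjective (sidePairing g j)
      obtain ⟨t, te, tm, t1, -, t2, -⟩ := L.exists_lift_T hg hk
        (hl.trans (sidePairing_sidePairing hg j).symm)
      have e1 : Circle.exp (p (k - 2 + (8 * g - 4 : ℕ))) = S.P (sidePairing g j - 2) := by
        rw [L.P.add, Circle.exp_add_two_pi, L.P.exp_eq (i := sidePairing g j - 2)]
        rw [← hk]; push_cast; rfl
      have e2 : Circle.exp (p (k - 1 + (8 * g - 4 : ℕ))) = S.P (sidePairing g j - 2 + 1) := by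
        rw [L.P.add, Circle.exp_add_two_pi, L.P.exp_eq]
        rw [← hk]; push_cast; ring
      have b := L.Q.add (k + 1)
      have b1 : q (k + 1) < p (k - 2 + (8 * g - 4 : ℕ)) := L.q_lt_p_of_lt (by omega)
      have b2 : p (k - 2 + (8 * g - 4 : ℕ)) < p (k - 1 + (8 * g - 4 : ℕ)) :=
        L.strictMono_p (by omega)
      have b3 : p (k - 1 + (8 * g - 4 : ℕ)) < q (k + 1 + (8 * g - 4 : ℕ)) :=
        L.p_lt_q_of_le (by omega)
      have b4 : p (l + 1) < p (l + (8 * g - 4 : ℕ)) := L.strictMono_p (by omega)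
      rw [L.P.add] at b4
      have c1 := tm ⟨le_refl _, by linarith⟩ ⟨b1.le, by linarith⟩ b1
      have c2 := tm ⟨b1.le, by linarith⟩ ⟨by linarith, by linarith⟩ b2
      rw [← e1, ← te, ← L.P.exp_eq hl, ← e2, ← te, t2]
      rw [t1] at c1
      rw [t2] at c2
      exact exp_mem_arcIcc c1.le c2.le (by linarith)
    · rw [if_neg hP, if_neg hP]
      have := S.map_P_sub_one hg (oppositeSide g (sidePairing g j) + 1)
      rw [sidePairing_oppositeSide_add_one hg, add_sub_cancel_right, sub_add_cancel] at this
      rw [this]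
      exact left_mem_arcIcc _ _
    · rw [if_pos hP, if_pos hP]
      have := S.map_P_sub_one hg (sidePairing g j)
      rw [sidePairing_sidePairing hg] at this
      rw [show sidePairing g j - 2 + 1 = sidePairing g j - 1 by ring, this]
      exact right_mem_arcIcc _ _
    · rw [if_neg hP, if_neg hP]
      have := S.map_P hg (oppositeSide g (sidePairing g j) + 1)
      rw [sidePairing_oppositeSide_add_one hg, sub_add_cancel] at this
      rw [this, ← L.P.exp_eq hl, ← L.Q.exp_eq hl,
        ← L.P.exp_eq (k := l + 1) (i := j + 1) (by rw [← hl]; push_cast; rfl)]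
      have := L.strictMono_p (show l + 1 < l + (8 * g - 4 : ℕ) by omega)
      rw [L.P.add] at this
      exact exp_mem_arcIcc (L.p_lt_q l).le (L.q_lt_p l).le (by linarith)
  · intro G G' h h'
    -- The arcs `[P j, P (j + 1)]` may share an end with the image arc. On the larger arcs `[Q (j -
    -- 1), Q (j + 1)]` the solutions stay away from the ends, and the left end of the image arc is
    -- always strictly inside.
    have mem : ∀ G : ZMod (8 * g - 4) → Circle, (∀ j, G j ∈ arcIcc (S.P j) (S.P (j + 1))) →
        ∀ j, G j ∈ arcIcc (S.Q (j - 1)) (S.Q (j + 1)) ∧ G j ≠ S.Q (j - 1) ∧ G j ≠ S.Q (j + 1) := by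
      intro G hG j
      obtain ⟨l, hl⟩ := ZMod.intCast_surjective j
      have e1 : Circle.exp (p (l + 1)) = S.P (j + 1) :=
        L.P.exp_eq (by rw [← hl]; push_cast; rfl)
      have e2 : Circle.exp (q (l + 1)) = S.Q (j + 1) :=
        L.Q.exp_eq (by rw [← hl]; push_cast; rfl)
      have e3 : Circle.exp (q (l - 1)) = S.Q (j - 1) :=
        L.Q.exp_eq (by rw [← hl]; push_cast; rfl)
      have b1 : q (l - 1) < p l := L.q_lt_p_of_lt (by omega)
      have b2 : p l < p (l + 1) := L.strictMono_p (by omega)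
      have b3 : p (l + 1) < q (l + 1) := L.p_lt_q _
      have b4 : q (l + 1) < q (l - 1 + (8 * g - 4 : ℕ)) := L.strictMono_q (by omega)
      rw [L.Q.add] at b4
      have hj := hG j
      rw [← e1, ← L.P.exp_eq hl, mem_arcIcc_exp (by linarith) (by linarith)] at hj
      obtain ⟨y, hy, y1, y2⟩ := hj
      rw [← e2, ← e3, ← hy]
      exact ⟨exp_mem_arcIcc (by linarith) (by linarith) (by linarith),
        (exp_ne_exp (by linarith) (by linarith)).symm, exp_ne_exp (by linarith) (by linarith)⟩
    refine arc_system_solution_unique (fun j => S.Q (j - 1)) (fun j => S.Q (j + 1)) _ _ ?_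
      (fun j => (h j).2) (fun j => (h' j).2) (mem G fun j => (h j).1) (mem G' fun j => (h' j).1)
    intro j
    obtain ⟨l, hl⟩ := ZMod.intCast_surjective j
    have e2 : Circle.exp (q (l + 1)) = S.Q (j + 1) :=
      L.Q.exp_eq (by rw [← hl]; push_cast; rfl)
    have e3 : Circle.exp (q (l - 1)) = S.Q (j - 1) :=
      L.Q.exp_eq (by rw [← hl]; push_cast; rfl)
    have b0 : q (l - 1) < p l := L.q_lt_p_of_lt (by omega)
    have b4 : q (l + 1) < q (l - 1 + (8 * g - 4 : ℕ)) := L.strictMono_q (by omega)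
    rw [L.Q.add] at b4
    unfold depMap depIndex
    by_cases hP : A (sidePairing g j) = S.P (sidePairing g j)
    · rw [if_pos hP, if_pos hP]
      obtain ⟨k, hk⟩ := ZMod.intCast_surjective (sidePairing g j)
      obtain ⟨t, te, tm, t1, -, -, t2, -⟩ := L.exists_lift_T hg hk
        (hl.trans (sidePairing_sidePairing hg j).symm)
      have b := L.Q.add (k + 1)
      have b1 : q (k + 1) < q (k - 3 + (8 * g - 4 : ℕ)) := L.strictMono_q (by omega)
      have b2 : q (k - 3 + (8 * g - 4 : ℕ)) < q (k - 1 + (8 * g - 4 : ℕ)) :=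
        L.strictMono_q (by omega)
      have b3 : q (k - 1 + (8 * g - 4 : ℕ)) < p (k + (8 * g - 4 : ℕ)) :=
        L.q_lt_p_of_lt (by omega)
      have b5 : p (k + (8 * g - 4 : ℕ)) < q (k + 1 + (8 * g - 4 : ℕ)) :=
        L.p_lt_q_of_le (by omega)
      have c1 := tm ⟨le_refl _, by linarith⟩ ⟨b1.le, by linarith⟩ b1
      have c2 := tm ⟨b1.le, by linarith⟩ ⟨by linarith, by linarith⟩ b2
      have c3 := tm ⟨by linarith, by linarith⟩ ⟨by linarith, by linarith⟩ b3
      refine ⟨q (l - 1), t (q (k - 3 + (8 * g - 4 : ℕ))), t (q (k - 1 + (8 * g - 4 : ℕ))),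
        q (l + 1), by linarith, by linarith, by linarith, by linarith, e3, ?_, ?_, e2⟩
      · rw [te, L.Q.add, Circle.exp_add_two_pi, L.Q.exp_eq]
        rw [← hk]; push_cast; ring
      · rw [te, L.Q.add, Circle.exp_add_two_pi, L.Q.exp_eq]
        rw [← hk]; push_cast; ring
    · rw [if_neg hP, if_neg hP]
      obtain ⟨k, hk⟩ := ZMod.intCast_surjective (oppositeSide g (sidePairing g j) + 1)
      obtain ⟨t, te, tm, t1, t2, -, -, t3⟩ := L.exists_lift_T hg (l := l - 1) hk
        (by rw [sidePairing_oppositeSide_add_one hg, ← hl]; push_cast; rfl)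
      have b := L.Q.add (k + 1)
      have b0 : q (k + 1) < q (k + 2) := L.strictMono_q (by omega)
      have b1 : q (k + 2) < q (k - 2 + (8 * g - 4 : ℕ)) := L.strictMono_q (by omega)
      have b2 : q (k - 2 + (8 * g - 4 : ℕ)) < q (k + (8 * g - 4 : ℕ)) :=
        L.strictMono_q (by omega)
      have b3 : q (k + (8 * g - 4 : ℕ)) < q (k + 1 + (8 * g - 4 : ℕ)) :=
        L.strictMono_q (by omega)
      have c1 := tm ⟨by linarith, by linarith⟩ ⟨by linarith, by linarith⟩ b1
      have c2 := tm ⟨by linarith, by linarith⟩ ⟨by linarith, by linarith⟩ b2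
      rw [show l - 1 + 2 = l + 1 by ring] at t3
      refine ⟨q (l - 1), t (q (k - 2 + (8 * g - 4 : ℕ))), t (q (k + (8 * g - 4 : ℕ))),
        q (l + 1), by linarith, by linarith, by linarith, by linarith, e3, ?_, ?_, e2⟩
      · rw [te, L.Q.add, Circle.exp_add_two_pi, L.Q.exp_eq]
        push_cast; rw [hk]; ring
      · rw [te, L.Q.add, Circle.exp_add_two_pi, L.Q.exp_eq]
        exact hk

end FundamentalPolygon

/-! ### Relations between the points `G`, `D` and `H` -/

namespace FundamentalPolygon

variable {g : ℕ} {S : FundamentalPolygon g} {A G : ZMod (8 * g - 4) → Circle}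

theorem map_cornerH (hg : 2 ≤ g) (i : ZMod (8 * g - 4)) :
    bdry (S.T i) (S.cornerH G (i + 1)) = S.dualParameter G (sidePairing g i) := by
  unfold cornerH dualParameter
  rw [add_sub_cancel_right, bdry_mul, S.bdry_bdry_sidePairing hg, sidePairing_sidePairing hg,
    oppositeSide_add_one, add_sub_cancel_right]

/-- The useful description of `H`: it is the inverse image of a dual parameter under a side pairing.
-/
theorem cornerH_add_one (hg : 2 ≤ g) (i : ZMod (8 * g - 4)) :
    S.cornerH G (i + 1) = bdry (S.T (sidePairing g i)) (S.dualParameter G (sidePairing g i)) := by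
  rw [← map_cornerH hg, S.bdry_sidePairing_bdry]

theorem map_G_sub_one (hg : 2 ≤ g) (i : ZMod (8 * g - 4)) :
    bdry (S.T i) (G (i - 1)) = S.dualParameter G (sidePairing g i + 1) := by
  unfold dualParameter
  rw [sidePairing_add_one hg, sidePairing_sidePairing hg, oppositeSide_sub_one,
    oppositeSide_oppositeSide hg, sub_add_cancel]

/-- The vertex relation at `V (τ σ i)`, with the two factors `T (i + 1)` and `T (σ i)` moved to the
other side and inverted. -/
theorem T_mul_T (hg : 2 ≤ g) (i : ZMod (8 * g - 4)) :
    S.T (oppositeSide g i + 1) * S.T (oppositeSide g (sidePairing g i)) =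
      S.T i * S.T (oppositeSide g (sidePairing g i) - 1) := by
  have h := S.vertex_cycle (oppositeSide g (sidePairing g i))
  rw [vertexMap_vertexMap hg, vertexMap_vertexMap hg, oppositeSide_oppositeSide hg] at h
  unfold vertexMap at h
  rw [sidePairing_oppositeSide hg, sidePairing_sidePairing hg, oppositeSide_add_one,
    oppositeSide_oppositeSide hg, mul_assoc] at h
  have h2 := eq_inv_of_mul_eq_one_right h
  rw [h2, mul_inv_rev, S.T_inv, S.T_inv, sidePairing_sidePairing hg, sidePairing_add_one hg]

theorem IsSystemSolution.eq_dualParameter (hg : 2 ≤ g) (h : S.IsSystemSolution A G)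
    {i : ZMod (8 * g - 4)} (hi : A i = S.Q i) :
    G (sidePairing g i) = S.dualParameter G (sidePairing g i) := by
  rw [h.eq_of_Q i hi]
  unfold dualParameter
  rw [sidePairing_sidePairing hg]

/-- By the vertex relation the transformation in `H` factors through `T i`. This makes `H`
computable from the equation for `G (σ (i + 1))`, that is, from the choice of `A (i + 1)`. -/
theorem cornerH_sidePairing (hg : 2 ≤ g) (i : ZMod (8 * g - 4)) :
    S.cornerH G (sidePairing g i) =
      bdry (S.T i) (bdry (S.T (sidePairing g (i + 1))) (G (sidePairing g (i + 1)))) := by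
  unfold cornerH
  rw [sidePairing_sub_one hg, sidePairing_sidePairing hg, T_mul_T hg, bdry_mul,
    sidePairing_add_one hg]

theorem IsSystemSolution.map_cornerH_add_two (hg : 2 ≤ g) (h : S.IsSystemSolution A G)
    {i : ZMod (8 * g - 4)} (hi : A (i + 1) = S.Q (i + 1)) :
    bdry (S.T i) (S.cornerH G (i + 2)) = S.cornerH G (sidePairing g i) := by
  rw [cornerH_sidePairing hg, h.eq_dualParameter hg hi, ← cornerH_add_one hg]
  congr 2; ring

theorem IsSystemSolution.cornerH_eq (hg : 2 ≤ g) (h : S.IsSystemSolution A G)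
    {i : ZMod (8 * g - 4)} (hi : A (i + 1) = S.P (i + 1)) :
    S.cornerH G (sidePairing g i) = S.dualParameter G (sidePairing g i + 1) := by
  rw [cornerH_sidePairing hg, h.eq_of_P _ hi, S.bdry_sidePairing_bdry,
    show i + 1 - 2 = i - 1 by ring, map_G_sub_one hg]

/-- Needed only on the boundary of the closed domain, where `T i` acts on a point of the strip just
below its own. -/
theorem map_cornerH_self (hg : 2 ≤ g) (i : ZMod (8 * g - 4)) :
    bdry (S.T i) (S.cornerH G i) =
      bdry (S.T (sidePairing g (sidePairing g i + 1))) (G (sidePairing g (sidePairing g i + 1))) := by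
  have h := T_mul_T (S := S) hg (oppositeSide g i - 1)
  rw [oppositeSide_sub_one, oppositeSide_oppositeSide hg, sub_add_cancel,
    sidePairing_sub_one hg, sidePairing_oppositeSide hg, oppositeSide_oppositeSide hg,
    oppositeSide_add_one, add_sub_cancel_right] at h
  unfold cornerH
  rw [sidePairing_sub_one hg, ← bdry_mul, ← mul_assoc, h, mul_assoc,
    ← sidePairing_oppositeSide hg, S.pairing_inv, mul_one, sidePairing_add_one hg,
    sidePairing_sidePairing hg]

/-- With `j = τ σ i`, the map `T (j + 1)` carries the arc `[P j, P (j + 1)]` that contains `G j`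
onto `[P i, Q i]`. -/
theorem IsSystemSolution.dualParameter_mem (hg : 2 ≤ g) (h : S.IsSystemSolution A G)
    (i : ZMod (8 * g - 4)) : S.dualParameter G i ∈ arcIcc (S.P i) (S.Q i) := by
  have h1 := h.mem (oppositeSide g (sidePairing g i))
  rw [← bdry_mem_arcIcc (S.T (oppositeSide g (sidePairing g i) + 1))] at h1
  have h2 := S.map_P_sub_one hg (oppositeSide g (sidePairing g i) + 1)
  rw [sidePairing_oppositeSide_add_one hg, add_sub_cancel_right, sub_add_cancel] at h2
  have h3 := S.map_P hg (oppositeSide g (sidePairing g i) + 1)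
  rw [sidePairing_oppositeSide_add_one hg, sub_add_cancel] at h3
  rwa [h2, h3] at h1

theorem IsSystemSolution.cornerH_mem (hg : 2 ≤ g) (h : S.IsSystemSolution A G)
    (i : ZMod (8 * g - 4)) : S.cornerH G i ∈ arcIcc (S.Q i) (S.Q (i + 1)) := by
  obtain ⟨i, rfl⟩ : ∃ j, i = j + 1 := ⟨i - 1, by ring⟩
  have h1 := h.dualParameter_mem hg (sidePairing g i)
  rw [← bdry_mem_arcIcc (S.T (sidePairing g i)), ← cornerH_add_one hg, S.map_P hg, S.map_Q hg,
    sidePairing_sidePairing hg] at h1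
  rwa [show i + 1 + 1 = i + 2 by ring]

/-- Yields `D j ≤ G j` on the line. If `A i = P i` for `j = σ i`, then `G j` is the image of a point
of `[P (i-2), P (i-1)]`, and `T i` carries the larger arc `[Q (i+2), P (i-1)]` onto `[Q j, P
(j+1)]`. -/
theorem IsSystemSolution.G_eq_or_mem (hg : 2 ≤ g) (hA : S.IsExtremal A)
    (h : S.IsSystemSolution A G) (j : ZMod (8 * g - 4)) :
    G j = S.dualParameter G j ∨ G j ∈ arcIcc (S.Q j) (S.P (j + 1)) := by
  obtain ⟨i, rfl⟩ : ∃ i, j = sidePairing g i := ⟨_, (sidePairing_sidePairing hg j).symm⟩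
  rcases hA i with hi | hi
  · right
    have hN := natCast_mod_eq hg
    obtain ⟨p, q, L⟩ := S.exists_isEndpointLift hg
    obtain ⟨k, hk⟩ := ZMod.intCast_surjective i
    rw [h.eq_of_P i hi, ← S.map_Q_add_two hg, ← S.map_P_sub_one hg, bdry_mem_arcIcc]
    have h1 := h.mem (i - 2)
    have e1 : Circle.exp (p (k - 2 + (8 * g - 4 : ℕ))) = S.P (i - 2) := by
      rw [L.P.add, Circle.exp_add_two_pi, L.P.exp_eq]
      rw [← hk]; push_cast; rfl
    have e2 : Circle.exp (p (k - 1 + (8 * g - 4 : ℕ))) = S.P (i - 1) := by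
      rw [L.P.add, Circle.exp_add_two_pi, L.P.exp_eq]
      rw [← hk]; push_cast; ring
    have e3 : Circle.exp (q (k + 2)) = S.Q (i + 2) :=
      L.Q.exp_eq (by rw [← hk]; push_cast; rfl)
    have b1 : q (k + 2) < p (k - 2 + (8 * g - 4 : ℕ)) := L.q_lt_p_of_lt (by omega)
    have b2 : p (k - 2 + (8 * g - 4 : ℕ)) < p (k - 1 + (8 * g - 4 : ℕ)) :=
      L.strictMono_p (by omega)
    have b3 : p (k - 1 + (8 * g - 4 : ℕ)) < q (k + 2 + (8 * g - 4 : ℕ)) :=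
      L.p_lt_q_of_le (by omega)
    rw [L.Q.add] at b3
    rw [show i - 2 + 1 = i - 1 by ring, ← e1, ← e2, mem_arcIcc_exp b2.le (by linarith)] at h1
    obtain ⟨y, hy, y1, y2⟩ := h1
    rw [← hy, ← e3, ← e2]
    exact exp_mem_arcIcc (by linarith) y2 (by linarith)
  · left
    exact h.eq_dualParameter hg hi

/-- Yields `H j ≤ D (j + 1)` on the line. If the equality fails, `H j` is the image under `T i` of
`H (i + 2)`, which lies in `[Q (i+2), P (i-1)]`. -/
theorem IsSystemSolution.cornerH_eq_or_mem (hg : 2 ≤ g) (hA : S.IsExtremal A)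
    (h : S.IsSystemSolution A G) (j : ZMod (8 * g - 4)) :
    S.cornerH G j = S.dualParameter G (j + 1) ∨
      S.cornerH G j ∈ arcIcc (S.Q j) (S.P (j + 1)) := by
  obtain ⟨i, rfl⟩ : ∃ i, j = sidePairing g i := ⟨_, (sidePairing_sidePairing hg j).symm⟩
  rcases hA (i + 1) with hi | hi
  · left
    exact h.cornerH_eq hg hi
  · right
    have hN := natCast_mod_eq hg
    obtain ⟨p, q, L⟩ := S.exists_isEndpointLift hg
    obtain ⟨k, hk⟩ := ZMod.intCast_surjective i
    rw [← h.map_cornerH_add_two hg hi, ← S.map_Q_add_two hg, ← S.map_P_sub_one hg,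
      bdry_mem_arcIcc]
    have h1 := h.cornerH_mem hg (i + 2)
    have e1 : Circle.exp (q (k + 3)) = S.Q (i + 2 + 1) :=
      L.Q.exp_eq (by rw [← hk]; push_cast; ring)
    have e2 : Circle.exp (p (k - 1 + (8 * g - 4 : ℕ))) = S.P (i - 1) := by
      rw [L.P.add, Circle.exp_add_two_pi, L.P.exp_eq]
      rw [← hk]; push_cast; ring
    have e3 : Circle.exp (q (k + 2)) = S.Q (i + 2) :=
      L.Q.exp_eq (by rw [← hk]; push_cast; rfl)
    have b1 : q (k + 2) < q (k + 3) := L.strictMono_q (by omega)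
    have b2 : q (k + 3) < p (k - 1 + (8 * g - 4 : ℕ)) := L.q_lt_p_of_lt (by omega)
    have b3 : p (k - 1 + (8 * g - 4 : ℕ)) < q (k + 2 + (8 * g - 4 : ℕ)) :=
      L.p_lt_q_of_le (by omega)
    rw [L.Q.add] at b3
    rw [← e1, ← e3, mem_arcIcc_exp b1.le (by linarith)] at h1
    obtain ⟨y, hy, y1, y2⟩ := h1
    rw [← hy, ← e3, ← e2]
    exact exp_mem_arcIcc (by linarith) (by linarith) (by linarith)

/-! ### Order of all corner points on the line -/

/-- Lifts to the line of all the points that bound the domains. -/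
structure IsDomainLift (S : FundamentalPolygon g) (G : ZMod (8 * g - 4) → Circle)
    (p q d g' h : ℤ → ℝ) : Prop extends S.IsEndpointLift p q where
  lift_D : IsCircleLift (S.dualParameter G) d
  lift_G : IsCircleLift G g'
  lift_H : IsCircleLift (S.cornerH G) h
  p_le_d : ∀ k, p k ≤ d k
  d_le_q : ∀ k, d k ≤ q k
  d_le_g : ∀ k, d k ≤ g' k
  g_le_p : ∀ k, g' k ≤ p (k + 1)
  q_le_h : ∀ k, q k ≤ h k
  h_le_d : ∀ k, h k ≤ d (k + 1)

theorem IsSystemSolution.exists_isDomainLift (hg : 2 ≤ g) (hA : S.IsExtremal A)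
    (hG : S.IsSystemSolution A G) : ∃ p q d g' h, IsDomainLift S G p q d g' h := by
  obtain ⟨p, q, L⟩ := S.exists_isEndpointLift hg
  have hN := natCast_mod_eq hg
  have bp : ∀ k, p (k + 1) < p k + 2 * Real.pi := fun k => by
    rw [← L.P.add]; exact L.strictMono_p (by omega)
  have bq : ∀ k, q (k + 1) < q k + 2 * Real.pi := fun k => by
    rw [← L.Q.add]; exact L.strictMono_q (by omega)
  have b1 := L.p_lt_q
  have b2 := L.q_lt_p
  obtain ⟨d, D, d1, d2⟩ := L.P.exists_between L.Q (fun k => (L.p_lt_q k).le)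
    (fun k => by linarith [bp k, b2 k]) (fun k => hG.dualParameter_mem hg k)
  have G' : ∃ g' : ℤ → ℝ, IsCircleLift G g' ∧ (∀ k, d k ≤ g' k) ∧ ∀ k, g' k ≤ p (k + 1) := by
    refine D.exists_between (L.P.shift 1) (fun k => by linarith [d2 k, b2 k])
      (fun k => by linarith [d1 k, bp k]) fun k => ?_
    rcases hG.G_eq_or_mem hg hA (k : ZMod (8 * g - 4)) with hk | hk
    · rw [hk]; exact left_mem_arcIcc _ _
    · have e : Circle.exp (p (k + 1)) = S.P ((k : ZMod (8 * g - 4)) + 1) :=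
        L.P.exp_eq (by push_cast; rfl)
      rw [← L.Q.exp, ← e, mem_arcIcc_exp (b2 k).le (by linarith [bp k, b1 k])] at hk
      obtain ⟨y, hy, y1, y2⟩ := hk
      push_cast
      rw [← hy, ← D.exp, ← e]
      exact exp_mem_arcIcc (by linarith [d2 k]) y2 (by linarith [bp k, d1 k])
  obtain ⟨g', G', g1, g2⟩ := G'
  have H : ∃ h : ℤ → ℝ, IsCircleLift (S.cornerH G) h ∧ (∀ k, q k ≤ h k) ∧
      ∀ k, h k ≤ d (k + 1) := by
    refine L.Q.exists_between (D.shift 1) (fun k => by linarith [d1 (k + 1), b2 k])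
      (fun k => by linarith [d2 (k + 1), bq k]) fun k => ?_
    push_cast
    rcases hG.cornerH_eq_or_mem hg hA (k : ZMod (8 * g - 4)) with hk | hk
    · rw [hk]; exact right_mem_arcIcc _ _
    · have e : Circle.exp (p (k + 1)) = S.P ((k : ZMod (8 * g - 4)) + 1) :=
        L.P.exp_eq (by push_cast; rfl)
      have e' : Circle.exp (d (k + 1)) = S.dualParameter G ((k : ZMod (8 * g - 4)) + 1) :=
        D.exp_eq (by push_cast; rfl)
      rw [← L.Q.exp, ← e, mem_arcIcc_exp (b2 k).le (by linarith [bp k, b1 k])] at hk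
      obtain ⟨y, hy, y1, y2⟩ := hk
      rw [← hy, ← e', ← L.Q.exp]
      exact exp_mem_arcIcc y1 (by linarith [d1 (k + 1)]) (by linarith [bq k, d2 (k + 1)])
  obtain ⟨h, H, h1, h2⟩ := H
  exact ⟨p, q, d, g', h, { L with
    lift_D := D, lift_G := G', lift_H := H, p_le_d := d1, d_le_q := d2, d_le_g := g1, g_le_p := g2,
    q_le_h := h1, h_le_d := h2 }⟩

end FundamentalPolygon

/-! ### The domains in the coordinates of the line -/

/-- The common properties of the families of closed and of half-open arcs. -/
structure IsArcKind (arc : Circle → Circle → Set Circle) (r : ℝ → ℝ → Prop) : Prop where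
  mem : ∀ {a b : ℝ} {x : Circle}, a ≤ b → b < a + 2 * Real.pi →
    (x ∈ arc (Circle.exp a) (Circle.exp b) ↔ ∃ y, Circle.exp y = x ∧ a ≤ y ∧ r y b)
  le : ∀ {x y}, r x y → x ≤ y
  of_lt : ∀ {x y}, x < y → r x y
  trans : ∀ {x y z}, r x y → y ≤ z → r x z
  add : ∀ {x y} (z), r x y → r (x + z) (y + z)
  bdry_mem : ∀ (T : diskMobius) {a b x : Circle},
    bdry T x ∈ arc (bdry T a) (bdry T b) ↔ x ∈ arc a b

theorem isArcKind_arcIcc : IsArcKind arcIcc (· ≤ ·) :=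
  ⟨mem_arcIcc_exp, id, le_of_lt, le_trans, fun z h => by linarith,
    bdry_mem_arcIcc⟩

theorem isArcKind_arcIco : IsArcKind arcIco (· < ·) :=
  ⟨mem_arcIco_exp, le_of_lt, id, lt_of_lt_of_le, fun z h => by linarith,
    bdry_mem_arcIco⟩

theorem exists_between_of_le {x : ℤ → ℝ} {a b : ℤ} {y : ℝ} (hab : a ≤ b) (ha : x a ≤ y)
    (hb : y < x b) : ∃ k, a ≤ k ∧ k < b ∧ x k ≤ y ∧ y < x (k + 1) := by
  induction b, hab using Int.leInduction with
  | base => linarith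
  | succ n hn ih =>
    rcases lt_or_ge y (x n) with h | h
    · obtain ⟨k, h1, h2, h3⟩ := ih h
      exact ⟨k, h1, by omega, h3⟩
    · exact ⟨n, hn, by omega, h, hb⟩

namespace FundamentalPolygon

variable {g : ℕ} {S : FundamentalPolygon g} {A G : ZMod (8 * g - 4) → Circle}
  {p q d g' h : ℤ → ℝ}

namespace IsDomainLift

theorem mono_d (L : IsDomainLift S G p q d g' h) {k l : ℤ} (hkl : k ≤ l) : d k ≤ d l :=
  monotone_int_of_le_succ (fun k => (L.d_le_q k).trans ((L.q_lt_p k).le.trans (L.p_le_d _))) hkl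

theorem d_le_g_of_le (L : IsDomainLift S G p q d g' h) {k l : ℤ} (hkl : k ≤ l) : d k ≤ g' l :=
  (L.mono_d hkl).trans (L.d_le_g l)

theorem h_le_d_of_lt (L : IsDomainLift S G p q d g' h) {k l : ℤ} (hkl : k < l) : h k ≤ d l :=
  (L.h_le_d k).trans (L.mono_d hkl)

theorem d_le_h_of_le (L : IsDomainLift S G p q d g' h) {k l : ℤ} (hkl : k ≤ l) : d k ≤ h l :=
  (L.mono_d hkl).trans ((L.d_le_q l).trans (L.q_le_h l))

theorem h_le_q (L : IsDomainLift S G p q d g' h) (k : ℤ) : h k ≤ q (k + 1) :=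
  (L.h_le_d k).trans (L.d_le_q _)

theorem h_lt_g_of_lt (L : IsDomainLift S G p q d g' h) {k l : ℤ} (hkl : k + 1 < l) :
    h k < g' l :=
  (L.h_le_q k).trans_lt ((L.q_lt_p_of_lt hkl).trans_le ((L.p_le_d l).trans (L.d_le_g l)))

theorem g_lt_h_of_le (L : IsDomainLift S G p q d g' h) {k l : ℤ} (hkl : k + 1 ≤ l) :
    g' k < h l :=
  (L.g_le_p k).trans_lt ((L.p_lt_q_of_le hkl).trans_le (L.q_le_h l))

end IsDomainLift

theorem mem_arc_iff {arc : Circle → Circle → Set Circle} {r : ℝ → ℝ → Prop} (K : IsArcKind arc r)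
    {n : ℕ} {X Y : ZMod n → Circle} {x y : ℤ → ℝ} (hx : IsCircleLift X x) (hy : IsCircleLift Y y)
    {k l : ℤ} {i j : ZMod n} (hk : (k : ZMod n) = i) (hl : (l : ZMod n) = j) (h1 : x k ≤ y l)
    (h2 : y l < x k + 2 * Real.pi) {u : Circle} :
    u ∈ arc (X i) (Y j) ↔ ∃ z, Circle.exp z = u ∧ x k ≤ z ∧ r z (y l) := by
  rw [← hx.exp_eq hk, ← hy.exp_eq hl, K.mem h1 h2]

/-- The domain `Ω_A` on the line. -/
theorem mem_domainA_iff {arc : Circle → Circle → Set Circle} {r : ℝ → ℝ → Prop}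
    (K : IsArcKind arc r) (hg : 2 ≤ g) (L : IsDomainLift S G p q d g' h) {u w : Circle} :
    (u, w) ∈ S.domainA arc G ↔ ∃ (k : ℤ) (x y : ℝ), Circle.exp x = u ∧ Circle.exp y = w ∧
      ((h (k + 1) ≤ x ∧ r x (g' (k - 2 + (8 * g - 4 : ℕ))) ∧ p k ≤ y ∧ r y (q k)) ∨
       (h (k + 1) ≤ x ∧ r x (g' (k - 1 + (8 * g - 4 : ℕ))) ∧ q k ≤ y ∧ r y (p (k + 1)))) := by
  have hN := natCast_mod_eq hg
  unfold domainA
  rw [Set.mem_iUnion, (ZMod.intCast_surjective (n := 8 * g - 4)).exists]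
  refine exists_congr fun k => ?_
  have a1 := L.p_lt_q k
  have a2 := L.q_lt_p k
  have a3 : p (k + 1) < p (k + (8 * g - 4 : ℕ)) := L.strictMono_p (by omega)
  rw [L.P.add] at a3
  have e1 : ((k + 1 : ℤ) : ZMod (8 * g - 4)) = (k : ZMod (8 * g - 4)) + 1 := by push_cast; rfl
  -- Counterclockwise from `H (k + 1)`, the point `G (k - 2)` is met almost a full turn later; hence
  -- the index raised by `N`.
  have e2 : ((k - 2 + (8 * g - 4 : ℕ) : ℤ) : ZMod (8 * g - 4)) = (k : ZMod (8 * g - 4)) - 2 := by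
    push_cast; simp
  have e3 : ((k - 1 + (8 * g - 4 : ℕ) : ℤ) : ZMod (8 * g - 4)) = (k : ZMod (8 * g - 4)) - 1 := by
    push_cast; simp
  have b1 : g' (k - 2 + (8 * g - 4 : ℕ)) < h (k + 1 + (8 * g - 4 : ℕ)) :=
    L.g_lt_h_of_le (by omega)
  have b2 : g' (k - 1 + (8 * g - 4 : ℕ)) < h (k + 1 + (8 * g - 4 : ℕ)) :=
    L.g_lt_h_of_le (by omega)
  rw [L.lift_H.add] at b1 b2
  rw [Set.mem_union, Set.mem_prod, Set.mem_prod,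
    mem_arc_iff K L.lift_H L.lift_G e1 e2 (L.h_lt_g_of_lt (by omega)).le b1,
    mem_arc_iff K L.lift_H L.lift_G e1 e3 (L.h_lt_g_of_lt (by omega)).le b2,
    mem_arc_iff K L.P L.Q rfl rfl a1.le (by linarith),
    mem_arc_iff K L.Q L.P rfl e1 a2.le (by linarith)]
  constructor
  · rintro (⟨⟨x, rfl, h1⟩, ⟨y, rfl, h2⟩⟩ | ⟨⟨x, rfl, h1⟩, ⟨y, rfl, h2⟩⟩)
    · exact ⟨x, y, rfl, rfl, Or.inl ⟨h1.1, h1.2, h2⟩⟩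
    · exact ⟨x, y, rfl, rfl, Or.inr ⟨h1.1, h1.2, h2⟩⟩
  · rintro ⟨x, y, hx, hy, (h1 | h1)⟩
    · exact Or.inl ⟨⟨x, hx, h1.1, h1.2.1⟩, ⟨y, hy, h1.2.2⟩⟩
    · exact Or.inr ⟨⟨x, hx, h1.1, h1.2.1⟩, ⟨y, hy, h1.2.2⟩⟩

/-- The domain `Ω_D` on the line. -/
theorem mem_domainD_iff {arc : Circle → Circle → Set Circle} {r : ℝ → ℝ → Prop}
    (K : IsArcKind arc r) (hg : 2 ≤ g) (L : IsDomainLift S G p q d g' h) {w u : Circle} :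
    (w, u) ∈ S.domainD arc G ↔ ∃ (k : ℤ) (y x : ℝ), Circle.exp y = w ∧ Circle.exp x = u ∧
      (((q (k + 2) ≤ y ∧ r y (p (k - 1 + (8 * g - 4 : ℕ))) ∧ d k ≤ x ∧ r x (d (k + 1))) ∨
       (p (k - 1) ≤ y ∧ r y (p k) ∧ h k ≤ x ∧ r x (d (k + 1)))) ∨
       (q (k + 1) ≤ y ∧ r y (q (k + 2)) ∧ d k ≤ x ∧ r x (g' k))) := by
  have hN := natCast_mod_eq hg
  unfold domainD
  rw [Set.mem_iUnion, (ZMod.intCast_surjective (n := 8 * g - 4)).exists]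
  refine exists_congr fun k => ?_
  have e1 : ((k + 1 : ℤ) : ZMod (8 * g - 4)) = (k : ZMod (8 * g - 4)) + 1 := by push_cast; rfl
  have e2 : ((k + 2 : ℤ) : ZMod (8 * g - 4)) = (k : ZMod (8 * g - 4)) + 2 := by push_cast; rfl
  have e3 : ((k - 1 : ℤ) : ZMod (8 * g - 4)) = (k : ZMod (8 * g - 4)) - 1 := by push_cast; rfl
  have e4 : ((k - 1 + (8 * g - 4 : ℕ) : ℤ) : ZMod (8 * g - 4)) = (k : ZMod (8 * g - 4)) - 1 := by
    push_cast; simp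
  have b1 : p (k - 1 + (8 * g - 4 : ℕ)) < q (k + 2 + (8 * g - 4 : ℕ)) :=
    L.p_lt_q_of_le (by omega)
  have b2 : p k < p (k - 1 + (8 * g - 4 : ℕ)) := L.strictMono_p (by omega)
  have b3 : q (k + 2) < q (k + 1 + (8 * g - 4 : ℕ)) := L.strictMono_q (by omega)
  have b4 : p (k + 1) < p (k + (8 * g - 4 : ℕ)) := L.strictMono_p (by omega)
  have b5 : q (k + 1) < q (k + (8 * g - 4 : ℕ)) := L.strictMono_q (by omega)
  have b6 : p (k - 1) < p k := L.strictMono_p (by omega)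
  have b7 : q (k + 1) < q (k + 2) := L.strictMono_q (by omega)
  rw [L.Q.add] at b1 b3 b5
  rw [L.P.add] at b2 b4
  have c1 := L.p_le_d k
  have c2 := L.d_le_q k
  have c3 := L.d_le_q (k + 1)
  have c4 := L.q_le_h k
  have c5 := L.g_le_p k
  have c6 := L.d_le_g k
  have c7 := L.h_le_d k
  have c8 := L.mono_d (show k ≤ k + 1 by omega)
  have c9 : d (k + 1) < d k + 2 * Real.pi := by
    rw [← L.lift_D.add]
    exact c3.trans_lt ((L.q_lt_p_of_lt (by omega)).trans_le (L.p_le_d _))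
  rw [Set.mem_union, Set.mem_union, Set.mem_prod, Set.mem_prod, Set.mem_prod,
    mem_arc_iff K L.Q L.P e2 e4 (L.q_lt_p_of_lt (by omega)).le b1,
    mem_arc_iff K L.lift_D L.lift_D rfl e1 c8 c9,
    mem_arc_iff K L.P L.P e3 rfl b6.le (by rw [L.P.add] at *; linarith),
    mem_arc_iff K L.lift_H L.lift_D rfl e1 c7 (by linarith),
    mem_arc_iff K L.Q L.Q e1 e2 b7.le b3,
    mem_arc_iff K L.lift_D L.lift_G rfl rfl c6 (by linarith)]
  constructor
  · rintro ((⟨⟨y, rfl, h1⟩, ⟨x, rfl, h2⟩⟩ | ⟨⟨y, rfl, h1⟩, ⟨x, rfl, h2⟩⟩) |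
      ⟨⟨y, rfl, h1⟩, ⟨x, rfl, h2⟩⟩)
    · exact ⟨y, x, rfl, rfl, Or.inl (Or.inl ⟨h1.1, h1.2, h2⟩)⟩
    · exact ⟨y, x, rfl, rfl, Or.inl (Or.inr ⟨h1.1, h1.2, h2⟩)⟩
    · exact ⟨y, x, rfl, rfl, Or.inr ⟨h1.1, h1.2, h2⟩⟩
  · rintro ⟨y, x, hy, hx, ((h1 | h1) | h1)⟩
    · exact Or.inl (Or.inl ⟨⟨y, hy, h1.1, h1.2.1⟩, ⟨x, hx, h1.2.2⟩⟩)
    · exact Or.inl (Or.inr ⟨⟨y, hy, h1.1, h1.2.1⟩, ⟨x, hx, h1.2.2⟩⟩)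
    · exact Or.inr ⟨⟨y, hy, h1.1, h1.2.1⟩, ⟨x, hx, h1.2.2⟩⟩

/-- The union of the horizontal strips is the union of the vertical strips. -/
theorem mem_domainA_iff_mem_domainD {arc : Circle → Circle → Set Circle} {r : ℝ → ℝ → Prop}
    (K : IsArcKind arc r) (hg : 2 ≤ g) (L : IsDomainLift S G p q d g' h) {u w : Circle} :
    (u, w) ∈ S.domainA arc G ↔ (w, u) ∈ S.domainD arc G := by
  have hN := natCast_mod_eq hg
  rw [mem_domainA_iff K hg L, mem_domainD_iff K hg L]
  constructor
  · rintro ⟨k, x, y, rfl, rfl, (⟨x1, x2, y1, y2⟩ | ⟨x1, x2, y1, y2⟩)⟩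
    -- The lift `x` runs from `h (k + 1)` through the intervals `[d j, d (j + 1)]`. The first one
    -- belongs to the corner rectangle with `H`, the last piece from `d` to `g'` to the one with
    -- `G`, and those in between to the middle rectangles. Away from the first, `y` is shifted by a
    -- full turn to fit the range of column `j`.
    · rcases lt_or_ge x (d (k - 2 + (8 * g - 4 : ℕ))) with hx | hx
      · obtain ⟨j, j1, j2, j3, j4⟩ := exists_between_of_le (a := k + 1) (by omega)
          ((L.d_le_h_of_le le_rfl).trans x1) hx
        rcases eq_or_lt_of_le j1 with rfl | j1
        · refine ⟨k + 1, y, x, rfl, rfl, Or.inl (Or.inr ⟨?_, ?_, x1, K.of_lt j4⟩)⟩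
          · rwa [add_sub_cancel_right]
          · exact K.trans y2 (L.q_lt_p k).le
        · refine ⟨j, y + 2 * Real.pi, x, Circle.exp_add_two_pi y, rfl,
            Or.inl (Or.inl ⟨?_, ?_, j3, K.of_lt j4⟩)⟩
          · have := L.q_lt_p_of_lt (show j + 2 < k + (8 * g - 4 : ℕ) by omega)
            rw [L.P.add] at this
            linarith
          · rw [L.P.add]
            exact K.add _ (K.trans y2 (L.q_lt_p_of_lt (by omega)).le)
      · refine ⟨k - 2 + (8 * g - 4 : ℕ), y + 2 * Real.pi, x, Circle.exp_add_two_pi y, rfl,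
          Or.inr ⟨?_, ?_, hx, x2⟩⟩
        · have := L.q_lt_p_of_lt (show k - 2 + (8 * g - 4 : ℕ) + 1 < k + (8 * g - 4 : ℕ) by omega)
          rw [L.P.add] at this
          linarith
        · rw [show k - 2 + (8 * g - 4 : ℕ) + 2 = k + (8 * g - 4 : ℕ) by ring, L.Q.add]
          exact K.add _ y2
    · rcases lt_or_ge x (d (k - 1 + (8 * g - 4 : ℕ))) with hx | hx
      · obtain ⟨j, j1, j2, j3, j4⟩ := exists_between_of_le (a := k + 1) (by omega)
          ((L.d_le_h_of_le le_rfl).trans x1) hx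
        rcases eq_or_lt_of_le j1 with rfl | j1
        · refine ⟨k + 1, y, x, rfl, rfl, Or.inl (Or.inr ⟨?_, y2, x1, K.of_lt j4⟩)⟩
          rw [add_sub_cancel_right]
          linarith [L.p_lt_q k]
        · refine ⟨j, y + 2 * Real.pi, x, Circle.exp_add_two_pi y, rfl,
            Or.inl (Or.inl ⟨?_, ?_, j3, K.of_lt j4⟩)⟩
          · have := L.strictMono_q.monotone (show j + 2 ≤ k + (8 * g - 4 : ℕ) by omega)
            rw [L.Q.add] at this
            linarith
          · rw [L.P.add]
            exact K.add _ (K.trans y2 (L.strictMono_p.monotone (by omega)))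
      · refine ⟨k - 1 + (8 * g - 4 : ℕ), y + 2 * Real.pi, x, Circle.exp_add_two_pi y, rfl,
          Or.inr ⟨?_, ?_, hx, x2⟩⟩
        · rw [show k - 1 + (8 * g - 4 : ℕ) + 1 = k + (8 * g - 4 : ℕ) by ring, L.Q.add]
          linarith
        · rw [show k - 1 + (8 * g - 4 : ℕ) + 2 = k + 1 + (8 * g - 4 : ℕ) by ring, L.Q.add]
          exact K.add _ (K.trans y2 (L.p_lt_q _).le)
  · rintro ⟨j, y, x, rfl, rfl, ((⟨y1, y2, x1, x2⟩ | ⟨y1, y2, x1, x2⟩) | ⟨y1, y2, x1, x2⟩)⟩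
    · have x3 : d (j + (8 * g - 4 : ℕ)) ≤ x + 2 * Real.pi := by
        rw [L.lift_D.add]; linarith
      have x4 : r (x + 2 * Real.pi) (d (j + 1 + (8 * g - 4 : ℕ))) := by
        rw [L.lift_D.add]; exact K.add _ x2
      -- For closed arcs the right end of the column range is attained; it is the top of the strip
      -- below it.
      rcases eq_or_lt_of_le (K.le y2) with hy | hy
      · refine ⟨j - 2 + (8 * g - 4 : ℕ), x + 2 * Real.pi, y, Circle.exp_add_two_pi x, rfl,
          Or.inr ⟨?_, ?_, ?_, ?_⟩⟩
        · exact (L.h_le_d_of_lt (by omega)).trans x3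
        · exact K.trans x4 (L.d_le_g_of_le (by omega))
        · rw [hy]; exact (L.q_lt_p_of_lt (by omega)).le
        · rwa [show j - 2 + (8 * g - 4 : ℕ) + 1 = j - 1 + (8 * g - 4 : ℕ) by ring]
      · obtain ⟨k, k1, k2, k3, k4⟩ := exists_between_of_le (a := j + 2) (by omega)
          ((L.p_lt_q _).le.trans y1) hy
        rcases lt_or_ge y (q k) with hk | hk
        · have k5 : j + 2 ≠ k := by
            rintro rfl
            linarith
          refine ⟨k, x + 2 * Real.pi, y, Circle.exp_add_two_pi x, rfl,
            Or.inl ⟨?_, ?_, k3, K.of_lt hk⟩⟩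
          · exact (L.h_le_d_of_lt (by omega)).trans x3
          · exact K.trans x4 (L.d_le_g_of_le (by omega))
        · refine ⟨k, x + 2 * Real.pi, y, Circle.exp_add_two_pi x, rfl,
            Or.inr ⟨?_, ?_, hk, K.of_lt k4⟩⟩
          · exact (L.h_le_d_of_lt (by omega)).trans x3
          · exact K.trans x4 (L.d_le_g_of_le (by omega))
    · rcases lt_or_ge y (q (j - 1)) with hy | hy
      · refine ⟨j - 1, x, y, rfl, rfl, Or.inl ⟨?_, ?_, y1, K.of_lt hy⟩⟩
        · rwa [sub_add_cancel]
        · exact K.trans x2 (L.d_le_g_of_le (by omega))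
      · refine ⟨j - 1, x, y, rfl, rfl, Or.inr ⟨?_, ?_, hy, ?_⟩⟩
        · rwa [sub_add_cancel]
        · exact K.trans x2 (L.d_le_g_of_le (by omega))
        · rwa [sub_add_cancel]
    · have x3 : d (j + (8 * g - 4 : ℕ)) ≤ x + 2 * Real.pi := by
        rw [L.lift_D.add]; linarith
      have x4 : r (x + 2 * Real.pi) (g' (j + (8 * g - 4 : ℕ))) := by
        rw [L.lift_G.add]; exact K.add _ x2
      rcases lt_or_ge y (p (j + 2)) with hy | hy
      · refine ⟨j + 1, x + 2 * Real.pi, y, Circle.exp_add_two_pi x, rfl,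
          Or.inr ⟨?_, ?_, y1, ?_⟩⟩
        · exact (L.h_le_d_of_lt (by omega)).trans x3
        · rwa [add_sub_cancel_right]
        · rw [show j + 1 + 1 = j + 2 by ring]
          exact K.of_lt hy
      · refine ⟨j + 2, x + 2 * Real.pi, y, Circle.exp_add_two_pi x, rfl,
          Or.inl ⟨?_, ?_, hy, y2⟩⟩
        · exact (L.h_le_d_of_lt (by omega)).trans x3
        · rwa [add_sub_cancel_right]

theorem image_swap_domainA {arc : Circle → Circle → Set Circle} {r : ℝ → ℝ → Prop}
    (K : IsArcKind arc r) (hg : 2 ≤ g) (L : IsDomainLift S G p q d g' h) :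
    Prod.swap '' S.domainA arc G = S.domainD arc G := by
  ext ⟨w, u⟩
  rw [← mem_domainA_iff_mem_domainD K hg L]
  constructor
  · rintro ⟨⟨a, b⟩, hab, heq⟩
    cases heq
    exact hab
  · intro hm
    exact ⟨(u, w), hm, rfl⟩

/-! ### Shape of the domains -/

theorem hasFiniteRectangularStructure_domainA (hg : 2 ≤ g) (L : IsDomainLift S G p q d g' h) :
    HasFiniteRectangularStructure (S.domainA arcIcc G) := by
  classical
  have hNZ : NeZero (8 * g - 4) := ⟨by omega⟩
  have hN := natCast_mod_eq hg
  have bounds : ∀ k : ℤ, h (k + 1) < g' (k - 2 + (8 * g - 4 : ℕ)) ∧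
      h (k + 1) < g' (k - 1 + (8 * g - 4 : ℕ)) ∧ q (k + 1) ≤ h (k + 1) ∧
      g' (k - 2 + (8 * g - 4 : ℕ)) ≤ p (k - 1) + 2 * Real.pi ∧
      g' (k - 1 + (8 * g - 4 : ℕ)) ≤ p k + 2 * Real.pi := fun k => by
    have b1 := L.g_le_p (k - 2 + (8 * g - 4 : ℕ))
    have b2 := L.g_le_p (k - 1 + (8 * g - 4 : ℕ))
    rw [show k - 2 + (8 * g - 4 : ℕ) + 1 = k - 1 + (8 * g - 4 : ℕ) by ring, L.P.add] at b1
    rw [show k - 1 + (8 * g - 4 : ℕ) + 1 = k + (8 * g - 4 : ℕ) by ring, L.P.add] at b2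
    exact ⟨L.h_lt_g_of_lt (by omega), L.h_lt_g_of_lt (by omega), L.q_le_h _, b1, b2⟩
  refine ⟨⟨Finset.univ.image (fun i => ((S.cornerH G (i + 1), G (i - 2)), (S.P i, S.Q i))) ∪
    Finset.univ.image (fun i => ((S.cornerH G (i + 1), G (i - 1)), (S.Q i, S.P (i + 1)))),
    ?_, ?_⟩, ?_⟩
  · intro r hr
    rw [Finset.mem_union, Finset.mem_image, Finset.mem_image] at hr
    have ne : ∀ i : ZMod (8 * g - 4), S.cornerH G (i + 1) ≠ G (i - 2) ∧
        S.cornerH G (i + 1) ≠ G (i - 1) ∧ S.Q i ≠ S.P (i + 1) := by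
      intro i
      obtain ⟨k, rfl⟩ := ZMod.intCast_surjective i
      obtain ⟨b1, b2, b3, b4, b5⟩ := bounds k
      have c1 := L.p_lt_q k
      have c2 := L.q_lt_p k
      have c3 := L.p_lt_q (k + 1)
      have c4 : p (k - 1) < p k := L.strictMono_p (by omega)
      have c5 : p (k + 1) < p (k + (8 * g - 4 : ℕ)) := L.strictMono_p (by omega)
      rw [L.P.add] at c5
      rw [← L.lift_H.exp_eq (k := k + 1) (by push_cast; rfl),
        ← L.lift_G.exp_eq (k := k - 2 + (8 * g - 4 : ℕ)) (by push_cast; simp),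
        ← L.lift_G.exp_eq (k := k - 1 + (8 * g - 4 : ℕ)) (by push_cast; simp), ← L.Q.exp,
        ← L.P.exp_eq (k := k + 1) (by push_cast; rfl)]
      exact ⟨exp_ne_exp b1 (by linarith), exp_ne_exp b2 (by linarith),
        exp_ne_exp c2 (by linarith)⟩
    rcases hr with ⟨i, -, rfl⟩ | ⟨i, -, rfl⟩
    · exact ⟨(ne i).1, S.P_ne_Q hg i⟩
    · exact ⟨(ne i).2.1, (ne i).2.2⟩
  · ext ⟨u, w⟩
    simp only [domainA, Set.mem_iUnion, Finset.mem_union, Finset.mem_image, Finset.mem_univ,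
      true_and, Set.mem_union, exists_prop]
    constructor
    · rintro ⟨i, hi | hi⟩
      · exact ⟨_, Or.inl ⟨i, rfl⟩, hi⟩
      · exact ⟨_, Or.inr ⟨i, rfl⟩, hi⟩
    · rintro ⟨_, ⟨i, rfl⟩ | ⟨i, rfl⟩, hi⟩
      · exact ⟨i, Or.inl hi⟩
      · exact ⟨i, Or.inr hi⟩
  · rintro ⟨u, w⟩ huw heq
    rw [mem_domainA_iff isArcKind_arcIcc hg L] at huw
    obtain ⟨k, x, y, hx, hy, hxy⟩ := huw
    have heq : u = w := heq
    obtain ⟨b1, b2, b3, b4, b5⟩ := bounds k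
    have c1 := L.p_lt_q k
    have c2 := L.q_lt_p k
    have c3 := L.p_lt_q (k + 1)
    have c4 : p (k - 1) < p k := L.strictMono_p (by omega)
    rw [← hx, ← hy] at heq
    rcases hxy with ⟨x1, x2, y1, y2⟩ | ⟨x1, x2, y1, y2⟩ <;>
      exact exp_ne_exp (a := y) (b := x) (by linarith) (by linarith) heq.symm

/-- The fibres of the closed domain over interior points of the horizontal strips. -/
theorem exists_lift_of_mem_domainA (hg : 2 ≤ g) (L : IsDomainLift S G p q d g' h) {x y : ℝ}
    (hxy : (Circle.exp x, Circle.exp y) ∈ S.domainA arcIcc G) (k : ℤ) :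
    (p k < y → y < q k → ∃ m : ℤ, h (k + 1) ≤ x + m * (2 * Real.pi) ∧
      x + m * (2 * Real.pi) ≤ g' (k - 2 + (8 * g - 4 : ℕ))) ∧
    (q k < y → y < p (k + 1) → ∃ m : ℤ, h (k + 1) ≤ x + m * (2 * Real.pi) ∧
      x + m * (2 * Real.pi) ≤ g' (k - 1 + (8 * g - 4 : ℕ))) := by
  rw [mem_domainA_iff isArcKind_arcIcc hg L] at hxy
  obtain ⟨l, x', y', hx, hy, H⟩ := hxy
  obtain ⟨m, hm⟩ := Circle.exp_eq_exp.1 hx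
  obtain ⟨m', hm'⟩ := Circle.exp_eq_exp.1 hy
  obtain ⟨j, rfl⟩ : ∃ j, l = j + (8 * g - 4 : ℕ) * m' := ⟨l - (8 * g - 4 : ℕ) * m', by ring⟩
  have e1 : ∀ a : ℤ, j + (8 * g - 4 : ℕ) * m' + a = (j + a) + (8 * g - 4 : ℕ) * m' := fun a => by
    ring
  have e2 : ∀ a : ℤ, j + (8 * g - 4 : ℕ) * m' - a + (8 * g - 4 : ℕ) =
      (j - a + (8 * g - 4 : ℕ)) + (8 * g - 4 : ℕ) * m' := fun a => by ring
  rw [e1, e2, e2, L.lift_H.add_mul, L.lift_G.add_mul, L.lift_G.add_mul, L.P.add_mul, L.P.add_mul,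
    L.Q.add_mul] at H
  have c1 : ∀ {a b : ℤ}, a < b → p (a + 1) ≤ p b := fun hab =>
    L.strictMono_p.monotone (by omega)
  have fin : ∀ c : ℝ, (h (j + 1) + m' * (2 * Real.pi) ≤ x' ∧ x' ≤ c + m' * (2 * Real.pi)) →
      ∃ m : ℤ, h (j + 1) ≤ x + m * (2 * Real.pi) ∧ x + m * (2 * Real.pi) ≤ c := by
    intro c hc
    refine ⟨m - m', ?_, ?_⟩ <;> push_cast <;> linarith
  have c2 := L.q_lt_p j
  have c3 := L.q_lt_p k
  have c4 := L.p_lt_q j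
  have c5 := L.p_lt_q k
  constructor
  · intro y1 y2
    rcases lt_trichotomy j k with hjk | rfl | hjk
    · have := c1 hjk
      rcases H with H | H <;> linarith
    · rcases H with H | H
      · exact fin _ ⟨H.1, H.2.1⟩
      · linarith
    · have := c1 hjk
      rcases H with H | H <;> linarith
  · intro y1 y2
    rcases lt_trichotomy j k with hjk | rfl | hjk
    · have := c1 hjk
      rcases H with H | H <;> linarith
    · rcases H with H | H
      · linarith
      · exact fin _ ⟨H.1, H.2.1⟩
    · have := c1 hjk
      rcases H with H | H <;> linarith

theorem interior_domainA_subset (hg : 2 ≤ g) (L : IsDomainLift S G p q d g' h) :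
    interior (S.domainA arcIcc G) ⊆ S.domainA arcIco G := by
  have hN := natCast_mod_eq hg
  rintro ⟨u, w⟩ huw
  obtain ⟨k₀, x, y, rfl, rfl, H₀⟩ :=
    (mem_domainA_iff isArcKind_arcIcc hg L).1 (interior_subset huw)
  obtain ⟨ε, hε, hball⟩ : ∃ ε > 0, ∀ s t : ℝ, |s| < ε → |t| < ε →
      (Circle.exp (x + s), Circle.exp (y + t)) ∈ S.domainA arcIcc G := by
    have hc : Continuous fun v : ℝ × ℝ => (Circle.exp (x + v.1), Circle.exp (y + v.2)) := by
      fun_prop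
    have hn : (fun v : ℝ × ℝ => (Circle.exp (x + v.1), Circle.exp (y + v.2))) ⁻¹'
        interior (S.domainA arcIcc G) ∈ nhds ((0 : ℝ), (0 : ℝ)) :=
      (isOpen_interior.preimage hc).mem_nhds (by simpa using huw)
    obtain ⟨ε, hε, hb⟩ := Metric.mem_nhds_iff.1 hn
    refine ⟨ε, hε, fun s t hs ht => ?_⟩
    have hst : (s, t) ∈ Metric.ball ((0 : ℝ), (0 : ℝ)) ε := by
      rw [Metric.mem_ball, Prod.dist_eq, Real.dist_eq, Real.dist_eq, sub_zero, sub_zero]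
      exact max_lt hs ht
    exact interior_subset (hb hst)
  -- a point of the closed fibres nearby lies in the half-open arc
  have key : ∀ a b c : ℝ, b < a + 2 * Real.pi → y < c →
      (∀ s t, 0 < t → y + t < c →
        (Circle.exp (x + s), Circle.exp (y + t)) ∈ S.domainA arcIcc G →
        ∃ m : ℤ, a ≤ x + s + m * (2 * Real.pi) ∧ x + s + m * (2 * Real.pi) ≤ b) →
      ∃ m : ℤ, a ≤ x + m * (2 * Real.pi) ∧ x + m * (2 * Real.pi) < b := by
    intro a b c hba hyc hfib
    obtain ⟨δ, hδ0, hδ⟩ := exists_between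
      (lt_min hε (lt_min (sub_pos.2 hyc) (sub_pos.2 hba)))
    rw [lt_min_iff, lt_min_iff] at hδ
    obtain ⟨d1, d2, d3⟩ := hδ
    have habs : |δ| < ε := by rwa [abs_of_pos hδ0]
    obtain ⟨m, m1, m2⟩ := hfib 0 δ hδ0 (by linarith) (hball 0 δ (by simpa using hε) habs)
    -- The move by `δ` in the second coordinate leaves the lines where two strips meet, so a single
    -- fibre is relevant. If `x` were its right end, moving `x` by `δ` would leave it: `δ` is too
    -- small to reach its next lift.
    obtain ⟨l, l1, l2⟩ := hfib δ δ hδ0 (by linarith) (hball δ δ habs habs)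
    rw [add_zero] at m1 m2
    refine ⟨m, m1, lt_of_le_of_ne m2 fun heq => ?_⟩
    have hpi := Real.pi_pos
    rcases lt_or_ge l m with hlm | hlm
    · have : (l : ℝ) + 1 ≤ m := by exact_mod_cast hlm
      nlinarith
    · have : (m : ℝ) ≤ l := by exact_mod_cast hlm
      nlinarith
  have hy0 : p k₀ ≤ y ∧ y < p (k₀ + 2) := by
    have c1 := L.p_lt_q k₀
    have c2 := L.q_lt_p k₀
    have c3 : p (k₀ + 1) < p (k₀ + 2) := L.strictMono_p (by omega)
    rcases H₀ with H | H <;> constructor <;> linarith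
  obtain ⟨k, -, -, k1, k2⟩ := exists_between_of_le (by omega) hy0.1 hy0.2
  have b1 : g' (k - 2 + (8 * g - 4 : ℕ)) < h (k + 1 + (8 * g - 4 : ℕ)) :=
    L.g_lt_h_of_le (by omega)
  have b2 : g' (k - 1 + (8 * g - 4 : ℕ)) < h (k + 1 + (8 * g - 4 : ℕ)) :=
    L.g_lt_h_of_le (by omega)
  rw [L.lift_H.add] at b1 b2
  rw [mem_domainA_iff isArcKind_arcIco hg L]
  have hexp : ∀ m : ℤ, Circle.exp (x + m * (2 * Real.pi)) = Circle.exp x := fun m =>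
    Circle.exp_eq_exp.2 ⟨m, rfl⟩
  rcases lt_or_ge y (q k) with hk | hk
  · obtain ⟨m, m1, m2⟩ := key _ _ _ b1 hk fun s t ht htc hm =>
      (exists_lift_of_mem_domainA hg L hm k).1 (by linarith) htc
    exact ⟨k, _, y, hexp m, rfl, Or.inl ⟨m1, m2, k1, hk⟩⟩
  · obtain ⟨m, m1, m2⟩ := key _ _ _ b2 k2 fun s t ht htc hm =>
      (exists_lift_of_mem_domainA hg L hm k).2 (by linarith) htc
    exact ⟨k, _, y, hexp m, rfl, Or.inr ⟨m1, m2, hk, k2⟩⟩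

end FundamentalPolygon

/-! ### Inclusions between arcs -/

theorem IsArcKind.subset {arc : Circle → Circle → Set Circle} {r : ℝ → ℝ → Prop}
    (K : IsArcKind arc r) {n : ℕ} {X Y Z W : ZMod n → Circle} {x y z w : ℤ → ℝ}
    (hX : IsCircleLift X x) (hY : IsCircleLift Y y) (hZ : IsCircleLift Z z)
    (hW : IsCircleLift W w) (a b c d : ℤ) {ia ib ic id : ZMod n} (ha : (a : ZMod n) = ia)
    (hb : (b : ZMod n) = ib) (hc : (c : ZMod n) = ic) (hd : (d : ZMod n) = id)
    (h1 : x a ≤ y b) (h2 : y b ≤ z c) (h3 : z c ≤ w d) (h4 : w d < x (a + n)) :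
    arc (Y ib) (Z ic) ⊆ arc (X ia) (W id) := by
  rw [hX.add] at h4
  intro v hv
  rw [FundamentalPolygon.mem_arc_iff K hY hZ hb hc h2 (by linarith)] at hv
  rw [FundamentalPolygon.mem_arc_iff K hX hW ha hd (by linarith) h4]
  obtain ⟨t, ht, t1, t2⟩ := hv
  exact ⟨t, ht, h1.trans t1, K.trans t2 h3⟩

theorem mem_arcIcc_or_of_mem {a b c x : Circle} (hb : b ∈ arcIcc a c) (hx : x ∈ arcIcc a c) :
    x ∈ arcIcc a b ∨ x ∈ arcIcc b c := by
  obtain ⟨a, rfl, -⟩ := exists_exp_eq_Ico 0 a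
  obtain ⟨c, rfl, c1, c2⟩ := exists_exp_eq_Ico a c
  rw [mem_arcIcc_exp c1 c2] at hb hx
  obtain ⟨b, rfl, b1, b2⟩ := hb
  obtain ⟨x, rfl, x1, x2⟩ := hx
  rcases le_total x b with h | h
  · exact Or.inl (exp_mem_arcIcc x1 h (by linarith))
  · exact Or.inr (exp_mem_arcIcc h x2 (by linarith))

namespace FundamentalPolygon

variable {g : ℕ} {S : FundamentalPolygon g} {A B G : ZMod (8 * g - 4) → Circle}
  {p q d g' h : ℤ → ℝ}

/-! ### The arcs of a parameter choice -/

theorem IsParameterChoice.exists_lift (hB : S.IsParameterChoice B) (hg : 2 ≤ g)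
    (L : S.IsEndpointLift p q) : ∃ b, IsCircleLift B b ∧ (∀ k, p k ≤ b k) ∧ ∀ k, b k ≤ q k := by
  have hN := natCast_mod_eq hg
  refine L.P.exists_between L.Q (fun k => (L.p_lt_q k).le) (fun k => ?_) (fun k => hB k)
  rw [← L.P.add]
  exact L.q_lt_p_of_lt (by omega)

theorem strictMono_of_between (L : S.IsEndpointLift p q) {b : ℤ → ℝ} (b1 : ∀ k, p k ≤ b k)
    (b2 : ∀ k, b k ≤ q k) : StrictMono b :=
  strictMono_int_of_lt_succ fun k => (b2 k).trans_lt ((L.q_lt_p k).trans_le (b1 _))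

theorem IsParameterChoice.existsUnique_arc (hB : S.IsParameterChoice B) (hg : 2 ≤ g)
    (x : Circle) : ∃! i, x ∈ arcIco (B i) (B (i + 1)) := by
  have hN := natCast_mod_eq hg
  obtain ⟨p, q, L⟩ := S.exists_isEndpointLift hg
  obtain ⟨b, hb, b1, b2⟩ := hB.exists_lift hg L
  have mb := strictMono_of_between L b1 b2
  have mem : ∀ k : ℤ, x ∈ arcIco (B k) (B ((k : ZMod (8 * g - 4)) + 1)) ↔
      ∃ y, Circle.exp y = x ∧ b k ≤ y ∧ y < b (k + 1) := fun k => by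
    refine mem_arc_iff isArcKind_arcIco hb hb rfl (by push_cast; rfl) (mb (by omega)).le ?_
    rw [← hb.add]
    exact mb (by omega)
  obtain ⟨y, hy, y1, y2⟩ := exists_exp_eq_Ico (b 0) x
  rw [← hb.add] at y2
  obtain ⟨k, -, -, k1, k2⟩ := exists_between_of_le (by omega) y1 y2
  refine ⟨k, (mem k).2 ⟨y, hy, k1, k2⟩, fun i hi => ?_⟩
  obtain ⟨l, rfl⟩ := ZMod.intCast_surjective i
  obtain ⟨z, hz, z1, z2⟩ := (mem l).1 hi
  obtain ⟨m, hm⟩ := Circle.exp_eq_exp.1 (hz.trans hy.symm)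
  have e1 := hb.add_mul k m
  have e2 := hb.add_mul (k + 1) m
  have h1 := mb.lt_iff_lt.1 (show b l < b (k + 1 + (8 * g - 4 : ℕ) * m) by linarith)
  have h2 := mb.lt_iff_lt.1 (show b (k + (8 * g - 4 : ℕ) * m) < b (l + 1) by linarith)
  exact intCast_eq_of_sub m (by omega)

theorem IsParameterChoice.arcIndex_mem (hB : S.IsParameterChoice B) (hg : 2 ≤ g) (x : Circle) :
    x ∈ arcIco (B (arcIndex B x)) (B (arcIndex B x + 1)) := by
  have hx := (hB.existsUnique_arc hg x).exists
  unfold arcIndex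
  rw [dif_pos hx]
  exact hx.choose_spec

theorem IsParameterChoice.arcIndex_eq (hB : S.IsParameterChoice B) (hg : 2 ≤ g) {x : Circle}
    {i : ZMod (8 * g - 4)} (hx : x ∈ arcIco (B i) (B (i + 1))) : arcIndex B x = i :=
  (hB.existsUnique_arc hg x).unique (hB.arcIndex_mem hg x) hx

theorem IsParameterChoice.left_mem (hB : S.IsParameterChoice B) (hg : 2 ≤ g)
    (i : ZMod (8 * g - 4)) : B i ∈ arcIco (B i) (B (i + 1)) := by
  have hN := natCast_mod_eq hg
  obtain ⟨p, q, L⟩ := S.exists_isEndpointLift hg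
  obtain ⟨b, hb, b1, b2⟩ := hB.exists_lift hg L
  have mb := strictMono_of_between L b1 b2
  obtain ⟨k, rfl⟩ := ZMod.intCast_surjective i
  refine left_mem_arcIco ?_
  rw [← hb.exp, ← hb.exp_eq (k := k + 1) (by push_cast; rfl)]
  refine exp_ne_exp (mb (by omega)) ?_
  rw [← hb.add]
  exact mb (by omega)

theorem IsExtremal.isParameterChoice (hA : S.IsExtremal A) : S.IsParameterChoice A := fun i => by
  rcases hA i with hi | hi <;> rw [hi]
  · exact left_mem_arcIcc _ _
  · exact right_mem_arcIcc _ _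

theorem arc_Q_P_subset (hg : 2 ≤ g) (hB : S.IsParameterChoice B) (i : ZMod (8 * g - 4)) :
    arcIco (S.Q i) (S.P (i + 1)) ⊆ arcIco (B i) (B (i + 1)) := by
  have hN := natCast_mod_eq hg
  obtain ⟨p, q, L⟩ := S.exists_isEndpointLift hg
  obtain ⟨b, hb, b1, b2⟩ := hB.exists_lift hg L
  obtain ⟨k, rfl⟩ := ZMod.intCast_surjective i
  exact isArcKind_arcIco.subset hb L.Q L.P hb k k (k + 1) (k + 1) rfl rfl (by push_cast; rfl)
    (by push_cast; rfl) (b2 k) (L.q_lt_p k).le (b1 _)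
    (strictMono_of_between L b1 b2 (by omega))

theorem arc_P_Q_subset_of_left (hg : 2 ≤ g) (hB : S.IsParameterChoice B) {i : ZMod (8 * g - 4)}
    (hi : B i = S.P i) : arcIco (S.P i) (S.Q i) ⊆ arcIco (B i) (B (i + 1)) := by
  have hN := natCast_mod_eq hg
  obtain ⟨p, q, L⟩ := S.exists_isEndpointLift hg
  obtain ⟨b, hb, b1, b2⟩ := hB.exists_lift hg L
  obtain ⟨k, rfl⟩ := ZMod.intCast_surjective i
  rw [hi]
  exact isArcKind_arcIco.subset L.P L.P L.Q hb k k k (k + 1) rfl rfl rfl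
    (by push_cast; rfl) le_rfl (L.p_lt_q k).le ((L.q_lt_p k).le.trans (b1 _))
    ((b2 _).trans_lt (L.q_lt_p_of_lt (by omega)))

theorem arc_P_Q_subset_of_right (hg : 2 ≤ g) (hB : S.IsParameterChoice B) {i : ZMod (8 * g - 4)}
    (hi : B (i + 1) = S.Q (i + 1)) :
    arcIco (S.P (i + 1)) (S.Q (i + 1)) ⊆ arcIco (B i) (B (i + 1)) := by
  have hN := natCast_mod_eq hg
  obtain ⟨p, q, L⟩ := S.exists_isEndpointLift hg
  obtain ⟨b, hb, b1, b2⟩ := hB.exists_lift hg L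
  obtain ⟨k, rfl⟩ := ZMod.intCast_surjective i
  rw [hi]
  exact isArcKind_arcIco.subset hb L.P L.Q L.Q k (k + 1) (k + 1) (k + 1) rfl (by push_cast; rfl)
    (by push_cast; rfl) (by push_cast; rfl) ((b2 k).trans (L.q_lt_p k).le) (L.p_lt_q _).le le_rfl
    ((L.q_lt_p_of_lt (by omega)).trans_le (b1 _))

/-! ### Rows of `Ω_A` and columns of `Ω_D` -/

/-- The part of `Ω_A` over the arc `[A i, A (i + 1))`. -/
def rowA (S : FundamentalPolygon g) (arc : Circle → Circle → Set Circle)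
    (A G : ZMod (8 * g - 4) → Circle) (i : ZMod (8 * g - 4)) : Set (Circle × Circle) :=
  (arc (S.cornerH G (i + 1)) (G (i - 1)) ×ˢ arc (S.Q i) (S.P (i + 1))) ∪
  {x | A i = S.P i ∧ x ∈ arc (S.cornerH G (i + 1)) (G (i - 2)) ×ˢ arc (S.P i) (S.Q i)} ∪
  {x | A (i + 1) = S.Q (i + 1) ∧
    x ∈ arc (S.cornerH G (i + 2)) (G (i - 1)) ×ˢ arc (S.P (i + 1)) (S.Q (i + 1))}

/-- The part of `Ω_D` over the arc `[D i, D (i + 1))`. -/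
def columnD (S : FundamentalPolygon g) (arc : Circle → Circle → Set Circle)
    (G : ZMod (8 * g - 4) → Circle) (i : ZMod (8 * g - 4)) : Set (Circle × Circle) :=
  (arc (S.Q (i + 2)) (S.P (i - 1)) ×ˢ
    arc (S.dualParameter G i) (S.dualParameter G (i + 1))) ∪
  (arc (S.P (i - 1)) (S.P i) ×ˢ arc (S.cornerH G i) (S.dualParameter G (i + 1))) ∪
  (arc (S.Q (i + 1)) (S.Q (i + 2)) ×ˢ arc (S.dualParameter G i) (G i))

variable {arc : Circle → Circle → Set Circle} {r : ℝ → ℝ → Prop} {u w : Circle}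

theorem mem_domainD_iff_column {x : Circle × Circle} :
    x ∈ S.domainD arc G ↔ ∃ i, x ∈ S.columnD arc G i := Set.mem_iUnion

theorem mem_domainA_of_left {i : ZMod (8 * g - 4)}
    (hx : (u, w) ∈ arc (S.cornerH G (i + 1)) (G (i - 2)) ×ˢ arc (S.P i) (S.Q i)) :
    (u, w) ∈ S.domainA arc G :=
  Set.mem_iUnion.2 ⟨i, Or.inl hx⟩

theorem mem_domainA_of_right {i : ZMod (8 * g - 4)}
    (hx : (u, w) ∈ arc (S.cornerH G (i + 1)) (G (i - 1)) ×ˢ arc (S.Q i) (S.P (i + 1))) :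
    (u, w) ∈ S.domainA arc G :=
  Set.mem_iUnion.2 ⟨i, Or.inr hx⟩

theorem mem_domainA_of_mem_rowA {i : ZMod (8 * g - 4)} (hx : (u, w) ∈ S.rowA arc A G i) :
    (u, w) ∈ S.domainA arc G := by
  rcases hx with (hx | ⟨-, hx⟩) | ⟨-, hx⟩
  · exact mem_domainA_of_right hx
  · exact mem_domainA_of_left hx
  · refine mem_domainA_of_left (i := i + 1) ?_
    rwa [show i + 1 + 1 = i + 2 by ring, show i + 1 - 2 = i - 1 by ring]

theorem mem_arc_of_mem_columnD (K : IsArcKind arc r) (hg : 2 ≤ g)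
    (L : IsDomainLift S G p q d g' h) {i : ZMod (8 * g - 4)}
    (hx : (w, u) ∈ S.columnD arc G i) :
    u ∈ arc (S.dualParameter G i) (S.dualParameter G (i + 1)) := by
  have hN := natCast_mod_eq hg
  obtain ⟨k, rfl⟩ := ZMod.intCast_surjective i
  have md := strictMono_of_between L.toIsEndpointLift L.p_le_d L.d_le_q
  rcases hx with (⟨-, hu⟩ | ⟨-, hu⟩) | ⟨-, hu⟩
  · exact hu
  · exact K.subset L.lift_D L.lift_H L.lift_D L.lift_D k k (k + 1) (k + 1) rfl rfl
      (by push_cast; rfl) (by push_cast; rfl) (L.d_le_h_of_le le_rfl) (L.h_le_d k) le_rfl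
      (md (by omega)) hu
  · exact K.subset L.lift_D L.lift_D L.lift_G L.lift_D k k k (k + 1) rfl rfl rfl
      (by push_cast; rfl) le_rfl (L.d_le_g k) ((L.g_le_p k).trans (L.p_le_d _))
      (md (by omega)) hu

theorem mem_arcIco_of_mem_rowA (hg : 2 ≤ g) (hA : S.IsExtremal A) {i : ZMod (8 * g - 4)}
    (hx : (u, w) ∈ S.rowA arcIco A G i) : w ∈ arcIco (A i) (A (i + 1)) := by
  rcases hx with (⟨-, hw⟩ | ⟨hi, -, hw⟩) | ⟨hi, -, hw⟩
  · exact arc_Q_P_subset hg hA.isParameterChoice i hw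
  · exact arc_P_Q_subset_of_left hg hA.isParameterChoice hi hw
  · exact arc_P_Q_subset_of_right hg hA.isParameterChoice hi hw

/-- The central computation: the at most three rectangles of a row are carried to rectangles of the
column `σ i`, corner by corner. -/
theorem map_mem_columnD (K : IsArcKind arc r) (hg : 2 ≤ g) (hG : S.IsSystemSolution A G)
    {i : ZMod (8 * g - 4)} (hx : (u, w) ∈ S.rowA arc A G i) :
    (bdry (S.T i) w, bdry (S.T i) u) ∈ S.columnD arc G (sidePairing g i) := by
  rcases hx with (⟨hu, hw⟩ | ⟨hi, hu, hw⟩) | ⟨hi, hu, hw⟩ <;>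
    dsimp only at hu hw <;> rw [← K.bdry_mem (S.T i)] at hu hw
  · rw [map_cornerH hg, map_G_sub_one hg] at hu
    rw [S.map_Q hg, S.map_P_add_one hg] at hw
    exact Or.inl (Or.inl ⟨hw, hu⟩)
  · rw [map_cornerH hg, ← hG.eq_of_P i hi] at hu
    rw [S.map_P hg, S.map_Q hg] at hw
    exact Or.inr ⟨hw, hu⟩
  · rw [hG.map_cornerH_add_two hg hi, map_G_sub_one hg] at hu
    rw [S.map_P_add_one hg, S.map_Q_add_one hg] at hw
    exact Or.inl (Or.inr ⟨hw, hu⟩)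

/-- The converse of `map_mem_columnD`. A column rectangle without a partner has a degenerate side:
the one at `D (s + 1)` is excluded by `hu`, the one at `D s` is the second alternative, empty for
half-open arcs. -/
theorem map_mem_rowA (K : IsArcKind arc r) (hg : 2 ≤ g) (hA : S.IsExtremal A)
    (hG : S.IsSystemSolution A G) (hK : ∀ a b, arc a b ⊆ arcIcc a b) {i : ZMod (8 * g - 4)}
    (hx : (w, u) ∈ S.columnD arc G (sidePairing g i))
    (hu : u ∈ arcIco (S.dualParameter G (sidePairing g i))
      (S.dualParameter G (sidePairing g i + 1))) :
    (bdry (S.T (sidePairing g i)) u, bdry (S.T (sidePairing g i)) w) ∈ S.rowA arc A G i ∨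
      (u ∈ arc (S.dualParameter G (sidePairing g i)) (S.dualParameter G (sidePairing g i)) ∧
        w ∈ arc (S.Q (sidePairing g i + 1)) (S.Q (sidePairing g i + 2))) := by
  have cancel : ∀ {a b x : Circle}, x ∈ arc (bdry (S.T i) a) (bdry (S.T i) b) →
      bdry (S.T (sidePairing g i)) x ∈ arc a b := fun hx => by
    rw [← K.bdry_mem (S.T (sidePairing g i)), S.bdry_sidePairing_bdry,
      S.bdry_sidePairing_bdry] at hx
    exact hx
  rcases hx with (⟨hw, hu'⟩ | ⟨hw, hu'⟩) | ⟨hw, hu'⟩ <;> dsimp only at hu' hw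
  · rw [← map_cornerH hg, ← map_G_sub_one hg] at hu'
    rw [← S.map_Q hg, ← S.map_P_add_one hg] at hw
    exact Or.inl (Or.inl (Or.inl ⟨cancel hu', cancel hw⟩))
  · rcases hA (i + 1) with hi | hi
    · rw [hG.cornerH_eq hg hi] at hu'
      have h1 := hK _ _ hu'
      rw [mem_arcIcc_iff, arcIco_self] at h1
      rw [h1.resolve_left id] at hu
      exact absurd hu (right_notMem_arcIco _ _)
    · rw [← hG.map_cornerH_add_two hg hi, ← map_G_sub_one hg] at hu'
      rw [← S.map_P_add_one hg, ← S.map_Q_add_one hg] at hw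
      exact Or.inl (Or.inr ⟨hi, cancel hu', cancel hw⟩)
  · rcases hA i with hi | hi
    · rw [← map_cornerH hg, hG.eq_of_P i hi] at hu'
      rw [← S.map_P hg, ← S.map_Q hg] at hw
      exact Or.inl (Or.inl (Or.inr ⟨hi, cancel hu', cancel hw⟩))
    · rw [hG.eq_dualParameter hg hi] at hu'
      exact Or.inr ⟨hu', hw⟩

/-! ### The half-open domains -/

theorem mem_rowA_arcIndex (hg : 2 ≤ g) (hA : S.IsExtremal A)
    (hx : (u, w) ∈ S.domainA arcIco G) : (u, w) ∈ S.rowA arcIco A G (arcIndex A w) := by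
  have hA' := hA.isParameterChoice
  suffices hs : ∃ i, (u, w) ∈ S.rowA arcIco A G i by
    obtain ⟨i, hi⟩ := hs
    rwa [hA'.arcIndex_eq hg (mem_arcIco_of_mem_rowA hg hA hi)]
  obtain ⟨j, hj | hj⟩ := Set.mem_iUnion.1 hx
  · rcases hA j with h1 | h1
    · exact ⟨j, Or.inl (Or.inr ⟨h1, hj⟩)⟩
    · refine ⟨j - 1, Or.inr ⟨by rwa [sub_add_cancel], ?_⟩⟩
      rwa [sub_add_cancel, show j - 1 + 2 = j + 1 by ring, show j - 1 - 1 = j - 2 by ring]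
  · exact ⟨j, Or.inl (Or.inl hj)⟩

theorem extMap_mem_domainA_core (hg : 2 ≤ g) (hA : S.IsExtremal A) (hG : S.IsSystemSolution A G)
    {x : Circle × Circle} (hx : x ∈ S.domainA arcIco G) :
    (S.extMap A x).swap ∈ S.columnD arcIco G (sidePairing g (arcIndex A x.2)) :=
  map_mem_columnD isArcKind_arcIco hg hG (mem_rowA_arcIndex hg hA hx)

/-- The assumption says that `F_D` reads off the index `σ(i)` at the image; it then applies `T (σ
i)`, the inverse of `T i`. -/
theorem extMap_dual_swap_extMap (hg : 2 ≤ g) (hG : S.IsSystemSolution A G)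
    {x : Circle × Circle}
    (hx : (S.extMap A x).1 ∈ arcIco (S.dualParameter G (sidePairing g (arcIndex A x.2)))
      (S.dualParameter G (sidePairing g (arcIndex A x.2) + 1))) :
    S.extMap (S.dualParameter G) (S.extMap A x).swap = x.swap := by
  have hD : S.IsParameterChoice (S.dualParameter G) := hG.dualParameter_mem hg
  have e := hD.arcIndex_eq hg hx
  unfold extMap at e ⊢
  dsimp only [Prod.swap] at e ⊢
  rw [e, S.bdry_sidePairing_bdry, S.bdry_sidePairing_bdry]

theorem extMap_swap_extMap_dual (hg : 2 ≤ g) (hA : S.IsExtremal A)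
    (hG : S.IsSystemSolution A G) {x : Circle × Circle} (hx : x ∈ S.domainD arcIco G) :
    (S.extMap (S.dualParameter G) x).swap ∈ S.domainA arcIco G ∧
      S.extMap A (S.extMap (S.dualParameter G) x).swap = x.swap := by
  have hD : S.IsParameterChoice (S.dualParameter G) := hG.dualParameter_mem hg
  obtain ⟨p, q, d, g', h, L⟩ := hG.exists_isDomainLift hg hA
  obtain ⟨w, u⟩ := x
  obtain ⟨s, hs⟩ := mem_domainD_iff_column.1 hx
  have hu := mem_arc_of_mem_columnD isArcKind_arcIco hg L hs
  have e := hD.arcIndex_eq hg hu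
  obtain ⟨i, rfl⟩ : ∃ i, s = sidePairing g i := ⟨_, (sidePairing_sidePairing hg s).symm⟩
  rcases map_mem_rowA isArcKind_arcIco hg hA hG arcIco_subset_arcIcc hs hu with h1 | ⟨h1, -⟩
  · have e' := hA.isParameterChoice.arcIndex_eq hg (mem_arcIco_of_mem_rowA hg hA h1)
    unfold extMap
    dsimp only [Prod.swap]
    rw [e, e', S.bdry_bdry_sidePairing hg, S.bdry_bdry_sidePairing hg]
    exact ⟨mem_domainA_of_mem_rowA h1, rfl⟩
  · rw [arcIco_self] at h1
    exact h1.elim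

/-! ### The closed domains -/

theorem arc_cornerH_G_subset (hg : 2 ≤ g) (L : IsDomainLift S G p q d g' h)
    (i : ZMod (8 * g - 4)) : arcIcc (S.cornerH G (i + 1)) (G (i - 2)) ⊆
      arcIcc (S.cornerH G (i + 1)) (G (i - 1)) := by
  have hN := natCast_mod_eq hg
  obtain ⟨k, rfl⟩ := ZMod.intCast_surjective i
  refine isArcKind_arcIcc.subset L.lift_H L.lift_H L.lift_G L.lift_G (k + 1) (k + 1)
    (k - 2 + (8 * g - 4 : ℕ)) (k - 1 + (8 * g - 4 : ℕ)) (by push_cast; rfl) (by push_cast; rfl)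
    (by push_cast; simp) (by push_cast; simp) le_rfl (L.h_lt_g_of_lt (by omega)).le ?_
    (L.g_lt_h_of_le (by omega))
  exact (L.g_le_p _).trans ((L.p_le_d _).trans (L.d_le_g_of_le (by omega)))

/-- For closed arcs a point on the top edge of a strip may be assigned the index of the next strip.
At `Q j` this does no harm because the fibre widens there; at `P j` with `A j = P j` the fibre of
the next strip is smaller, which gives the exceptional case. -/
theorem mem_rowA_arcIndex_of_closed (hg : 2 ≤ g) (hA : S.IsExtremal A)
    (L : IsDomainLift S G p q d g' h) (hx : (u, w) ∈ S.domainA arcIcc G) :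
    (u, w) ∈ S.rowA arcIcc A G (arcIndex A w) ∨
      (w = A (arcIndex A w) ∧ w = S.P (arcIndex A w) ∧
        u ∈ arcIcc (S.cornerH G (arcIndex A w)) (G (arcIndex A w - 2))) := by
  have hA' := hA.isParameterChoice
  obtain ⟨j, ⟨hu, hw⟩ | ⟨hu, hw⟩⟩ := Set.mem_iUnion.1 hx <;> dsimp only at hu hw
  · rcases mem_arcIcc_iff.1 hw with hw' | rfl
    · rcases hA j with h1 | h1
      · left
        rw [hA'.arcIndex_eq hg (arc_P_Q_subset_of_left hg hA' h1 hw')]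
        exact Or.inl (Or.inr ⟨h1, hu, hw⟩)
      · left
        obtain ⟨j, rfl⟩ : ∃ i, j = i + 1 := ⟨j - 1, by ring⟩
        rw [hA'.arcIndex_eq hg (arc_P_Q_subset_of_right hg hA' h1 hw')]
        refine Or.inr ⟨h1, ?_, hw⟩
        rwa [show j + 1 + 1 = j + 2 by ring, show j + 1 - 2 = j - 1 by ring] at hu
    · left
      have h2 : S.Q j ∈ arcIco (S.Q j) (S.P (j + 1)) := left_mem_arcIco (by
        obtain ⟨k, rfl⟩ := ZMod.intCast_surjective j
        rw [← L.Q.exp, ← L.P.exp_eq (k := k + 1) (by push_cast; rfl)]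
        refine exp_ne_exp (L.q_lt_p k) ?_
        rw [← L.Q.add]
        have hN := natCast_mod_eq hg
        exact L.p_lt_q_of_le (by omega))
      rw [hA'.arcIndex_eq hg (arc_Q_P_subset hg hA' j h2)]
      exact Or.inl (Or.inl ⟨arc_cornerH_G_subset hg L j hu, left_mem_arcIcc _ _⟩)
  · rcases mem_arcIcc_iff.1 hw with hw' | rfl
    · left
      rw [hA'.arcIndex_eq hg (arc_Q_P_subset hg hA' j hw')]
      exact Or.inl (Or.inl ⟨hu, hw⟩)
    · rcases hA (j + 1) with h1 | h1
      · right
        have h2 := hA'.left_mem hg (j + 1)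
        rw [← h1, hA'.arcIndex_eq hg h2]
        refine ⟨rfl, h1, ?_⟩
        rwa [show j + 1 - 2 = j - 1 by ring]
      · left
        have h2 := left_mem_arcIco (S.P_ne_Q hg (j + 1))
        rw [hA'.arcIndex_eq hg (arc_P_Q_subset_of_right hg hA' h1 h2)]
        exact Or.inl (Or.inl ⟨hu, hw⟩)

theorem extMap_mem_domainA (hg : 2 ≤ g) (hA : S.IsExtremal A) (hG : S.IsSystemSolution A G)
    {x : Circle × Circle} (hx : x ∈ S.domainA arcIcc G) : S.extMap A x ∈ S.domainA arcIcc G := by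
  have hN := natCast_mod_eq hg
  obtain ⟨p, q, d, g', h, L⟩ := hG.exists_isDomainLift hg hA
  obtain ⟨u, w⟩ := x
  rcases mem_rowA_arcIndex_of_closed hg hA L hx with h1 | ⟨h1, h2, h3⟩
  · exact (mem_domainA_iff_mem_domainD isArcKind_arcIcc hg L).2
      (mem_domainD_iff_column.2 ⟨_, map_mem_columnD isArcKind_arcIcc hg hG h1⟩)
  · unfold extMap
    dsimp only
    have hi : A (arcIndex A w) = S.P (arcIndex A w) := h1.symm.trans h2
    generalize arcIndex A w = i at *
    subst h2
    -- In the exceptional case the second coordinate goes to `Q (s + 1)`, with `s = σ i`. The first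
    -- coordinate lies in an arc ending at `G s`, and `c1` and `c2` place the start of that arc
    -- after `H (s + 2)`.
    rw [← bdry_mem_arcIcc (S.T i), map_cornerH_self hg, ← hG.eq_of_P i hi] at h3
    rw [S.map_P hg]
    generalize sidePairing g i = s at *
    refine mem_domainA_of_right (i := s + 1) ⟨?_, left_mem_arcIcc _ _⟩
    dsimp only
    rw [show s + 1 - 1 = s by ring]
    have c1 : S.P s ∈ arcIcc (S.cornerH G (s + 1 + 1)) (G s) := by
      obtain ⟨k, rfl⟩ := ZMod.intCast_surjective s
      exact isArcKind_arcIcc.subset L.lift_H L.P L.P L.lift_G (k + 1 + 1)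
        (k + (8 * g - 4 : ℕ)) (k + (8 * g - 4 : ℕ)) (k + (8 * g - 4 : ℕ)) (by push_cast; rfl)
        (by push_cast; simp) (by push_cast; simp) (by push_cast; simp)
        ((L.h_le_q _).trans (L.q_lt_p_of_lt (by omega)).le) le_rfl
        ((L.p_le_d _).trans (L.d_le_g _)) (L.g_lt_h_of_le (by omega))
        (left_mem_arcIcc (S.P k) (S.P k))
    have c2 : bdry (S.T (sidePairing g (s + 1))) (G (sidePairing g (s + 1))) ∈
        arcIcc (S.cornerH G (s + 1 + 1)) (S.P s) := by
      have c3 := S.map_P_add_one hg (sidePairing g (s + 1))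
      rw [sidePairing_sidePairing hg, add_sub_cancel_right] at c3
      rw [cornerH_add_one hg, ← c3, bdry_mem_arcIcc]
      generalize sidePairing g (s + 1) = n
      obtain ⟨k, rfl⟩ := ZMod.intCast_surjective n
      exact isArcKind_arcIcc.subset L.lift_D L.lift_G L.lift_G L.P k k k (k + 1) rfl rfl rfl
        (by push_cast; rfl) (L.d_le_g k) le_rfl (L.g_le_p k)
        ((L.strictMono_p (by omega)).trans_le (L.p_le_d _)) (left_mem_arcIcc _ _)
    exact (mem_arcIcc_of_chain (mem_arcIcc_trans c1 c2) (right_mem_arcIcc _ _) h3).1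

/-- The first coordinate becomes `H (i + 1)`, the common left edge of the two rectangles of index
`i`, and the second one stays in their joint range `[P i, P (i + 1)]`. -/
theorem extMap_mem_of_eq_dualParameter (hg : 2 ≤ g) (L : IsDomainLift S G p q d g' h)
    (i : ZMod (8 * g - 4))
    (hw : w ∈ arcIcc (S.Q (sidePairing g i + 1)) (S.P (sidePairing g i - 1))) :
    (bdry (S.T (sidePairing g i)) (S.dualParameter G (sidePairing g i)),
      bdry (S.T (sidePairing g i)) w) ∈ S.domainA arcIcc G := by
  have hN := natCast_mod_eq hg
  rw [← bdry_mem_arcIcc (S.T (sidePairing g i)), S.map_Q_add_one hg, S.map_P_sub_one hg,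
    sidePairing_sidePairing hg] at hw
  rw [← cornerH_add_one hg]
  have hQ : S.Q i ∈ arcIcc (S.P i) (S.P (i + 1)) := by
    obtain ⟨k, rfl⟩ := ZMod.intCast_surjective i
    exact isArcKind_arcIcc.subset L.P L.Q L.Q L.P k k k (k + 1) rfl rfl rfl
      (by push_cast; rfl) (L.p_lt_q k).le le_rfl (L.q_lt_p k).le
      (L.strictMono_p (by omega)) (left_mem_arcIcc _ _)
  rcases mem_arcIcc_or_of_mem hQ hw with h1 | h1
  · exact mem_domainA_of_left ⟨left_mem_arcIcc _ _, h1⟩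
  · exact mem_domainA_of_right ⟨left_mem_arcIcc _ _, h1⟩

theorem extMap_dual_mem_domainD (hg : 2 ≤ g) (hA : S.IsExtremal A)
    (hG : S.IsSystemSolution A G) {x : Circle × Circle} (hx : x ∈ S.domainD arcIcc G) :
    S.extMap (S.dualParameter G) x ∈ S.domainD arcIcc G := by
  have hN := natCast_mod_eq hg
  have hD : S.IsParameterChoice (S.dualParameter G) := hG.dualParameter_mem hg
  obtain ⟨p, q, d, g', h, L⟩ := hG.exists_isDomainLift hg hA
  obtain ⟨w, u⟩ := x
  obtain ⟨s, hs⟩ := mem_domainD_iff_column.1 hx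
  unfold extMap
  dsimp only
  rcases mem_arcIcc_iff.1 (mem_arc_of_mem_columnD isArcKind_arcIcc hg L hs) with hu | rfl
  · rw [hD.arcIndex_eq hg hu, ← mem_domainA_iff_mem_domainD isArcKind_arcIcc hg L]
    obtain ⟨i, rfl⟩ : ∃ i, s = sidePairing g i := ⟨_, (sidePairing_sidePairing hg s).symm⟩
    rcases map_mem_rowA isArcKind_arcIcc hg hA hG (fun _ _ => subset_rfl) hs hu with h1 | ⟨h1, h2⟩
    · exact mem_domainA_of_mem_rowA h1
    · rw [mem_arcIcc_iff, arcIco_self] at h1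
      rw [h1.resolve_left id]
      refine extMap_mem_of_eq_dualParameter hg L i ?_
      generalize sidePairing g i = s at *
      obtain ⟨k, rfl⟩ := ZMod.intCast_surjective s
      exact isArcKind_arcIcc.subset L.Q L.Q L.Q L.P (k + 1) (k + 1) (k + 2)
        (k - 1 + (8 * g - 4 : ℕ)) (by push_cast; rfl) (by push_cast; rfl) (by push_cast; rfl)
        (by push_cast; simp) le_rfl (L.strictMono_q (by omega)).le
        (L.q_lt_p_of_lt (by omega)).le (L.p_lt_q_of_le (by omega)) h2
  -- At the right end of column `s` the map already uses `T (s + 1)`. Either the previous lemma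
  -- applies with `s + 1`, or `D (s + 1) = G s` and the image lies on the lower edge of column `i +
  -- 1`, where `i = σ (s + 1)`.
  · rw [hD.arcIndex_eq hg (hD.left_mem hg (s + 1))]
    have hor : w ∈ arcIcc (S.Q (s + 1 + 1)) (S.P (s + 1 - 1)) ∨
        (w ∈ arcIcc (S.Q (s + 1)) (S.Q (s + 1 + 1)) ∧ S.dualParameter G (s + 1) = G s) := by
      have e2 : s + 1 + 1 = s + 2 := by ring
      rw [add_sub_cancel_right, e2]
      rcases hs with (⟨hw, -⟩ | ⟨hw, -⟩) | ⟨hw, hu⟩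
      · left
        obtain ⟨k, rfl⟩ := ZMod.intCast_surjective s
        exact isArcKind_arcIcc.subset L.Q L.Q L.P L.P (k + 2) (k + 2)
          (k - 1 + (8 * g - 4 : ℕ)) (k + (8 * g - 4 : ℕ)) (by push_cast; rfl) (by push_cast; rfl)
          (by push_cast; simp) (by push_cast; simp) le_rfl (L.q_lt_p_of_lt (by omega)).le
          (L.strictMono_p (by omega)).le (L.p_lt_q_of_le (by omega)) hw
      · left
        obtain ⟨k, rfl⟩ := ZMod.intCast_surjective s
        exact isArcKind_arcIcc.subset L.Q L.P L.P L.P (k + 2) (k - 1 + (8 * g - 4 : ℕ))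
          (k + (8 * g - 4 : ℕ)) (k + (8 * g - 4 : ℕ)) (by push_cast; rfl) (by push_cast; simp)
          (by push_cast; simp) (by push_cast; simp) (L.q_lt_p_of_lt (by omega)).le
          (L.strictMono_p (by omega)).le le_rfl (L.p_lt_q_of_le (by omega)) hw
      · right
        refine ⟨hw, ?_⟩
        rcases mem_arcIcc_iff.1 hu with h1 | h1
        · refine absurd ?_ (right_notMem_arcIco (S.dualParameter G s) (S.dualParameter G (s + 1)))
          exact mem_arc_of_mem_columnD isArcKind_arcIco hg L (w := S.Q (s + 1))
            (Or.inr ⟨left_mem_arcIco (by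
              obtain ⟨k, rfl⟩ := ZMod.intCast_surjective s
              rw [← L.Q.exp_eq (k := k + 1) (by push_cast; rfl),
                ← L.Q.exp_eq (k := k + 2) (by push_cast; rfl)]
              refine exp_ne_exp (L.strictMono_q (by omega)) ?_
              rw [← L.Q.add]
              exact L.strictMono_q (by omega)), h1⟩)
        · exact h1
    rcases hor with hw | ⟨hw, hu⟩
    · rw [← mem_domainA_iff_mem_domainD isArcKind_arcIcc hg L]
      obtain ⟨i, hi⟩ : ∃ i, s + 1 = sidePairing g i := ⟨_, (sidePairing_sidePairing hg _).symm⟩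
      rw [hi] at hw ⊢
      exact extMap_mem_of_eq_dualParameter hg L i hw
    · have e := map_G_sub_one (S := S) (G := G) hg (s + 1)
      rw [add_sub_cancel_right, ← hu] at e
      rw [e]
      rw [← bdry_mem_arcIcc (S.T (s + 1)), S.map_Q hg, S.map_Q_add_one hg] at hw
      generalize sidePairing g (s + 1) = i at *
      have hQ : S.Q (i + 3) ∈ arcIcc (S.Q (i + 2)) (S.P i) := by
        obtain ⟨k, rfl⟩ := ZMod.intCast_surjective i
        exact isArcKind_arcIcc.subset L.Q L.Q L.Q L.P (k + 2) (k + 3) (k + 3)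
          (k + (8 * g - 4 : ℕ)) (by push_cast; rfl) (by push_cast; rfl) (by push_cast; rfl)
          (by push_cast; simp) (L.strictMono_q (by omega)).le le_rfl
          (L.q_lt_p_of_lt (by omega)).le (L.p_lt_q_of_le (by omega)) (left_mem_arcIcc _ _)
      refine mem_domainD_iff_column.2 ⟨i + 1, ?_⟩
      unfold columnD
      rw [add_sub_cancel_right, show i + 1 + 2 = i + 3 by ring,
        show i + 1 + 1 = i + 2 by ring]
      rcases mem_arcIcc_or_of_mem hQ hw with h1 | h1
      · exact Or.inr ⟨h1, left_mem_arcIcc _ _⟩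
      · exact Or.inl (Or.inl ⟨h1, left_mem_arcIcc _ _⟩)

/-- Off the parameter points neither the exceptional case of the closed rows nor the right end of a
column occurs, so the argument for half-open domains applies. -/
theorem extMap_mem_arcIco_of_closed (hg : 2 ≤ g) (hA : S.IsExtremal A)
    (hG : S.IsSystemSolution A G) {x : Circle × Circle} (hx : x ∈ S.domainA arcIcc G)
    (hw : x.2 ∉ Set.range A) (hu : (S.extMap A x).1 ∉ Set.range (S.dualParameter G)) :
    (S.extMap A x).1 ∈ arcIco (S.dualParameter G (sidePairing g (arcIndex A x.2)))
      (S.dualParameter G (sidePairing g (arcIndex A x.2) + 1)) := by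
  obtain ⟨p, q, d, g', h, L⟩ := hG.exists_isDomainLift hg hA
  rcases mem_rowA_arcIndex_of_closed hg hA L hx with h1 | ⟨h1, -⟩
  · refine (mem_arcIcc_iff.1 (mem_arc_of_mem_columnD isArcKind_arcIcc hg L
      (map_mem_columnD isArcKind_arcIcc hg hG h1))).resolve_right fun he => hu ?_
    exact ⟨_, he.symm⟩
  · exact absurd ⟨_, h1.symm⟩ hw

end FundamentalPolygon

/-! ### Duality -/

theorem HasFiniteRectangularStructure.image_swap {Ω : Set (Circle × Circle)}
    (hΩ : HasFiniteRectangularStructure Ω) : HasFiniteRectangularStructure (Prod.swap '' Ω) := by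
  classical
  obtain ⟨⟨R, hR, hU⟩, hd⟩ := hΩ
  refine ⟨⟨R.image Prod.swap, fun r hr => ?_, ?_⟩, ?_⟩
  · obtain ⟨r, h1, rfl⟩ := Finset.mem_image.1 hr
    exact (hR r h1).symm
  · rw [hU, Set.image_iUnion₂, Finset.set_biUnion_finset_image]
    simp only [Set.image_swap_prod, Prod.fst_swap, Prod.snd_swap]
  · rintro _ ⟨x, hx, rfl⟩
    exact (hd x hx).symm

namespace FundamentalPolygon

variable {g : ℕ} {S : FundamentalPolygon g} {A G : ZMod (8 * g - 4) → Circle}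

theorem isDual_dualParameter (hg : 2 ≤ g) (hA : S.IsExtremal A) (hG : S.IsSystemSolution A G) :
    S.IsDual A (S.dualParameter G)
      (S.domainA arcIcc G) (S.domainA arcIco G) (S.domainD arcIcc G) (S.domainD arcIco G) := by
  obtain ⟨p, q, d, g', h, L⟩ := hG.exists_isDomainLift hg hA
  have sw := image_swap_domainA isArcKind_arcIcc hg L
  have sw₀ := image_swap_domainA isArcKind_arcIco hg L
  have toD : ∀ {x : Circle × Circle}, x ∈ S.domainA arcIco G → x.swap ∈ S.domainD arcIco G :=
    fun hx => sw₀ ▸ Set.mem_image_of_mem _ hx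
  have toA : ∀ {x : Circle × Circle}, x ∈ S.domainD arcIco G → x.swap ∈ S.domainA arcIco G := by
    intro x hx
    rw [← sw₀] at hx
    obtain ⟨y, hy, rfl⟩ := hx
    exact hy
  have mapA : ∀ x ∈ S.domainA arcIco G, S.extMap A x ∈ S.domainA arcIco G ∧
      S.extMap (S.dualParameter G) (S.extMap A x).swap = x.swap := fun x hx => by
    have h1 := extMap_mem_domainA_core hg hA hG hx
    exact ⟨toA (mem_domainD_iff_column.2 ⟨_, h1⟩),
      extMap_dual_swap_extMap hg hG (mem_arc_of_mem_columnD isArcKind_arcIco hg L h1)⟩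
  have mapD : ∀ x ∈ S.domainD arcIco G,
      S.extMap (S.dualParameter G) x ∈ S.domainD arcIco G ∧
      S.extMap A (S.extMap (S.dualParameter G) x).swap = x.swap := fun x hx => by
    obtain ⟨h1, h2⟩ := extMap_swap_extMap_dual hg hA hG hx
    exact ⟨toD h1, h2⟩
  have bijA : Set.BijOn (S.extMap A) (S.domainA arcIco G) (S.domainA arcIco G) := by
    -- The two-sided inverse of `F_A` is `F_D` conjugated by the swap, and conversely below.
    refine Set.InvOn.bijOn (f' := fun x => (S.extMap (S.dualParameter G) x.swap).swap)
      ⟨fun x hx => ?_, fun x hx => ?_⟩ (fun x hx => (mapA x hx).1)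
      (fun x hx => toA (mapD _ (toD hx)).1)
    · dsimp only
      rw [(mapA x hx).2, Prod.swap_swap]
    · dsimp only
      rw [(mapD _ (toD hx)).2, Prod.swap_swap]
  have bijD : Set.BijOn (S.extMap (S.dualParameter G)) (S.domainD arcIco G)
      (S.domainD arcIco G) := by
    refine Set.InvOn.bijOn (f' := fun x => (S.extMap A x.swap).swap)
      ⟨fun x hx => ?_, fun x hx => ?_⟩ (fun x hx => (mapD x hx).1)
      (fun x hx => toD (mapA _ (toA hx)).1)
    · dsimp only
      rw [(mapD x hx).2, Prod.swap_swap]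
    · dsimp only
      rw [(mapA _ (toA hx)).2, Prod.swap_swap]
  have rect := hasFiniteRectangularStructure_domainA hg L
  have subA : S.domainA arcIco G ⊆ S.domainA arcIcc G := by
    refine Set.iUnion_mono fun i => Set.union_subset_union ?_ ?_ <;>
      exact Set.prod_mono (arcIco_subset_arcIcc _ _) (arcIco_subset_arcIcc _ _)
  refine
    { parameterA := hA.isParameterChoice
      parameterD := hG.dualParameter_mem hg
      domain_A := ⟨rect, fun x hx => extMap_mem_domainA hg hA hG hx, subA,
        interior_domainA_subset hg L, bijA⟩
      domain_D := ⟨sw ▸ rect.image_swap, fun x hx => extMap_dual_mem_domainD hg hA hG hx,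
        ?_, ?_, bijD⟩
      swap_image := sw
      swap_image_core := sw₀
      inverse := fun x hx => ?_
      inverse_closed := ?_ }
  · rw [← sw, ← sw₀]
    exact Set.image_mono subA
  · rw [← sw, ← sw₀]
    have e := (Homeomorph.prodComm Circle Circle).image_interior (S.domainA arcIcc G)
    rw [Homeomorph.coe_prodComm] at e
    rw [← e]
    exact Set.image_mono (interior_domainA_subset hg L)
  · have hx' := bijA.surjOn hx
    have h1 := Function.invFunOn_mem hx'
    have h2 := (mapA _ h1).2
    rw [Function.invFunOn_eq hx'] at h2
    exact h2.symm
  · rintro _ - hu x hx rfl hw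
    exact (extMap_dual_swap_extMap hg hG (extMap_mem_arcIco_of_closed hg hA hG hx hw hu)).symm

/-! ### Codes of orbits -/

theorem pastIsDualFuture_of_mem_arcIco (hg : 2 ≤ g) (hG : S.IsSystemSolution A G)
    {x : ℤ → Circle × Circle} (hx : ∀ k, S.extMap A (x k) = x (k + 1))
    (hu : ∀ k, (S.extMap A (x k)).1 ∈
      arcIco (S.dualParameter G (sidePairing g (arcIndex A (x k).2)))
        (S.dualParameter G (sidePairing g (arcIndex A (x k).2) + 1))) :
    S.PastIsDualFuture A (S.dualParameter G) x := by
  have future : ∀ k : ℕ, (S.boundaryMap A)^[k] (x 0).2 = (x k).2 := by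
    intro k
    induction k with
    | zero => rfl
    | succ k ih =>
      rw [Function.iterate_succ_apply', ih]
      push_cast
      rw [← hx]
      rfl
  have past : ∀ k : ℕ, (S.boundaryMap (S.dualParameter G))^[k] (x 0).1 = (x (-(k : ℤ))).1 := by
    intro k
    induction k with
    | zero => rfl
    | succ k ih =>
      -- One backward step of the orbit is one forward step of `F_D` after the swap, so on the
      -- coordinate `u` it is a step of `f_D`.
      have e := congrArg Prod.snd (extMap_dual_swap_extMap hg hG (hu (-(k : ℤ) - 1)))
      rw [hx, sub_add_cancel] at e
      rw [Function.iterate_succ_apply', ih, show -((k + 1 : ℕ) : ℤ) = -(k : ℤ) - 1 by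
        push_cast; ring]
      exact e
  refine ⟨fun k => by rw [future]; rfl, fun k => ?_⟩
  have h1 := hu (-(k : ℤ) - 1)
  rw [hx, sub_add_cancel] at h1
  rw [past]
  exact h1

end FundamentalPolygon

theorem mainTheorem3 (g : ℕ) (hg : 2 ≤ g) (S : FundamentalPolygon g)
    (A : ZMod (8 * g - 4) → Circle) (hA : S.IsExtremal A) :
    (∃! G : ZMod (8 * g - 4) → Circle, S.IsSystemSolution A G) ∧
    ∀ G : ZMod (8 * g - 4) → Circle, S.IsSystemSolution A G →
      S.IsDual A (S.dualParameter G)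
        (S.domainA arcIcc G) (S.domainA arcIco G) (S.domainD arcIcc G) (S.domainD arcIco G) ∧
      (∀ p : ℤ → Circle × Circle, (∀ k, p k ∈ S.domainA arcIco G) →
        (∀ k, S.extMap A (p k) = p (k + 1)) →
        S.PastIsDualFuture A (S.dualParameter G) p) ∧
      (∀ p : ℤ → Circle × Circle, (∀ k, p k ∈ S.domainA arcIcc G) →
        (∀ k, S.extMap A (p k) = p (k + 1)) →
        (∀ k, (p k).2 ∉ Set.range A) → (∀ k, (p k).1 ∉ Set.range (S.dualParameter G)) →
        S.PastIsDualFuture A (S.dualParameter G) p) := by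
  refine ⟨FundamentalPolygon.existsUnique_isSystemSolution hg hA, fun G hG =>
    ⟨FundamentalPolygon.isDual_dualParameter hg hA hG, fun x hx hF => ?_,
      fun x hx hF hw hu => ?_⟩⟩
  · obtain ⟨p, q, d, g', h, L⟩ := hG.exists_isDomainLift hg hA
    exact FundamentalPolygon.pastIsDualFuture_of_mem_arcIco hg hG hF fun k =>
      FundamentalPolygon.mem_arc_of_mem_columnD isArcKind_arcIco hg L
        (FundamentalPolygon.extMap_mem_domainA_core hg hA hG (hx k))
  · refine FundamentalPolygon.pastIsDualFuture_of_mem_arcIco hg hG hF fun k =>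
      FundamentalPolygon.extMap_mem_arcIco_of_closed hg hA hG (hx k) (hw k) ?_
    rw [hF]
    exact hu _
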